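/- Let $S=\mathbb{C}\cup\{\infty\}$ be the 2-sphere with four marked points (punctures) $L=-1$, $U=e^{i\pi/3}$, $D=e^{-i\pi/3}$ and $O=\infty$; let $M=\{L,U,D,O\}$. An *arc* is the homotopy class in $S\setminus M$ (endpoints fixed) of a non-contractible curve without self-intersections connecting two marked points and meeting $M$ only at its ends; a curve and its inverse are identified. Two arcs are *compatible* if they are equal or contain such curves that do not intersect in $S\setminus M$. For $p\in\mathbb{Q}_\infty=\mathbb{Q}\cup\{\infty\}$ write $p=a(p)/b(p)$ with $a(p),b(p)$ coprime integers, $b(p)\ge 0$ (and $a(\infty)=1$, $b(\infty)=0$). The inner arc $\alpha_p^{+}$ and the outer arc $\alpha_p^{-}$ are the classes of the following curves. * $\alpha_0^+,\alpha_\infty^+,\alpha_{-1}^+$ are the segments $LD$, $LU$, $UD$, and $\alpha_0^-,\alpha_\infty^-,\alpha_{-1}^-$ are the half-lines from $U$, $D$, $L$ to $O$ pointing radially away from the triangle $LUD$. * Let $p=r/s$ with $r,s>0$ coprime. For $\alpha_p^+$ draw $\lfloor r/2\rfloor$ semicircles with centre $U$ and $\lfloor s/2\rfloor$ semicircles with centre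 $D$, all open to the left and mutually disjoint, and $\lfloor (r+s)/2\rfloor$ distinct semicircles with centre $L$ open to the right. The endpoints of the semicircles around $U$ and $D$, together with $U$ (resp. $D$) if $r$ (resp. $s$) is odd, are $\kappa_1,\dots,\kappa_{r+s}$, numbered from top to bottom; the endpoints of the semicircles around $L$, together with $L$ if $r+s$ is odd, are $\lambda_1,\dots,\lambda_{r+s}$, numbered from top to bottom. Join $\kappa_i$ and $\lambda_i$ by a segment for each $i$. * For $\alpha_p^-$ with $p=r/s$ as before, do the same with $r-1$, $s-1$, $r+s-1$ instead of $r$, $s$, $r+s$ as numbers of points around $U$, $D$, $L$; the points around $U$ are $\kappa_1,\dots,\kappa_{r-1}$, those around $D$ are $\kappa_{r+1},\dots,\kappa_{r+s-1}$, and an additional point $\kappa_r$ is placed vertically between these two groups and between $U$ and $D$. Join $\kappa_i$ and $\lambda_i$ by a segment for $1\le i\le r+s-1$, and join $\kappa_r$ with $O$ by a horizontal half-line to the right. * For $p=r/s<0$, $s>0$, $p\neq -1$, make the same construction after a rotation of the triangle: with the numbers $|r|,|s|,|r+s|$ attached to $U,D,L$, the puncture with the largest number takes the role that $L$ has for positive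 $p$. Then for all $p,q\in\mathbb{Q}_\infty$ and $\varepsilon,\varphi\in\{+,-\}$ the arcs $\alpha_p^\varepsilon$ and $\alpha_q^\varphi$ are well defined, and they are compatible if and only if $$|a(q)b(p)-a(p)b(q)|\le\begin{cases}2,&\text{if }\varepsilon=\varphi,\\ 1,&\text{if }\varepsilon\ne\varphi.\end{cases}$$ -/

import Mathlib

open scoped unitInterval

noncomputable section

namespace FourPuncturedSphere

/-! ### Slopes -/

/-- The numerator `a(q)` of a slope `q ∈ ℚ ∪ {∞}`; `a(∞) = 1`. -/
def slopeNum (q : OnePoint ℚ) : ℤ := q.elim 1 (fun x => x.num)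

/-- The denominator `b(q) ≥ 0` of a slope `q ∈ ℚ ∪ {∞}`; `b(∞) = 0`. -/
def slopeDen (q : OnePoint ℚ) : ℤ := q.elim 0 (fun x => (x.den : ℤ))

/-- The distance `|a(q) b(p) - a(p) b(q)|` of two slopes. -/
def slopeDist (p q : OnePoint ℚ) : ℤ :=
  |slopeNum q * slopeDen p - slopeNum p * slopeDen q|

/-! ### The sphere with four punctures -/

/-- The 2-sphere, as the Riemann sphere `ℂ ∪ {∞}`. -/
abbrev Sphere : Type := OnePoint ℂ

/-- The left puncture. -/
def L : ℂ := -1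

/-- The upper right puncture. -/
def U : ℂ := ⟨1 / 2, √3 / 2⟩

/-- The lower right puncture. Together with `L` and `U` it spans an equilateral triangle of side
`√3` centred at `0`, with `U` vertically above `D`. -/
def D : ℂ := ⟨1 / 2, -(√3 / 2)⟩

/-- The four marked points `L`, `U`, `D` and `O = ∞`. -/
def marked : Set Sphere := {(L : Sphere), (U : Sphere), (D : Sphere), OnePoint.infty}

/-! ### Arcs and their compatibility -/

/-- A curve that runs from a marked point to a marked point and meets no marked point in between. -/
def IsMarkedCurve (f : C(I, Sphere)) : Prop :=
  ∀ s : I, f s ∈ marked ↔ s = 0 ∨ s = 1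

/-- A marked curve is contractible if it can be deformed, through marked curves, to the constant
curve at its starting point. -/
def IsContractible (f : C(I, Sphere)) : Prop :=
  ∃ H : C(I × I, Sphere),
    (∀ s, H (0, s) = f s) ∧ (∀ s, H (1, s) = f 0) ∧
      ∀ t s : I, t ≠ 1 → (H (t, s) ∈ marked ↔ s = 0 ∨ s = 1)

/-- A curve without self-intersections (except that its two endpoints may coincide) that connects
two marked points and is not contractible. -/
structure ArcCurve where
  /-- the underlying parametrized curve -/
  toMap : C(I, Sphere)
  isMarked : IsMarkedCurve toMap
  simple : ∀ s t : I, toMap s = toMap t → s = t ∨ (s = 0 ∧ t = 1) ∨ (s = 1 ∧ t = 0)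
  not_contractible : ¬ IsContractible toMap

/-- The points of a curve. -/
def ArcCurve.trace (γ : ArcCurve) : Set Sphere := Set.range γ.toMap

/-- The inverse curve. -/
def reverse (f : C(I, Sphere)) : C(I, Sphere) := f.comp ⟨unitInterval.symm, by fun_prop⟩

/-- Homotopy in the complement of the marked points: all intermediate curves are marked curves
(so that the endpoints, which vary continuously in the finite set `marked`, stay fixed). -/
def Homotopic (f g : C(I, Sphere)) : Prop := ContinuousMap.HomotopicWith f g IsMarkedCurve

theorem reverse_reverse (f : C(I, Sphere)) : reverse (reverse f) = f := by
  ext s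
  simp [reverse]

theorem Homotopic.reverse {f g : C(I, Sphere)} (h : Homotopic f g) :
    Homotopic (reverse f) (reverse g) := by
  obtain ⟨H⟩ := h
  refine ⟨⟨⟨⟨fun x => H (x.1, unitInterval.symm x.2), by fun_prop⟩, ?_, ?_⟩, ?_⟩⟩
  · intro s
    exact H.apply_zero _
  · intro s
    exact H.apply_one _
  · intro t s
    have h2 := H.prop' t (unitInterval.symm s)
    have e1 : unitInterval.symm s = 0 ↔ s = 1 := by
      rw [← unitInterval.symm_one, unitInterval.symm_inj]
    have e2 : unitInterval.symm s = 1 ↔ s = 0 := by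
      rw [← unitInterval.symm_zero, unitInterval.symm_inj]
    rw [e1, e2, or_comm] at h2
    exact h2

/-- Two curves are identified if they are homotopic up to inversion. -/
instance ArcCurve.setoid : Setoid ArcCurve where
  r γ δ := Homotopic γ.toMap δ.toMap ∨ Homotopic γ.toMap (reverse δ.toMap)
  iseqv :=
    { refl := fun γ => Or.inl (ContinuousMap.HomotopicWith.refl γ.toMap γ.isMarked)
      symm := by
        rintro γ δ (h | h)
        · exact Or.inl h.symm
        · have h2 := Homotopic.reverse h.symm
          rw [reverse_reverse] at h2
          exact Or.inr h2
      trans := by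
        rintro γ δ η (h | h) (k | k)
        · exact Or.inl (h.trans k)
        · exact Or.inr (h.trans k)
        · exact Or.inr (h.trans (Homotopic.reverse k))
        · have k2 := Homotopic.reverse k
          rw [reverse_reverse] at k2
          exact Or.inl (h.trans k2) }

/-- An (untagged) arc: the homotopy class, up to inversion, of a curve without self-intersections
connecting two marked points. -/
def Arc : Type := Quotient ArcCurve.setoid

/-- The arc represented by a curve. -/
def ArcCurve.toArc (γ : ArcCurve) : Arc := Quotient.mk ArcCurve.setoid γ

/-- Two arcs are compatible if they contain curves that do not intersect outside the marked points;
each arc is compatible with itself. -/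
def Compatible (α β : Arc) : Prop :=
  α = β ∨ ∃ γ δ : ArcCurve, γ.toArc = α ∧ δ.toArc = β ∧ γ.trace ∩ δ.trace ⊆ marked

/-- `α` is the arc that is drawn as the point set `X`: the class of a curve with trace `X`, and the
only such class. -/
def Arc.IsDrawnAs (α : Arc) (X : Set Sphere) : Prop :=
  ∀ β : Arc, (∃ γ : ArcCurve, γ.trace = X ∧ γ.toArc = β) ↔ β = α

/-! ### The construction of the arcs `α_p^+` and `α_p^-` -/

/-- The two kinds of arcs: inner arcs (sign `+`) and outer arcs (sign `-`). -/
inductive Kind : Type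
  | inner : Kind
  | outer : Kind
  deriving DecidableEq

/-- The semicircle with centre `c` and radius `ρ` that is open to the left. -/
def semicircleOpenLeft (c : ℂ) (ρ : ℝ) : Set ℂ := {z | ‖z - c‖ = ρ ∧ c.re ≤ z.re}

/-- The semicircle with centre `c` and radius `ρ` that is open to the right. -/
def semicircleOpenRight (c : ℂ) (ρ : ℝ) : Set ℂ := {z | ‖z - c‖ = ρ ∧ z.re ≤ c.re}

/-- The `i`-th point from the top (`1 ≤ i ≤ m`) of `m` points with spacing `2 h` on the vertical
line through `c`, placed symmetrically about `c`. -/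
def verticalPoint (c : ℂ) (m : ℕ) (h : ℝ) (i : ℕ) : ℂ :=
  ⟨c.re, c.im + ((m : ℝ) + 1 - 2 * (i : ℝ)) * h⟩

/-- The `⌊m/2⌋` semicircles with centre `c`, open to the left, whose endpoints are, together with
`c` if `m` is odd, the points `verticalPoint c m h i` for `1 ≤ i ≤ m`. -/
def capsOpenLeft (c : ℂ) (m : ℕ) (h : ℝ) : Set ℂ :=
  ⋃ j ∈ Finset.range (m / 2), semicircleOpenLeft c (((m : ℝ) - 1 - 2 * (j : ℝ)) * h)

/-- The `⌊m/2⌋` semicircles with centre `c`, open to the right, whose endpoints are, together with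
`c` if `m` is odd, the points `verticalPoint c m h i` for `1 ≤ i ≤ m`. -/
def capsOpenRight (c : ℂ) (m : ℕ) (h : ℝ) : Set ℂ :=
  ⋃ j ∈ Finset.range (m / 2), semicircleOpenRight c (((m : ℝ) - 1 - 2 * (j : ℝ)) * h)

/-- Half the distance of neighbouring points `κ_i` and `κ_{i+1}`. -/
def halfStep (r s : ℕ) : ℝ := √3 / ((r : ℝ) + (s : ℝ))

/-- The points `κ_i`, `1 ≤ i ≤ r + s`, for inner arcs: `r` points around `U` followed by `s` points
around `D`. -/
def kappaInner (r s i : ℕ) : ℂ :=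
  if i ≤ r then verticalPoint U r (halfStep r s) i else verticalPoint D s (halfStep r s) (i - r)

/-- The points `κ_i`, `1 ≤ i ≤ r + s - 1`, for outer arcs: `r - 1` points around `U`, an additional
point `κ_r`, and `s - 1` points around `D`. -/
def kappaOuter (r s i : ℕ) : ℂ :=
  if i < r then verticalPoint U (r - 1) (halfStep r s) i
  else if i = r then ⟨U.re, U.im - (r : ℝ) * halfStep r s⟩
  else verticalPoint D (s - 1) (halfStep r s) (i - r)

/-- The inner arc of slope `r / s` for coprime `r, s > 0`. -/
def positiveInner (r s : ℕ) : Set ℂ :=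
  capsOpenLeft U r (halfStep r s) ∪ capsOpenLeft D s (halfStep r s) ∪
    capsOpenRight L (r + s) (halfStep r s) ∪
    ⋃ i ∈ Finset.Icc 1 (r + s),
      segment ℝ (kappaInner r s i) (verticalPoint L (r + s) (halfStep r s) i)

/-- The outer arc of slope `r / s` for coprime `r, s > 0`, without its endpoint `O = ∞`; the
last set is the horizontal half-line from `κ_r` to `O`. -/
def positiveOuter (r s : ℕ) : Set ℂ :=
  capsOpenLeft U (r - 1) (halfStep r s) ∪ capsOpenLeft D (s - 1) (halfStep r s) ∪
    capsOpenRight L (r + s - 1) (halfStep r s) ∪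
    (⋃ i ∈ Finset.Icc 1 (r + s - 1),
      segment ℝ (kappaOuter r s i) (verticalPoint L (r + s - 1) (halfStep r s) i)) ∪
    {z | (kappaOuter r s r).re ≤ z.re ∧ z.im = (kappaOuter r s r).im}

/-- The arc of the given kind and of slope `r / s` for coprime `r, s > 0`, without `O`. -/
def positiveArc (r s : ℕ) : Kind → Set ℂ
  | Kind.inner => positiveInner r s
  | Kind.outer => positiveOuter r s

/-- The half-line from the puncture `c` to `O`, pointing away from the triangle, without `O`. -/
def outwardRay (c : ℂ) : Set ℂ := {z | ∃ t : ℝ, 1 ≤ t ∧ z = (t : ℂ) * c}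

/-- The three pairs of arcs of lowest complexity: an inner arc is the side `c c'` of the triangle,
the outer arc connects the remaining puncture `d` with `O`. -/
def lowArc (c c' d : ℂ) : Kind → Set ℂ
  | Kind.inner => segment ℝ c c'
  | Kind.outer => outwardRay d

/-- The rotation by `2π/3` about the centre of the triangle; it maps `L` to `D`, `D` to `U` and
`U` to `L`. -/
def rotate (z : ℂ) : ℂ := (⟨-(1 / 2), √3 / 2⟩ : ℂ) * z

/-- The part in `ℂ` of the arc of slope `r / s` (`r, s` coprime, `s ≥ 0`). For a negative slope,
the roles of the three punctures are exchanged by a rotation: the puncture with the largest of the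
three numbers `|r|` (at `U`), `|s|` (at `D`), `|r + s|` (at `L`) takes the role that `L` has for
positive slopes. -/
def planarArc (r s : ℤ) (ε : Kind) : Set ℂ :=
  if r = 0 then lowArc L D U ε
  else if s = 0 then lowArc L U D ε
  else if r + s = 0 then lowArc U D L ε
  else if 0 < r then positiveArc r.natAbs s.natAbs ε
  else if 0 < r + s then rotate '' positiveArc (r + s).natAbs r.natAbs ε
  else rotate '' (rotate '' positiveArc s.natAbs (r + s).natAbs ε)

/-- The drawing on the sphere of the arc `α_p^+` (inner) or `α_p^-` (outer). -/
def drawing (p : OnePoint ℚ) (ε : Kind) : Set Sphere :=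
  (fun z : ℂ => (z : Sphere)) '' planarArc (slopeNum p) (slopeDen p) ε ∪
    {x | ε = Kind.outer ∧ x = OnePoint.infty}

end FourPuncturedSphere

end

noncomputable section

namespace FourPuncturedSphere

open Topology Filter
open scoped ComplexConjugate

/-! The four-punctured sphere is a pillowcase: the quotient of the plane by the group generated by
the translations by `2 ℤ²` and the half turns about lattice points, with the images of `ℤ²` as
marked points. Concretely, triangle waves fold the plane onto the surface of a tetrahedron, which
`toSphere` identifies with the sphere. The composite `cover` is a covering away from the marked
points (`isCoveringMapOn_cover`). A segment from a lattice point `x` to `x + v` with `v` primitive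
becomes an arc, `segmentArc`. Its direction `v = (b, a)` encodes the slope `a / b`, and the parity
of `det (v, x)` separates the two arcs of this slope: it is even for the outer arc, which ends at
`O`, the image of `2 ℤ²`, and odd for the inner arc.

For straight arcs of different slopes compatibility is arithmetic. If two segments meet in the
sphere, the parameter of the meeting point times `det (v, v')` is an integer of known parity; a
small determinant then forces the parameter to be `0` or `1` (`compatible_of_abs_idet_le`).
Conversely, by homotopy lifting every curve in the class of a segment has a lift with the same two
ends (`exists_lift_of_homotopy`). Half turns extend this lift to a curve at bounded distance from a
line, and two such curves of different directions cross, by a winding number argument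
(`exists_crossing`). If the two curves on the sphere meet in marked points only, every crossing
happens at lattice points, also after translating one curve by any vector of `2 ℤ²`. Hence `2 ℤ²`
lies in the lattice spanned by `v` and `v'`, so the determinant divides `2`, and it can be `±2` only
if the parities agree (`abs_idet_le_of_compatible`).

It remains to see that the drawn curves are these arcs. For positive slopes, `drawPoint` sends the
lines of the given slope on the tetrahedron piece by piece to the semicircles, segments and ray of
the drawing. It is injective and keeps each face in its sector of the plane, so the affine
interpolation `blend` between straight and drawn curve never passes through a marked point in
between (`drawnArc_toArc`). The remaining slopes are reached by the rotation of order three, which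
lifts to a linear automorphism of the lattice. Finally, a simple arc with distinct ends is
determined by its point set (`ArcCurve.isDrawnAs`), so each drawing defines one arc. -/

/-! ### The triangle wave -/

/-- The triangle wave of period `2` with value `|x|` on `[-1, 1]`. -/
def tri (x : ℝ) : ℝ := Real.arccos (Real.cos (Real.pi * x)) / Real.pi

theorem continuous_tri : Continuous tri := by
  unfold tri
  fun_prop

theorem tri_mem (x : ℝ) : tri x ∈ Set.Icc (0 : ℝ) 1 := by
  refine ⟨div_nonneg (Real.arccos_nonneg _) Real.pi_pos.le, ?_⟩
  rw [tri, div_le_one Real.pi_pos]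
  exact Real.arccos_le_pi _

/-- The wave is an injective function of `cos (π x)`, so its fibres are the orbits of the infinite
dihedral group generated by `x ↦ -x` and `x ↦ x + 2`. -/
theorem tri_eq_iff {x y : ℝ} : tri x = tri y ↔ ∃ k : ℤ, y = 2 * k + x ∨ y = 2 * k - x := by
  have hpi := Real.pi_pos
  have h1 : tri x = tri y ↔ Real.cos (Real.pi * x) = Real.cos (Real.pi * y) := by
    unfold tri
    constructor
    · intro h
      have h2 : Real.arccos (Real.cos (Real.pi * x)) = Real.arccos (Real.cos (Real.pi * y)) := by
        field_simp at h
        exact h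
      exact Real.arccos_injOn ⟨Real.neg_one_le_cos _, Real.cos_le_one _⟩
        ⟨Real.neg_one_le_cos _, Real.cos_le_one _⟩ h2
    · intro h
      rw [h]
  rw [h1, Real.cos_eq_cos_iff]
  refine exists_congr fun k => or_congr ?_ ?_
  · constructor
    · intro h
      apply mul_left_cancel₀ hpi.ne'
      linarith
    · rintro rfl
      ring
  · constructor
    · intro h
      apply mul_left_cancel₀ hpi.ne'
      linarith
    · rintro rfl
      ring

theorem tri_neg (x : ℝ) : tri (-x) = tri x := tri_eq_iff.2 ⟨0, Or.inr (by simp)⟩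

theorem tri_add_two_mul (x : ℝ) (k : ℤ) : tri (x + 2 * k) = tri x :=
  tri_eq_iff.2 ⟨-k, Or.inl (by push_cast; ring)⟩

theorem tri_of_nonneg {x : ℝ} (h0 : 0 ≤ x) (h1 : x ≤ 1) : tri x = x := by
  have hpi := Real.pi_pos
  rw [tri, Real.arccos_cos (by positivity) (by nlinarith)]
  field_simp

theorem tri_abs (x : ℝ) : tri |x| = tri x := by
  rcases abs_choice x with h | h <;> rw [h]
  exact tri_neg x

theorem tri_of_abs_le {x : ℝ} (h : |x| ≤ 1) : tri x = |x| := by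
  rw [← tri_abs, tri_of_nonneg (abs_nonneg x) h]

theorem tri_of_one_le {x : ℝ} (h1 : 1 ≤ x) (h2 : x ≤ 2) : tri x = 2 - x := by
  rw [← tri_of_nonneg (x := 2 - x) (by linarith) (by linarith)]
  exact tri_eq_iff.2 ⟨1, Or.inr (by norm_num)⟩

theorem exists_eq_two_mul_add_tri (x : ℝ) : ∃ k : ℤ, x = 2 * k + tri x ∨ x = 2 * k - tri x := by
  have h : tri (tri x) = tri x := tri_of_nonneg (tri_mem x).1 (tri_mem x).2
  exact tri_eq_iff.1 h

/-- The third side: the value of the triangle wave at `x + y`. -/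
theorem tri_add_cases (x y : ℝ) :
    tri (x + y) = |tri x - tri y| ∨ tri (x + y) = tri (tri x + tri y) := by
  have hx := tri_mem x
  have hy := tri_mem y
  obtain ⟨j, hj⟩ := exists_eq_two_mul_add_tri x
  obtain ⟨k, hk⟩ := exists_eq_two_mul_add_tri y
  have hd : tri (tri x - tri y) = |tri x - tri y| :=
    tri_of_abs_le (abs_le.2 ⟨by linarith [hx.1, hy.2], by linarith [hx.2, hy.1]⟩)
  -- Equal signs in the two representations add the wave values, opposite signs subtract them.
  rcases hj with hj | hj <;> rcases hk with hk | hk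
  · right
    exact tri_eq_iff.2 ⟨-(j + k), Or.inl (by push_cast; linarith)⟩
  · left
    rw [← hd]
    exact tri_eq_iff.2 ⟨-(j + k), Or.inl (by push_cast; linarith)⟩
  · left
    rw [← hd]
    exact tri_eq_iff.2 ⟨(j + k), Or.inr (by push_cast; linarith)⟩
  · right
    exact tri_eq_iff.2 ⟨(j + k), Or.inr (by push_cast; linarith)⟩

/-! ### Barycentric coordinates on the surface of a tetrahedron -/

/-- Barycentric coordinates with respect to `L`, `U`, `D`; the coordinate that belongs to `O` is
determined by the others. -/
@[ext] structure Weights where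
  l : ℝ
  u : ℝ
  d : ℝ

/-- The weight of `O`. -/
def Weights.o (b : Weights) : ℝ := 1 - b.l - b.u - b.d

/-- The surface of the tetrahedron. -/
structure Weights.OnSurface (b : Weights) : Prop where
  l_nonneg : 0 ≤ b.l
  u_nonneg : 0 ≤ b.u
  d_nonneg : 0 ≤ b.d
  o_nonneg : 0 ≤ b.o
  face : b.o = 0 ∨ b.l = 0 ∨ b.u = 0 ∨ b.d = 0

/-- The folding map of the plane onto the surface of a tetrahedron. -/
def weights (w : ℝ × ℝ) : Weights :=
  ⟨(tri w.1 + tri w.2 - tri (w.1 + w.2)) / 2, (tri w.1 + tri (w.1 + w.2) - tri w.2) / 2,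
    (tri w.2 + tri (w.1 + w.2) - tri w.1) / 2⟩

theorem weights_o (w : ℝ × ℝ) :
    (weights w).o = 1 - (tri w.1 + tri w.2 + tri (w.1 + w.2)) / 2 := by
  simp only [Weights.o, weights]
  ring

/-- The waves at `w.1`, `w.2` and `w.1 + w.2` are the sums `l + u`, `l + d` and `u + d`. By
`tri_add_cases` the third is the difference of the other two in one order, their sum, or `2` minus
their sum; these alternatives say that `u`, `d`, `l` or `o` vanishes. -/
theorem weights_onSurface (w : ℝ × ℝ) : (weights w).OnSurface := by
  have hx := tri_mem w.1
  have hy := tri_mem w.2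
  have ho := weights_o w
  rcases tri_add_cases w.1 w.2 with h | h
  · rcases le_total (tri w.1) (tri w.2) with hle | hle
    · rw [abs_of_nonpos (by linarith)] at h
      constructor <;> (try rw [ho]) <;> simp only [weights, h] <;>
        first | linarith [hx.1, hx.2, hy.1, hy.2] | (right; right; left; linarith)
    · rw [abs_of_nonneg (by linarith)] at h
      constructor <;> (try rw [ho]) <;> simp only [weights, h] <;>
        first | linarith [hx.1, hx.2, hy.1, hy.2] | (right; right; right; linarith)
  · rcases le_total (tri w.1 + tri w.2) 1 with hle | hle
    · rw [tri_of_nonneg (by linarith [hx.1, hy.1]) hle] at h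
      constructor <;> (try rw [ho]) <;> simp only [weights, h] <;>
        first | linarith [hx.1, hx.2, hy.1, hy.2] | (right; left; linarith)
    · rw [tri_of_one_le hle (by linarith [hx.2, hy.2])] at h
      constructor <;> (try rw [ho]) <;> simp only [weights, h] <;>
        first | linarith [hx.1, hx.2, hy.1, hy.2] | (left; linarith)

/-- Two points of the plane have the same image if and only if they are exchanged by a translation
by `2 ℤ²` or by a half turn about a lattice point. -/
theorem weights_eq_iff {w w' : ℝ × ℝ} :
    weights w = weights w' ↔
      ∃ j k : ℤ, w' = (2 * j + w.1, 2 * k + w.2) ∨ w' = (2 * j - w.1, 2 * k - w.2) := by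
  constructor
  · intro h
    have h1 := congrArg Weights.l h
    have h2 := congrArg Weights.u h
    have h3 := congrArg Weights.d h
    simp only [weights] at h1 h2 h3
    have e1 : tri w.1 = tri w'.1 := by linarith
    have e2 : tri w.2 = tri w'.2 := by linarith
    have e3 : tri (w.1 + w.2) = tri (w'.1 + w'.2) := by linarith
    obtain ⟨j, hj⟩ := tri_eq_iff.1 e1
    obtain ⟨k, hk⟩ := tri_eq_iff.1 e2
    obtain ⟨i, hi⟩ := tri_eq_iff.1 e3
    rcases hj with hj | hj <;> rcases hk with hk | hk
    · exact ⟨j, k, Or.inl (Prod.ext hj hk)⟩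
    -- The two coordinates suggest different signs; the wave at the sum of the coordinates decides
    -- which of them has to be rewritten.
    · rcases hi with hi | hi
      · refine ⟨j, i - j, Or.inl (Prod.ext hj ?_)⟩
        push_cast
        linarith
      · refine ⟨i - k, k, Or.inr (Prod.ext ?_ hk)⟩
        push_cast
        linarith
    · rcases hi with hi | hi
      · refine ⟨i - k, k, Or.inl (Prod.ext ?_ hk)⟩
        push_cast
        linarith
      · refine ⟨j, i - j, Or.inr (Prod.ext hj ?_)⟩
        push_cast
        linarith
    · exact ⟨j, k, Or.inr (Prod.ext hj hk)⟩
  · rintro ⟨j, k, rfl | rfl⟩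
    · have e1 : tri (2 * j + w.1) = tri w.1 := by rw [add_comm, tri_add_two_mul]
      have e2 : tri (2 * k + w.2) = tri w.2 := by rw [add_comm, tri_add_two_mul]
      have e3 : tri (2 * j + w.1 + (2 * k + w.2)) = tri (w.1 + w.2) := by
        rw [← tri_add_two_mul (w.1 + w.2) (j + k)]
        push_cast
        ring_nf
      simp only [weights, e1, e2, e3]
    · have e1 : tri (2 * j - w.1) = tri w.1 := (tri_eq_iff.2 ⟨j, Or.inr rfl⟩).symm
      have e2 : tri (2 * k - w.2) = tri w.2 := (tri_eq_iff.2 ⟨k, Or.inr rfl⟩).symm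
      have e3 : tri (2 * j - w.1 + (2 * k - w.2)) = tri (w.1 + w.2) :=
        (tri_eq_iff.2 ⟨j + k, Or.inr (by push_cast; ring)⟩).symm
      simp only [weights, e1, e2, e3]

/-- A lift of a point of the surface to the triangle with corners `(0, 0)`, `(2, 0)`, `(2, -2)`. -/
def unfold (b : Weights) : ℝ × ℝ :=
  if b.o = 0 then (b.l + b.u + 2 * b.d, -b.l - b.d)
  else if b.d = 0 then (b.l + b.u, -b.l)
  else if b.u = 0 then (b.l + 2 * b.d + 2 * b.o, -b.l - b.d - 2 * b.o)
  else (b.u + 2 * b.d + 2 * b.o, -b.d)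

theorem weights_unfold {b : Weights} (hb : b.OnSurface) : weights (unfold b) = b := by
  obtain ⟨hl, hu, hd, ho, hf⟩ := hb
  have ho' : b.o = 1 - b.l - b.u - b.d := rfl
  -- The three pairwise sums determine the weights, so each face needs only three values of the
  -- wave.
  have key : ∀ w : ℝ × ℝ, tri w.1 = b.l + b.u → tri w.2 = b.l + b.d →
      tri (w.1 + w.2) = b.u + b.d → weights w = b := by
    intro w h1 h2 h3
    ext <;> simp only [weights, h1, h2, h3] <;> ring
  have neg_case : ∀ y : ℝ, 0 ≤ -y → -y ≤ 1 → tri y = -y := fun y h0 h1 => by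
    rw [← tri_neg, tri_of_nonneg h0 h1]
  have neg_case' : ∀ y : ℝ, 1 ≤ -y → -y ≤ 2 → tri y = 2 + y := fun y h0 h1 => by
    rw [← tri_neg, tri_of_one_le h0 h1]
    ring
  unfold unfold
  split_ifs with c1 c2 c3
  · apply key
    · rw [tri_of_one_le] <;> simp only <;> linarith
    · rw [neg_case] <;> simp only <;> linarith
    · rw [tri_of_nonneg] <;> simp only <;> linarith
  · apply key
    · rw [tri_of_nonneg] <;> simp only <;> linarith
    · rw [neg_case] <;> simp only <;> linarith
    · rw [tri_of_nonneg] <;> simp only <;> linarith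
  · apply key
    · rw [tri_of_one_le] <;> simp only <;> linarith
    · rw [neg_case'] <;> simp only <;> linarith
    · rw [tri_of_nonneg] <;> simp only <;> linarith
  · have c4 : b.l = 0 := by tauto
    apply key
    · rw [tri_of_one_le] <;> simp only <;> linarith
    · rw [neg_case] <;> simp only <;> linarith
    · rw [tri_of_one_le] <;> simp only <;> linarith

/-! ### The branched covering of the sphere by the plane -/

/-- Where `c` tends to `0`, the bound `k ≤ ‖g‖ |c|` pushes `g` out of every compact set. -/
theorem tendsto_infty_of_bound {X : Type*} [TopologicalSpace X] {F : X → Sphere} {g : X → ℂ}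
    {c : X → ℝ} {x₀ : X} {k : ℝ} (hk : 0 < k) (hc : ContinuousAt c x₀) (hc0 : c x₀ = 0)
    (h : ∀ᶠ x in 𝓝 x₀, F x = OnePoint.infty ∨ F x = (g x : Sphere) ∧ k ≤ ‖g x‖ * |c x|) :
    Tendsto F (𝓝 x₀) (𝓝 OnePoint.infty) := by
  intro s hs
  rw [OnePoint.nhds_infty_eq, Filter.mem_sup, Filter.mem_map, Filter.mem_pure,
    Filter.coclosedCompact_eq_cocompact] at hs
  obtain ⟨h1, h2⟩ := hs
  rw [← Metric.cobounded_eq_cocompact, ← comap_norm_atTop] at h1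
  obtain ⟨t, ht, hts⟩ := h1
  obtain ⟨R, hR⟩ := Filter.mem_atTop_sets.1 ht
  have hsmall : ∀ᶠ x in 𝓝 x₀, |c x| * (|R| + 1) < k := by
    have hc' : ContinuousAt (fun x => |c x| * (|R| + 1)) x₀ := hc.abs.mul continuousAt_const
    refine hc'.eventually_lt continuousAt_const ?_
    simpa [hc0] using hk
  rw [Filter.mem_map]
  filter_upwards [h, hsmall] with x hx1 hx2
  rcases hx1 with hx | ⟨hx, hb⟩
  · change F x ∈ s
    rw [hx]
    exact h2
  · change F x ∈ s
    rw [hx]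
    refine hts (hR _ ?_)
    by_contra hlt
    push Not at hlt
    have h3 : ‖g x‖ * |c x| ≤ (|R| + 1) * |c x| := by
      refine mul_le_mul_of_nonneg_right ?_ (abs_nonneg _)
      linarith [le_abs_self R]
    linarith [mul_comm (|R| + 1) |c x|]

/-- The finite part of the identification of the surface of the tetrahedron with the sphere: the
face opposite to `O` is mapped to the triangle `LUD` by an affine map. -/
def affinePoint (b : Weights) : ℂ :=
  ⟨((b.u + b.d) / 2 - b.l) / (1 - b.o) ^ 2, √3 / 2 * (b.u - b.d) / (1 - b.o) ^ 2⟩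

/-- The identification of the surface of the tetrahedron with the sphere. -/
def toSphere (b : Weights) : Sphere :=
  if b.o = 1 then OnePoint.infty else (affinePoint b : Sphere)

theorem sqrt_three_sq : √3 * √3 = (3 : ℝ) := Real.mul_self_sqrt (by norm_num)

theorem sqrt_three_pos : 0 < √(3 : ℝ) := Real.sqrt_pos.2 (by norm_num)

theorem Weights.OnSurface.o_le_one {b : Weights} (hb : b.OnSurface) : b.o ≤ 1 := by
  have := hb.l_nonneg
  have := hb.u_nonneg
  have := hb.d_nonneg
  simp only [Weights.o]
  linarith

/-- Since `L + U + D = 0`, equality in the plane determines the rescaled weights `l, u, d` only up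
to a common summand `k ≥ 0`. If `k > 0`, the weights of `b'` at `L`, `U`, `D` are all positive,
hence `b'.o = 0` and its rescaled weights have sum `1`; but this sum exceeds that of `b`, which is
`1 / (1 - b.o) ≥ 1`, by `3 k`. -/
theorem toSphere_injOn {b b' : Weights} (hb : b.OnSurface) (hb' : b'.OnSurface)
    (h : toSphere b = toSphere b') : b = b' := by
  have vertex : ∀ b : Weights, b.OnSurface → b.o = 1 → b.l = 0 ∧ b.u = 0 ∧ b.d = 0 := by
    intro b hb ho
    have h1 := hb.l_nonneg
    have h2 := hb.u_nonneg
    have h3 := hb.d_nonneg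
    simp only [Weights.o] at ho
    refine ⟨?_, ?_, ?_⟩ <;> linarith
  have main : ∀ b b' : Weights, ∀ k : ℝ, 0 ≤ k → b.OnSurface → b'.OnSurface → 0 < 1 - b.o →
      0 < 1 - b'.o → b'.l / (1 - b'.o) ^ 2 = b.l / (1 - b.o) ^ 2 + k →
      b'.u / (1 - b'.o) ^ 2 = b.u / (1 - b.o) ^ 2 + k →
      b'.d / (1 - b'.o) ^ 2 = b.d / (1 - b.o) ^ 2 + k → b = b' := by
    intro b b' k hk hb hb' hm hm' h1 h2 h3
    have s : ∀ b : Weights, 0 < 1 - b.o →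
        b.l / (1 - b.o) ^ 2 + b.u / (1 - b.o) ^ 2 + b.d / (1 - b.o) ^ 2 = 1 / (1 - b.o) := by
      intro b hm
      have : b.l + b.u + b.d = 1 - b.o := by simp only [Weights.o]; ring
      rw [← add_div, ← add_div, this]
      field_simp
    have hs := s b hm
    have hs' := s b' hm'
    have hk0 : k = 0 := by
      by_contra hne
      have hkp : 0 < k := lt_of_le_of_ne hk (Ne.symm hne)
      have pl : b'.l ≠ 0 := by
        intro h0
        rw [h0, zero_div] at h1
        have : 0 ≤ b.l / (1 - b.o) ^ 2 := div_nonneg hb.l_nonneg (by positivity)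
        linarith
      have pu : b'.u ≠ 0 := by
        intro h0
        rw [h0, zero_div] at h2
        have : 0 ≤ b.u / (1 - b.o) ^ 2 := div_nonneg hb.u_nonneg (by positivity)
        linarith
      have pd : b'.d ≠ 0 := by
        intro h0
        rw [h0, zero_div] at h3
        have : 0 ≤ b.d / (1 - b.o) ^ 2 := div_nonneg hb.d_nonneg (by positivity)
        linarith
      have po : b'.o = 0 := by
        have := hb'.face
        tauto
      rw [po] at h1 h2 h3 hs'
      have : 1 ≤ 1 / (1 - b.o) := by
        rw [le_div_iff₀ hm]
        linarith [hb.o_nonneg]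
      norm_num at h1 h2 h3 hs'
      linarith
    subst hk0
    have he : 1 / (1 - b.o) = 1 / (1 - b'.o) := by linarith
    have he' : 1 - b.o = 1 - b'.o := by
      rw [one_div, one_div] at he
      exact inv_injective he
    rw [← he'] at h1 h2 h3
    have hm2 : (1 - b.o) ^ 2 ≠ 0 := by positivity
    rw [add_zero, div_left_inj' hm2] at h1 h2 h3
    exact Weights.ext h1.symm h2.symm h3.symm
  unfold toSphere at h
  split_ifs at h with c c' c'
  · obtain ⟨h1, h2, h3⟩ := vertex b hb c
    obtain ⟨h1', h2', h3'⟩ := vertex b' hb' c'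
    exact Weights.ext (by rw [h1, h1']) (by rw [h2, h2']) (by rw [h3, h3'])
  · exact absurd h.symm (OnePoint.coe_ne_infty _)
  · exact absurd h (OnePoint.coe_ne_infty _)
  · rw [OnePoint.coe_eq_coe] at h
    have hm : 0 < 1 - b.o := by
      have := hb.o_le_one
      have := lt_of_le_of_ne this c
      linarith
    have hm' : 0 < 1 - b'.o := by
      have := hb'.o_le_one
      have := lt_of_le_of_ne this c'
      linarith
    have hre := congrArg Complex.re h
    have him := congrArg Complex.im h
    simp only [affinePoint] at hre him
    have e : ∀ b : Weights, ((b.u + b.d) / 2 - b.l) / (1 - b.o) ^ 2 =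
        (b.u / (1 - b.o) ^ 2 + b.d / (1 - b.o) ^ 2) / 2 - b.l / (1 - b.o) ^ 2 := fun b => by ring
    rw [e, e] at hre
    rw [mul_div_assoc, mul_div_assoc, sub_div, sub_div] at him
    have him' := mul_left_cancel₀ (by have := sqrt_three_pos; positivity) him
    rcases le_total (b.l / (1 - b.o) ^ 2) (b'.l / (1 - b'.o) ^ 2) with hle | hle
    · exact main b b' (b'.l / (1 - b'.o) ^ 2 - b.l / (1 - b.o) ^ 2) (by linarith) hb hb' hm hm'
        (by ring) (by linarith) (by linarith)
    · exact (main b' b (b.l / (1 - b.o) ^ 2 - b'.l / (1 - b'.o) ^ 2) (by linarith) hb' hb hm' hm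
        (by ring) (by linarith) (by linarith)).symm

/-- The barycentric coordinates of a point of the plane with respect to `L`, `U`, `D`. -/
def baryL (z : ℂ) : ℝ := (1 - 2 * z.re) / 3
/-- The barycentric coordinate that belongs to `U`. -/
def baryU (z : ℂ) : ℝ := (1 + z.re + √3 * z.im) / 3
/-- The barycentric coordinate that belongs to `D`. -/
def baryD (z : ℂ) : ℝ := (1 + z.re - √3 * z.im) / 3

theorem scale_re (x y t : ℝ) {s : ℝ} (hs : s ≠ 0) :
    ((x / s ^ 2 + y / s ^ 2) / 2 - t / s ^ 2) / (1 / s) ^ 2 = (x + y) / 2 - t := by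
  field_simp

theorem scale_im (c x y : ℝ) {s : ℝ} (hs : s ≠ 0) :
    c * (x / s ^ 2 - y / s ^ 2) / (1 / s) ^ 2 = c * (x - y) := by
  field_simp

theorem exists_toSphere_eq (z : Sphere) : ∃ b : Weights, b.OnSurface ∧ toSphere b = z := by
  induction z using OnePoint.rec with
  | infty =>
    refine ⟨⟨0, 0, 0⟩, ⟨le_rfl, le_rfl, le_rfl, ?_, Or.inr (Or.inl rfl)⟩, ?_⟩
    · norm_num [Weights.o]
    · norm_num [toSphere, Weights.o]
  | coe z =>
    -- `m` is the minimum of `0` and the barycentric coordinates of `z`. It selects the face: `m =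
    -- 0` is the triangle, otherwise the weight with the smallest coordinate vanishes. Subtracting
    -- `m` leaves coordinates of sum `1 - 3 m`, which has to equal `1 / (1 - o)`.
    have key : ∀ m : ℝ, m ≤ 0 → m ≤ baryL z → m ≤ baryU z → m ≤ baryD z →
        (m = 0 ∨ m = baryL z ∨ m = baryU z ∨ m = baryD z) →
        ∃ b : Weights, b.OnSurface ∧ toSphere b = z := by
      intro m h0 h1 h2 h3 h4
      have hS : 0 < 1 - 3 * m := by linarith
      have hS0 : 1 - 3 * m ≠ 0 := hS.ne'
      have hsum : baryL z + baryU z + baryD z = 1 := by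
        simp only [baryL, baryU, baryD]
        ring
      have ho : Weights.o ⟨(baryL z - m) / (1 - 3 * m) ^ 2, (baryU z - m) / (1 - 3 * m) ^ 2,
          (baryD z - m) / (1 - 3 * m) ^ 2⟩ = 1 - 1 / (1 - 3 * m) := by
        simp only [Weights.o]
        rw [sub_sub, sub_sub, ← add_assoc, ← add_div, ← add_div,
          show baryL z - m + (baryU z - m) + (baryD z - m) = 1 - 3 * m by linarith]
        field_simp
      refine ⟨⟨(baryL z - m) / (1 - 3 * m) ^ 2, (baryU z - m) / (1 - 3 * m) ^ 2,
        (baryD z - m) / (1 - 3 * m) ^ 2⟩, ⟨?_, ?_, ?_, ?_, ?_⟩, ?_⟩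
      · exact div_nonneg (by linarith) (by positivity)
      · exact div_nonneg (by linarith) (by positivity)
      · exact div_nonneg (by linarith) (by positivity)
      · rw [ho, sub_nonneg, div_le_one hS]
        linarith
      · rw [ho]
        rcases h4 with h | h | h | h
        · left
          rw [h]
          norm_num
        · right; left
          simp [← h]
        · right; right; left
          simp [← h]
        · right; right; right
          simp [← h]
      · unfold toSphere
        rw [if_neg]
        · rw [OnePoint.coe_eq_coe]
          apply Complex.ext
          · simp only [affinePoint, ho, sub_sub_cancel]
            rw [scale_re _ _ _ hS0]
            simp only [baryL, baryU, baryD]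
            ring
          · simp only [affinePoint, ho, sub_sub_cancel]
            rw [scale_im _ _ _ hS0]
            simp only [baryU, baryD]
            linear_combination (z.im / 3) * sqrt_three_sq
        · rw [ho]
          have : 0 < 1 / (1 - 3 * m) := by positivity
          linarith
    rcases min_choice (min 0 (baryL z)) (min (baryU z) (baryD z)) with h | h
    · apply key (min (min 0 (baryL z)) (min (baryU z) (baryD z))) <;> try simp
      rw [h]
      rcases min_choice 0 (baryL z) with h' | h' <;> rw [h'] <;> tauto
    · apply key (min (min 0 (baryL z)) (min (baryU z) (baryD z))) <;> try simp
      rw [h]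
      rcases min_choice (baryU z) (baryD z) with h' | h' <;> rw [h'] <;> tauto

/-- The branched covering of the sphere by the plane. -/
def cover (w : ℝ × ℝ) : Sphere := toSphere (weights w)

theorem cover_eq_iff {w w' : ℝ × ℝ} :
    cover w = cover w' ↔
      ∃ j k : ℤ, w' = (2 * j + w.1, 2 * k + w.2) ∨ w' = (2 * j - w.1, 2 * k - w.2) := by
  rw [← weights_eq_iff]
  exact ⟨toSphere_injOn (weights_onSurface _) (weights_onSurface _), congrArg toSphere⟩

theorem cover_surjective : Function.Surjective cover := by
  intro z
  obtain ⟨b, hb, rfl⟩ := exists_toSphere_eq z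
  exact ⟨unfold b, by rw [cover, weights_unfold hb]⟩

/-- The lattice `ℤ²`. -/
def IsLattice (w : ℝ × ℝ) : Prop := ∃ j k : ℤ, w = ((j : ℝ), (k : ℝ))

theorem tri_even (k : ℤ) : tri (2 * k) = 0 := by
  rw [show (2 * k : ℝ) = 0 + 2 * k by ring, tri_add_two_mul, tri_of_nonneg le_rfl zero_le_one]

theorem toSphere_vertexL : toSphere ⟨1, 0, 0⟩ = (L : Sphere) := by
  norm_num [toSphere, Weights.o, affinePoint, L]
  apply Complex.ext <;> simp

theorem toSphere_vertexU : toSphere ⟨0, 1, 0⟩ = (U : Sphere) := by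
  norm_num [toSphere, Weights.o, affinePoint, U]

theorem toSphere_vertexD : toSphere ⟨0, 0, 1⟩ = (D : Sphere) := by
  norm_num [toSphere, Weights.o, affinePoint, D]

theorem toSphere_vertexO : toSphere ⟨0, 0, 0⟩ = OnePoint.infty := by
  norm_num [toSphere, Weights.o]

/-- The vertices of the tetrahedron. -/
def Weights.IsVertex (b : Weights) : Prop :=
  b = ⟨1, 0, 0⟩ ∨ b = ⟨0, 1, 0⟩ ∨ b = ⟨0, 0, 1⟩ ∨ b = ⟨0, 0, 0⟩

theorem toSphere_mem_marked {b : Weights} (hb : b.OnSurface) :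
    toSphere b ∈ marked ↔ b.IsVertex := by
  have hL : Weights.OnSurface ⟨1, 0, 0⟩ := by constructor <;> norm_num [Weights.o]
  have hU : Weights.OnSurface ⟨0, 1, 0⟩ := by constructor <;> norm_num [Weights.o]
  have hD : Weights.OnSurface ⟨0, 0, 1⟩ := by constructor <;> norm_num [Weights.o]
  have hO : Weights.OnSurface ⟨0, 0, 0⟩ := by constructor <;> norm_num [Weights.o]
  simp only [marked, Set.mem_insert_iff, Set.mem_singleton_iff, Weights.IsVertex]
  rw [← toSphere_vertexL, ← toSphere_vertexU, ← toSphere_vertexD, ← toSphere_vertexO]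
  refine or_congr ⟨toSphere_injOn hb hL, congrArg _⟩ (or_congr ⟨toSphere_injOn hb hU, congrArg _⟩
    (or_congr ⟨toSphere_injOn hb hD, congrArg _⟩ ⟨toSphere_injOn hb hO, congrArg _⟩))

/-- The residues modulo `2` of a lattice point determine the vertex: `(1, 1)`, `(1, 0)`, `(0, 1)`,
`(0, 0)` lie over `L`, `U`, `D`, `O`. -/
theorem weights_isVertex {w : ℝ × ℝ} : (weights w).IsVertex ↔ IsLattice w := by
  have h11 : weights (1, 1) = ⟨1, 0, 0⟩ := by
    have h1 : tri 1 = 1 := tri_of_nonneg zero_le_one le_rfl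
    have h2 : tri (1 + 1) = 0 := by
      have := tri_even 1
      norm_num at this ⊢
      exact this
    ext <;> simp only [weights, h1, h2] <;> norm_num
  have h10 : weights (1, 0) = ⟨0, 1, 0⟩ := by
    have h1 : tri 1 = 1 := tri_of_nonneg zero_le_one le_rfl
    have h2 : tri 0 = 0 := by simpa using tri_even 0
    ext <;> norm_num [weights, h1, h2]
  have h01 : weights (0, 1) = ⟨0, 0, 1⟩ := by
    have h1 : tri 1 = 1 := tri_of_nonneg zero_le_one le_rfl
    have h2 : tri 0 = 0 := by simpa using tri_even 0
    ext <;> norm_num [weights, h1, h2]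
  have h00 : weights (0, 0) = ⟨0, 0, 0⟩ := by
    have h2 : tri 0 = 0 := by simpa using tri_even 0
    ext <;> norm_num [weights, h2]
  rw [Weights.IsVertex, ← h11, ← h10, ← h01, ← h00]
  constructor
  · rintro (h | h | h | h) <;> obtain ⟨j, k, h | h⟩ := weights_eq_iff.1 h.symm
    · exact ⟨2 * j + 1, 2 * k + 1, by rw [h]; push_cast; rfl⟩
    · exact ⟨2 * j - 1, 2 * k - 1, by rw [h]; push_cast; rfl⟩
    · exact ⟨2 * j + 1, 2 * k, by rw [h]; simp⟩
    · exact ⟨2 * j - 1, 2 * k, by rw [h]; simp⟩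
    · exact ⟨2 * j, 2 * k + 1, by rw [h]; simp⟩
    · exact ⟨2 * j, 2 * k - 1, by rw [h]; simp⟩
    · exact ⟨2 * j, 2 * k, by rw [h]; simp⟩
    · exact ⟨2 * j, 2 * k, by rw [h]; simp⟩
  · rintro ⟨j, k, rfl⟩
    rcases Int.even_or_odd' j with ⟨j', rfl | rfl⟩ <;> rcases Int.even_or_odd' k with ⟨k', rfl | rfl⟩
    · right; right; right
      exact (weights_eq_iff.2 ⟨j', k', Or.inl (by simp)⟩).symm
    · right; right; left
      exact (weights_eq_iff.2 ⟨j', k', Or.inl (by simp)⟩).symm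
    · right; left
      exact (weights_eq_iff.2 ⟨j', k', Or.inl (by simp)⟩).symm
    · left
      exact (weights_eq_iff.2 ⟨j', k', Or.inl (by simp)⟩).symm

theorem cover_mem_marked {w : ℝ × ℝ} : cover w ∈ marked ↔ IsLattice w := by
  rw [cover, toSphere_mem_marked (weights_onSurface w), weights_isVertex]

/-- On a face at `O` the numerator of `affinePoint` lies on the boundary of the triangle scaled by
`1 - o`, and the inradius of the triangle is `1 / 2`. -/
theorem le_norm_affinePoint {b : Weights} (hb : b.OnSurface) (h0 : b.o ≠ 0) (h1 : b.o ≠ 1) :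
    1 / 2 ≤ ‖affinePoint b‖ * |1 - b.o| := by
  have hm : 0 < 1 - b.o := by
    have := hb.o_le_one
    have := lt_of_le_of_ne this h1
    linarith
  have hf : b.l = 0 ∨ b.u = 0 ∨ b.d = 0 := by
    have := hb.face
    tauto
  rw [abs_of_pos hm]
  have hn : ((1 - b.o) / 2) ^ 2 ≤
      ((b.u + b.d) / 2 - b.l) ^ 2 + (√3 / 2 * (b.u - b.d)) ^ 2 := by
    rw [show 1 - b.o = b.l + b.u + b.d by simp only [Weights.o]; ring, mul_pow, div_pow, div_pow, Real.sq_sqrt (by norm_num : (0 : ℝ) ≤ 3)]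
    have := hb.l_nonneg
    have := hb.u_nonneg
    have := hb.d_nonneg
    rcases hf with h | h | h <;> rw [h]
    · nlinarith [sq_nonneg (b.u - b.d)]
    · nlinarith [sq_nonneg (b.l - b.d)]
    · nlinarith [sq_nonneg (b.l - b.u)]
  have hnorm : ‖affinePoint b‖ * (1 - b.o) ^ 2 =
      √(((b.u + b.d) / 2 - b.l) ^ 2 + (√3 / 2 * (b.u - b.d)) ^ 2) := by
    rw [Complex.norm_eq_sqrt_sq_add_sq, ← Real.sqrt_sq (x := (1 - b.o) ^ 2) (by positivity),
      ← Real.sqrt_mul (by positivity)]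
    congr 1
    simp only [affinePoint]
    field_simp
  have h2 : (1 - b.o) / 2 ≤ ‖affinePoint b‖ * (1 - b.o) ^ 2 := by
    rw [hnorm]
    exact Real.le_sqrt_of_sq_le hn
  have h3 : (1 - b.o) * (1 / 2) ≤ (1 - b.o) * (‖affinePoint b‖ * (1 - b.o)) := by
    calc (1 - b.o) * (1 / 2) = (1 - b.o) / 2 := by ring
      _ ≤ _ := h2
      _ = _ := by ring
  exact le_of_mul_le_mul_left h3 hm

theorem continuous_weights : Continuous (fun w => (weights w).l) ∧
    Continuous (fun w => (weights w).u) ∧ Continuous (fun w => (weights w).d) ∧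
    Continuous (fun w => (weights w).o) := by
  have := continuous_tri
  unfold weights Weights.o
  refine ⟨?_, ?_, ?_, ?_⟩ <;> simp only <;> fun_prop

theorem continuous_cover : Continuous cover := by
  obtain ⟨cl, cu, cd, co⟩ := continuous_weights
  rw [continuous_iff_continuousAt]
  intro w
  by_cases h : (weights w).o = 1
  · have h0 : cover w = OnePoint.infty := by simp [cover, toSphere, h]
    rw [ContinuousAt, h0]
    refine tendsto_infty_of_bound (g := fun w => affinePoint (weights w))
      (c := fun w => 1 - (weights w).o) (k := 1 / 2) (by norm_num)
      (continuous_const.sub co).continuousAt (by simp [h]) ?_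
    have hne : ∀ᶠ x in 𝓝 w, (weights x).o ≠ 0 :=
      co.continuousAt.eventually_ne (by rw [h]; exact one_ne_zero)
    filter_upwards [hne] with x hx
    by_cases hx1 : (weights x).o = 1
    · left
      simp [cover, toSphere, hx1]
    · right
      exact ⟨by simp [cover, toSphere, hx1], le_norm_affinePoint (weights_onSurface x) hx hx1⟩
  · have hne : ∀ᶠ x in 𝓝 w, (weights x).o ≠ 1 := co.continuousAt.eventually_ne h
    have hcont : ContinuousAt (fun x => ((affinePoint (weights x) : ℂ) : Sphere)) w := by
      refine OnePoint.continuous_coe.continuousAt.comp ?_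
      have h2 : (1 - (weights w).o) ^ 2 ≠ 0 := pow_ne_zero 2 (sub_ne_zero.2 (Ne.symm h))
      have e : ∀ x, affinePoint (weights x) = (((((weights x).u + (weights x).d) / 2 -
          (weights x).l) / (1 - (weights x).o) ^ 2 : ℝ) : ℂ) +
          ((√3 / 2 * ((weights x).u - (weights x).d) / (1 - (weights x).o) ^ 2 : ℝ) : ℂ) *
          Complex.I := fun x => by
        apply Complex.ext <;> simp [affinePoint, -Complex.ofReal_div]
      simp_rw [e]
      have c1 := cl.continuousAt (x := w)
      have c2 := cu.continuousAt (x := w)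
      have c3 := cd.continuousAt (x := w)
      have c4 := co.continuousAt (x := w)
      refine ContinuousAt.add ?_ (ContinuousAt.mul ?_ continuousAt_const)
      · exact Complex.continuous_ofReal.continuousAt.comp
          (ContinuousAt.div (by fun_prop) (by fun_prop) h2)
      · exact Complex.continuous_ofReal.continuousAt.comp
          (ContinuousAt.div (by fun_prop) (by fun_prop) h2)
    refine hcont.congr ?_
    filter_upwards [hne] with x hx
    simp [cover, toSphere, hx]

/-- The lifts chosen by `unfold` stay in a compact square, and a continuous surjection from a
compact space onto the Hausdorff sphere is a closed map. -/
theorem isQuotientMap_cover : IsQuotientMap cover := by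
  let K : Set (ℝ × ℝ) := Set.Icc (0, -2) (2, 0)
  have hK : CompactSpace K := isCompact_iff_compactSpace.1 isCompact_Icc
  have hc : Continuous (fun w : K => cover w) := continuous_cover.comp continuous_subtype_val
  have hs : Function.Surjective (fun w : K => cover w) := by
    intro z
    obtain ⟨b, hb, rfl⟩ := exists_toSphere_eq z
    refine ⟨⟨unfold b, ?_⟩, by simp only [cover, weights_unfold hb]⟩
    have h1 := hb.l_nonneg
    have h2 := hb.u_nonneg
    have h3 := hb.d_nonneg
    have h4 := hb.o_nonneg
    have h5 : b.o = 1 - b.l - b.u - b.d := rfl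
    unfold unfold
    split_ifs <;> refine ⟨⟨?_, ?_⟩, ⟨?_, ?_⟩⟩ <;> simp only <;> linarith
  have hq : IsQuotientMap (fun w : K => cover w) := hc.isClosedMap.isQuotientMap hc hs
  exact IsQuotientMap.of_comp continuous_subtype_val continuous_cover hq

/-- The group of deck transformations: translations by `2 ℤ²` and half turns about lattice
points. -/
def deckGroup : Subgroup (Equiv.Perm (ℝ × ℝ)) where
  carrier := {g | ∃ j k : ℤ, (∀ w, g w = (2 * j + w.1, 2 * k + w.2)) ∨
    (∀ w, g w = (2 * j - w.1, 2 * k - w.2))}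
  one_mem' := ⟨0, 0, Or.inl fun w => by simp⟩
  mul_mem' := by
    rintro g g' ⟨j, k, h | h⟩ ⟨j', k', h' | h'⟩
    · exact ⟨j + j', k + k', Or.inl fun w => by
        rw [Equiv.Perm.mul_apply, h, h']; push_cast; ext <;> simp only <;> ring⟩
    · exact ⟨j + j', k + k', Or.inr fun w => by
        rw [Equiv.Perm.mul_apply, h, h']; push_cast; ext <;> simp only <;> ring⟩
    · exact ⟨j - j', k - k', Or.inr fun w => by
        rw [Equiv.Perm.mul_apply, h, h']; push_cast; ext <;> simp only <;> ring⟩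
    · exact ⟨j - j', k - k', Or.inl fun w => by
        rw [Equiv.Perm.mul_apply, h, h']; push_cast; ext <;> simp only <;> ring⟩
  inv_mem' := by
    rintro g ⟨j, k, h | h⟩
    · refine ⟨-j, -k, Or.inl fun w => ?_⟩
      rw [Equiv.Perm.inv_eq_iff_eq, h]
      push_cast
      ext <;> simp
    · refine ⟨j, k, Or.inr fun w => ?_⟩
      rw [Equiv.Perm.inv_eq_iff_eq, h]
      ext <;> simp

theorem deckGroup_smul (g : deckGroup) : ∃ j k : ℤ,
    (∀ w : ℝ × ℝ, g • w = (2 * j + w.1, 2 * k + w.2)) ∨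
      (∀ w : ℝ × ℝ, g • w = (2 * j - w.1, 2 * k - w.2)) := g.2

instance : ContinuousConstSMul deckGroup (ℝ × ℝ) where
  continuous_const_smul g := by
    obtain ⟨j, k, h | h⟩ := deckGroup_smul g <;> simp_rw [h] <;> fun_prop

theorem cover_eq_iff_orbit {w w' : ℝ × ℝ} :
    cover w = cover w' ↔ w ∈ MulAction.orbit deckGroup w' := by
  rw [eq_comm, cover_eq_iff]
  constructor
  · rintro ⟨j, k, h | h⟩
    · refine ⟨⟨⟨fun w => (2 * j + w.1, 2 * k + w.2), fun w => (w.1 - 2 * j, w.2 - 2 * k),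
        fun w => by simp, fun w => by simp⟩, j, k, Or.inl fun w => rfl⟩, h.symm⟩
    · refine ⟨⟨⟨fun w => (2 * j - w.1, 2 * k - w.2), fun w => (2 * j - w.1, 2 * k - w.2),
        fun w => by simp, fun w => by simp⟩, j, k, Or.inr fun w => rfl⟩, h.symm⟩
  · rintro ⟨g, rfl⟩
    obtain ⟨j, k, h | h⟩ := deckGroup_smul g
    · exact ⟨j, k, Or.inl (h w')⟩
    · exact ⟨j, k, Or.inr (h w')⟩

/-- If a half turn moves a point near `e` to a point near `e`, then its centre, the midpoint, is
near `e`; a nontrivial translation moves every point too far. -/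
theorem exists_nhds_smul_eq (e : ℝ × ℝ) :
    ∃ V ∈ 𝓝 e, ∀ g : deckGroup, ((g • ·) '' V ∩ V).Nonempty → g • e = e := by
  have key : ∃ r : ℝ, 0 < r ∧ r ≤ 1 ∧
      ∀ j k : ℤ, |e.1 - j| < r → |e.2 - k| < r → e.1 = j ∧ e.2 = k := by
    -- For integral `x` the radius `1` isolates it from the other integers; otherwise the distance
    -- to the nearest integer works.
    have aux : ∀ x : ℝ, ∃ r : ℝ, 0 < r ∧ r ≤ 1 ∧ ∀ j : ℤ, |x - j| < r → x = j := by
      intro x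
      by_cases hx : x = round x
      · refine ⟨1, one_pos, le_rfl, fun j hj => ?_⟩
        rw [hx] at hj ⊢
        norm_cast at hj ⊢
        rw [Int.abs_lt_one_iff] at hj
        linarith
      · refine ⟨|x - round x|, abs_pos.2 (sub_ne_zero.2 hx), ?_, fun j hj => ?_⟩
        · linarith [abs_sub_round x]
        · exact absurd hj (not_lt.2 (round_le x j))
    obtain ⟨r, hr, hr1, h⟩ := aux e.1
    obtain ⟨r', hr', hr1', h'⟩ := aux e.2
    exact ⟨min r r', lt_min hr hr', (min_le_left _ _).trans hr1, fun j k hj hk =>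
      ⟨h j (lt_of_lt_of_le hj (min_le_left _ _)), h' k (lt_of_lt_of_le hk (min_le_right _ _))⟩⟩
  obtain ⟨r, hr, hr1, h⟩ := key
  refine ⟨Metric.ball e r, Metric.ball_mem_nhds e hr, ?_⟩
  rintro g ⟨_, ⟨w, hw, rfl⟩, hgw⟩
  simp only [Metric.mem_ball, Prod.dist_eq, max_lt_iff, Real.dist_eq] at hw hgw
  obtain ⟨hw1, hw2⟩ := hw
  obtain ⟨hg1, hg2⟩ := hgw
  rw [abs_lt] at hw1 hw2 hg1 hg2
  obtain ⟨j, k, hg | hg⟩ := deckGroup_smul g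
  · rw [hg] at hg1 hg2 ⊢
    simp only at hg1 hg2
    have small : ∀ j : ℤ, -2 < 2 * (j : ℝ) → 2 * (j : ℝ) < 2 → j = 0 := by
      intro j h1 h2
      norm_cast at h1 h2
      lia
    have hj := small j (by linarith) (by linarith)
    have hk := small k (by linarith) (by linarith)
    simp [hj, hk]
  · rw [hg] at hg1 hg2 ⊢
    simp only at hg1 hg2
    obtain ⟨h1, h2⟩ := h j k (by rw [abs_lt]; constructor <;> linarith)
      (by rw [abs_lt]; constructor <;> linarith)
    ext <;> simp only <;> linarith

/-- A nontrivial translation has no fixed point, and a half turn about a lattice point fixes its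
centre only, so stabilisers are trivial off the lattice. -/
theorem isCoveringMapOn_cover : IsCoveringMapOn cover markedᶜ := by
  refine (isQuotientMap_cover.isCoveringMapOn_of_smul_disjoint (G := deckGroup)
    cover_eq_iff_orbit exists_nhds_smul_eq).mono ?_
  intro z hz
  obtain ⟨w, rfl⟩ := cover_surjective z
  refine ⟨w, ?_, rfl⟩
  rw [Set.mem_ofPred_eq, Subgroup.eq_bot_iff_forall]
  intro g hg
  rw [MulAction.mem_stabilizer_iff] at hg
  obtain ⟨j, k, h | h⟩ := deckGroup_smul g
  · have h1 := h w
    rw [hg] at h1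
    have e1 := congrArg Prod.fst h1
    have e2 := congrArg Prod.snd h1
    simp only [right_eq_add, mul_eq_zero, OfNat.ofNat_ne_zero, Int.cast_eq_zero, false_or] at e1 e2
    apply Subtype.ext
    apply Equiv.ext
    intro w
    change g • w = w
    rw [h, e1, e2]
    simp
  · exfalso
    have h1 := h w
    rw [hg] at h1
    have e1 := congrArg Prod.fst h1
    have e2 := congrArg Prod.snd h1
    simp only at e1 e2
    exact hz (cover_mem_marked.2 ⟨j, k, by ext <;> simp only <;> linarith⟩)

/-! ### Lifting homotopies of marked curves, including their ends at branch points. -/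

/-- The points of the plane at distance at least `ε` from the lattice. -/
def farFromLattice (ε : ℝ) : Set (ℝ × ℝ) := {w | ∀ j k : ℤ, ε ≤ dist w ((j : ℝ), (k : ℝ))}

/-- The set is invariant under deck transformations, hence it is the full preimage of its image, and
`cover` is a quotient map. -/
theorem isClosed_image_farFromLattice (ε : ℝ) : IsClosed (cover '' farFromLattice ε) := by
  rw [← isQuotientMap_cover.isClosed_preimage]
  have : cover ⁻¹' (cover '' farFromLattice ε) = farFromLattice ε := by
    refine Set.Subset.antisymm ?_ (Set.subset_preimage_image _ _)
    rintro w ⟨w', hw', h⟩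
    intro j k
    obtain ⟨j', k', h' | h'⟩ := cover_eq_iff.1 h
    · have := hw' (j - 2 * j') (k - 2 * k')
      rw [h']
      simp only [Prod.dist_eq, Real.dist_eq] at this ⊢
      convert this using 3 <;> push_cast <;> ring
    · have := hw' (2 * j' - j) (2 * k' - k)
      rw [h']
      simp only [Prod.dist_eq, Real.dist_eq] at this ⊢
      convert this using 2 <;> rw [← abs_neg] <;> push_cast <;> ring_nf
  rw [this]
  have : farFromLattice ε = ⋂ (j : ℤ) (k : ℤ), {w : ℝ × ℝ | ε ≤ dist w ((j : ℝ), (k : ℝ))} := by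
    ext w
    simp [farFromLattice]
  rw [this]
  exact isClosed_iInter fun j => isClosed_iInter fun k =>
    isClosed_le continuous_const (continuous_id.dist continuous_const)

theorem lattice_dist {w w' : ℝ × ℝ} (hw : IsLattice w) (hw' : IsLattice w') (h : dist w w' < 1) :
    w = w' := by
  obtain ⟨j, k, rfl⟩ := hw
  obtain ⟨j', k', rfl⟩ := hw'
  simp only [Prod.dist_eq, max_lt_iff, Real.dist_eq] at h
  obtain ⟨h1, h2⟩ := h
  norm_cast at h1 h2
  rw [Int.abs_lt_one_iff, sub_eq_zero] at h1 h2
  rw [h1, h2]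

/-- A path all of whose points are close to the lattice stays close to one lattice point. -/
theorem dist_lt_of_path {f : I → ℝ × ℝ} (hf : Continuous f) {ε : ℝ} (hε : ε ≤ 1 / 2)
    (h : ∀ t, f t ∉ farFromLattice ε) {w : ℝ × ℝ} (hw : IsLattice w) (h0 : dist (f 0) w < ε)
    (t : I) : dist (f t) w < ε := by
  have hpre : IsPreconnected (Set.range f) := isPreconnected_range hf
  let B : Set (ℝ × ℝ) := ⋃ (w' : ℝ × ℝ) (_ : IsLattice w' ∧ w' ≠ w), Metric.ball w' ε
  have hB : IsOpen B := isOpen_iUnion fun _ => isOpen_iUnion fun _ => Metric.isOpen_ball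
  have hdis : Disjoint (Metric.ball w ε) B := by
    rw [Set.disjoint_left]
    intro x hx hxB
    simp only [B, Set.mem_iUnion, Metric.mem_ball] at hxB hx
    obtain ⟨w', ⟨hw', hne⟩, hxw'⟩ := hxB
    refine hne (lattice_dist hw' hw ?_)
    linarith [dist_triangle_left w' w x]
  have hsub : Set.range f ⊆ Metric.ball w ε ∪ B := by
    rintro _ ⟨t, rfl⟩
    have := h t
    simp only [farFromLattice, Set.mem_ofPred_eq, not_forall, not_le] at this
    obtain ⟨j, k, hjk⟩ := this
    by_cases hjw : ((j : ℝ), (k : ℝ)) = w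
    · left
      rw [← hjw]
      exact hjk
    · right
      simp only [B, Set.mem_iUnion, Metric.mem_ball]
      exact ⟨_, ⟨⟨j, k, rfl⟩, hjw⟩, hjk⟩
  have := hpre.subset_left_of_subset_union Metric.isOpen_ball hB hdis hsub
    ⟨f 0, ⟨0, rfl⟩, h0⟩
  exact this ⟨t, rfl⟩

/-- A connected subset of a finite set in a Hausdorff space has at most one point. -/
theorem eq_of_mem_marked {f : I → Sphere} (hf : Continuous f) (h : ∀ t, f t ∈ marked) (s t : I) :
    f s = f t := by
  have hfin : marked.Finite := by simp [marked]
  have hd : IsPreconnected (Set.range f) := isPreconnected_range hf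
  have hsub : Set.range f ⊆ marked := by
    rintro _ ⟨t, rfl⟩
    exact h t
  by_contra hne
  exact hd.infinite_of_nontrivial ⟨f s, ⟨s, rfl⟩, f t, ⟨t, rfl⟩, hne⟩ (hfin.subset hsub)

/-- The interior of the unit interval. -/
abbrev OpenInterval : Type := {s : I // s ≠ 0 ∧ s ≠ 1}

/-- A homotopy through marked curves lifts to the plane, and the lifted curves have the same
endpoints. -/
theorem exists_lift_of_homotopy (f : C(I, ℝ × ℝ)) (H : C(I × I, Sphere))
    (h0 : ∀ s, H (0, s) = cover (f s)) (hH : ∀ t s : I, H (t, s) ∈ marked ↔ s = 0 ∨ s = 1) :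
    ∃ g : C(I, ℝ × ℝ), (∀ s, cover (g s) = H (1, s)) ∧ g 0 = f 0 ∧ g 1 = f 1 := by
  have hf0 : IsLattice (f 0) := by
    rw [← cover_mem_marked, ← h0, hH]
    simp
  have hf1 : IsLattice (f 1) := by
    rw [← cover_mem_marked, ← h0, hH]
    simp
  have hcov := isCoveringMapOn_cover.isCoveringMap_restrictPreimage
  let H' : C(I × OpenInterval, (markedᶜ : Set Sphere)) :=
    ⟨fun x => ⟨H (x.1, x.2.1), by
      rw [Set.mem_compl_iff, hH, not_or]
      exact x.2.2⟩, by fun_prop⟩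
  let f' : C(OpenInterval, cover ⁻¹' (markedᶜ : Set Sphere)) :=
    ⟨fun s => ⟨f s.1, by
      rw [Set.mem_preimage, ← h0, Set.mem_compl_iff, hH, not_or]
      exact s.2⟩, by fun_prop⟩
  have hcomp : ∀ a, H' (0, a) = (markedᶜ : Set Sphere).restrictPreimage cover (f' a) :=
    fun a => Subtype.ext (h0 a.1)
  let G := hcov.liftHomotopy H' f' hcomp
  have hG : ∀ t a, cover (G (t, a)).1 = H (t, a.1) := fun t a =>
    congrArg Subtype.val (congrFun (hcov.liftHomotopy_lifts H' f' hcomp) (t, a))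
  have hG0 : ∀ a, (G (0, a)).1 = f a.1 := fun a =>
    congrArg Subtype.val (hcov.liftHomotopy_zero H' f' hcomp a)
  -- The covering property lifts the homotopy over the open interval only. The ends of `f` are put
  -- back by hand, and continuity there needs an argument.
  let g : I → ℝ × ℝ := fun s => if h : s ≠ 0 ∧ s ≠ 1 then (G (1, ⟨s, h⟩)).1 else f s
  have hg_end : ∀ s, (s = 0 ∨ s = 1) → g s = f s := by
    intro s hs
    have : ¬ (s ≠ 0 ∧ s ≠ 1) := by tauto
    simp only [g, dif_neg this]
  -- Compactness in `t` keeps the whole homotopy, for `s` near `e`, in an open set whose preimage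
  -- lies close to the lattice. The lifted track of such an `s` starts near `f e`, and it cannot
  -- jump to another lattice point.
  have hcont_end : ∀ e : I, (e = 0 ∨ e = 1) → ContinuousAt g e := by
    intro e he
    have hfe : IsLattice (f e) := by
      rcases he with rfl | rfl <;> assumption
    rw [Metric.continuousAt_iff']
    intro ε hε
    rw [hg_end e he]
    let ε' := min ε (1 / 2)
    have hε' : 0 < ε' := lt_min hε (by norm_num)
    let W : Set Sphere := (cover '' farFromLattice ε')ᶜ
    have hW : IsOpen W := (isClosed_image_farFromLattice ε').isOpen_compl
    have hWe : ∀ t, H (t, e) ∈ W := by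
      rintro t ⟨w, hw, hwt⟩
      have : cover w ∈ marked := by
        rw [hwt, hH]
        exact he
      obtain ⟨j, k, rfl⟩ := cover_mem_marked.1 this
      have := hw j k
      rw [dist_self] at this
      linarith
    have htube : ∀ᶠ s in 𝓝 e, ∀ t, H (t, s) ∈ W := by
      have h1 : ∀ t ∈ (Set.univ : Set I), ∀ᶠ z : I × I in 𝓝 e ×ˢ 𝓝 t, H (z.2, z.1) ∈ W := by
        intro t _
        rw [← nhds_prod_eq]
        have hcH : Continuous (fun z : I × I => H (z.2, z.1)) := by fun_prop
        exact hcH.continuousAt.eventually (hW.mem_nhds (hWe t))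
      have h2 := isCompact_univ.eventually_forall_of_forall_eventually (x₀ := e)
        (P := fun s t => H (t, s) ∈ W) (fun t ht => by
          rw [nhds_prod_eq]
          exact h1 t ht)
      filter_upwards [h2] with s hs t using hs t (Set.mem_univ t)
    have hclose : ∀ᶠ s in 𝓝 e, dist (f s) (f e) < ε' :=
      Metric.continuousAt_iff'.1 f.continuous.continuousAt ε' hε'
    filter_upwards [htube, hclose] with s hs1 hs2
    by_cases hs : s ≠ 0 ∧ s ≠ 1
    · simp only [g, dif_pos hs]
      have hpath : Continuous (fun t : I => (G (t, ⟨s, hs⟩)).1) := by fun_prop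
      have := dist_lt_of_path hpath (min_le_right ε (1 / 2)) (fun t hfar => ?_) hfe ?_ 1
      · exact lt_of_lt_of_le this (min_le_left _ _)
      · exact hs1 t ⟨_, hfar, hG t ⟨s, hs⟩⟩
      · simp only [hG0]
        exact hs2
    · simp only [g, dif_neg hs]
      exact lt_of_lt_of_le hs2 (min_le_left _ _)
  have hcont : Continuous g := by
    rw [continuous_iff_continuousAt]
    intro e
    by_cases he : e ≠ 0 ∧ e ≠ 1
    · have hopen : IsOpen {s : I | s ≠ 0 ∧ s ≠ 1} := isOpen_ne.inter isOpen_ne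
      have : ContinuousOn g {s : I | s ≠ 0 ∧ s ≠ 1} := by
        rw [continuousOn_iff_continuous_domRestrict]
        have h1 : Continuous (fun s : OpenInterval => (G (1, s)).1) := by fun_prop
        refine h1.congr fun s => ?_
        have hs : s.1 ≠ 0 ∧ s.1 ≠ 1 := s.2
        change _ = g s.1
        simp only [g, dif_pos hs]
      exact this.continuousAt (hopen.mem_nhds he)
    · exact hcont_end e (by tauto)
  refine ⟨⟨g, hcont⟩, fun s => ?_, hg_end 0 (Or.inl rfl), hg_end 1 (Or.inr rfl)⟩
  by_cases hs : s ≠ 0 ∧ s ≠ 1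
  · simp only [ContinuousMap.coe_mk, g, dif_pos hs]
    exact hG 1 ⟨s, hs⟩
  · have hs' : s = 0 ∨ s = 1 := by tauto
    change cover (g s) = _
    rw [hg_end s hs', ← h0]
    exact eq_of_mem_marked (f := fun t => H (t, s)) (by fun_prop) (fun t => (hH t s).2 hs') 0 1

/-! ### Crossing curves in the plane -/

theorem exists_log {A : Type*} [TopologicalSpace A] [SimplyConnectedSpace A]
    [LocallyPathConnectedSpace A] (a₀ : A) (f : C(A, ℂ)) (hf : ∀ a, f a ≠ 0) (e₀ : ℂ)
    (he : Complex.exp e₀ = f a₀) : ∃! F : C(A, ℂ), F a₀ = e₀ ∧ Complex.exp ∘ F = f :=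
  Complex.isCoveringMapOn_exp.existsUnique_continuousMap_lifts f he (fun a => hf a)

/-- A bounded continuous perturbation of the identity of the plane has a zero. -/
theorem exists_add_eq_zero (P : C(ℂ, ℂ)) (c : ℝ) (hP : ∀ z, ‖P z‖ ≤ c) : ∃ z, z + P z = 0 := by
  by_contra! hne
  let F : C(ℂ, ℂ) := ⟨fun z => z + P z, by fun_prop⟩
  obtain ⟨G, ⟨-, hG⟩, -⟩ := exists_log 0 F hne (Complex.log (F 0)) (Complex.exp_log (hne 0))
  have hc : 0 ≤ c := (norm_nonneg _).trans (hP 0)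
  have hR : (0 : ℝ) < c + 1 := by linarith
  have hR0 : ((c + 1 : ℝ) : ℂ) ≠ 0 := by exact_mod_cast hR.ne'
  let z : ℝ → ℂ := fun θ => ((c + 1 : ℝ) : ℂ) * Complex.exp (θ * Complex.I)
  have hz : Continuous z := by fun_prop
  have hz0 : ∀ θ, z θ ≠ 0 := fun θ => mul_ne_zero hR0 (Complex.exp_ne_zero _)
  have hnz : ∀ θ, ‖z θ‖ = c + 1 := fun θ => by
    simp only [z, norm_mul, Complex.norm_exp_ofReal_mul_I, mul_one, Complex.norm_real,
      Real.norm_eq_abs, abs_of_pos hR]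
  have hslit : ∀ θ, 1 + P (z θ) / z θ ∈ Complex.slitPlane := by
    intro θ
    apply Complex.mem_slitPlane_of_norm_lt_one
    rw [norm_div, hnz, div_lt_one hR]
    linarith [hP (z θ)]
  -- On the circle of radius `c + 1` the quotient `F z / z` stays in the slit plane. Thus `ψ` is a
  -- continuous logarithm of the constant `c + 1`, hence constant. But its first and last terms have
  -- the same values at `0` and `2π`, and the middle term does not.
  let ψ : C(ℝ, ℂ) := ⟨fun θ => G (z θ) - θ * Complex.I - Complex.log (1 + P (z θ) / z θ), by
    refine Continuous.sub (by fun_prop) (Continuous.clog ?_ hslit)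
    exact continuous_const.add (Continuous.div (by fun_prop) hz hz0)⟩
  have hψ : ∀ θ, Complex.exp (ψ θ) = ((c + 1 : ℝ) : ℂ) := by
    intro θ
    have h1 : Complex.exp (G (z θ)) = z θ + P (z θ) := congrFun hG (z θ)
    simp only [ψ, ContinuousMap.coe_mk]
    rw [Complex.exp_sub, Complex.exp_sub, h1, Complex.exp_log (Complex.slitPlane_ne_zero (hslit θ))]
    have h2 : z θ + P (z θ) = ((c + 1 : ℝ) : ℂ) * Complex.exp (θ * Complex.I) *
        (1 + P (z θ) / z θ) := by
      rw [mul_add, mul_one, mul_div_cancel₀ _ (hz0 θ)]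
    rw [h2]
    have := Complex.exp_ne_zero (θ * Complex.I)
    have := Complex.slitPlane_ne_zero (hslit θ)
    field_simp
  obtain ⟨K, -, hK⟩ := exists_log (0 : ℝ) (ContinuousMap.const ℝ ((c + 1 : ℝ) : ℂ))
    (fun _ => hR0) (ψ 0) (hψ 0)
  have e1 := hK ψ ⟨rfl, funext hψ⟩
  have e2 := hK (ContinuousMap.const ℝ (ψ 0)) ⟨rfl, funext fun _ => hψ 0⟩
  have h3 : ψ (2 * Real.pi) = ψ 0 := by
    exact congrArg (fun F : C(ℝ, ℂ) => F (2 * Real.pi)) (e1.trans e2.symm)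
  have hz2 : z (2 * Real.pi) = z 0 := by
    simp only [z]
    push_cast
    rw [Complex.exp_two_pi_mul_I]
    simp
  simp only [ψ, ContinuousMap.coe_mk, hz2] at h3
  have h4 : ((2 * Real.pi : ℝ) : ℂ) * Complex.I = 0 := by
    have := h3
    push_cast at this ⊢
    linear_combination -this
  simp [Real.pi_ne_zero] at h4

/-- The determinant of two vectors. -/
def det (v w : ℝ × ℝ) : ℝ := v.1 * w.2 - v.2 * w.1

theorem det_sub_right (v w w' : ℝ × ℝ) : det v (w - w') = det v w - det v w' := by
  simp only [det, Prod.fst_sub, Prod.snd_sub]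
  ring

/-- Two curves in the plane that stay close to lines of different directions meet. -/
theorem exists_crossing {v v' : ℝ × ℝ} (hv : det v v' ≠ 0) {x y : ℝ × ℝ} {f f' : ℝ → ℝ × ℝ}
    (hf : Continuous f) (hf' : Continuous f') {c : ℝ} (hc : ∀ t, ‖f t - (x + t • v)‖ ≤ c)
    (hc' : ∀ t, ‖f' t - (y + t • v')‖ ≤ c) : ∃ t t', f t = f' t' := by
  let δ : ℝ → ℝ → ℝ × ℝ := fun t t' => (f t - (x + t • v)) - (f' t' - (y + t' • v')) + (x - y)
  have hδ : ∀ t t', f t - f' t' = t • v - t' • v' + δ t t' := by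
    intro t t'
    simp only [δ]
    abel
  have hδb : ∀ t t', ‖δ t t'‖ ≤ c + c + ‖x - y‖ := fun t t' =>
    (norm_add_le _ _).trans (add_le_add ((norm_sub_le _ _).trans (add_le_add (hc t) (hc' t'))) le_rfl)
  have hdet : ∀ u w : ℝ × ℝ, |det u w| ≤ 2 * ‖u‖ * ‖w‖ := by
    intro u w
    have h1 : |u.1| ≤ ‖u‖ := norm_fst_le u
    have h2 : |u.2| ≤ ‖u‖ := norm_snd_le u
    have h3 : |w.1| ≤ ‖w‖ := norm_fst_le w
    have h4 : |w.2| ≤ ‖w‖ := norm_snd_le w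
    calc |det u w| ≤ |u.1 * w.2| + |u.2 * w.1| := abs_sub _ _
      _ = |u.1| * |w.2| + |u.2| * |w.1| := by rw [abs_mul, abs_mul]
      _ ≤ ‖u‖ * ‖w‖ + ‖u‖ * ‖w‖ := by gcongr
      _ = _ := by ring
  -- With `z = t + i t'`, Cramer's rule turns `t • v - t' • v' + δ t t' = 0` into `z + P z = 0`.
  let P : C(ℂ, ℂ) := ⟨fun z => ((det (δ z.re z.im) v' / det v v' : ℝ) : ℂ) +
    ((det (δ z.re z.im) v / det v v' : ℝ) : ℂ) * Complex.I, by
      have h1 : Continuous fun z : ℂ => δ z.re z.im := by fun_prop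
      have h2 : ∀ w : ℝ × ℝ, Continuous fun z : ℂ => det (δ z.re z.im) w / det v v' := by
        intro w
        unfold det
        fun_prop
      have h3 := h2 v
      have h4 := h2 v'
      fun_prop⟩
  obtain ⟨z, hz⟩ := exists_add_eq_zero P ((2 * (c + c + ‖x - y‖) * ‖v'‖) / |det v v'| +
    (2 * (c + c + ‖x - y‖) * ‖v‖) / |det v v'|) (by
      intro z
      have hb : ∀ w, ‖((det (δ z.re z.im) w / det v v' : ℝ) : ℂ)‖ ≤
          (2 * (c + c + ‖x - y‖) * ‖w‖) / |det v v'| := by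
        intro w
        rw [Complex.norm_real, Real.norm_eq_abs, abs_div]
        have := hdet (δ z.re z.im) w
        have := hδb z.re z.im
        gcongr
        refine (hdet _ _).trans ?_
        gcongr
      refine (norm_add_le _ _).trans (add_le_add (hb v') ?_)
      rw [norm_mul, Complex.norm_I, mul_one]
      exact hb v)
  have h1 := congrArg Complex.re hz
  have h2 := congrArg Complex.im hz
  simp only [P, ContinuousMap.coe_mk, Complex.add_re, Complex.add_im, Complex.mul_re,
    Complex.mul_im, Complex.ofReal_re, Complex.ofReal_im, Complex.I_re, Complex.I_im,
    Complex.zero_re, Complex.zero_im, mul_zero, mul_one, sub_zero, add_zero, zero_add] at h1 h2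
  field_simp at h1 h2
  refine ⟨z.re, z.im, ?_⟩
  rw [← sub_eq_zero, hδ]
  set w := δ z.re z.im
  have key : ∀ u : ℝ × ℝ, det u v' = 0 → det u v = 0 → u = 0 := by
    intro u h1 h2
    simp only [det] at h1 h2 hv
    have e1 : u.1 * (v.1 * v'.2 - v.2 * v'.1) = 0 := by linear_combination v.1 * h1 - v'.1 * h2
    have e2 : u.2 * (v.1 * v'.2 - v.2 * v'.1) = 0 := by linear_combination v.2 * h1 - v'.2 * h2
    ext
    · exact (mul_eq_zero.1 e1).resolve_right hv
    · exact (mul_eq_zero.1 e2).resolve_right hv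
  apply key
  · simp only [det, Prod.fst_add, Prod.snd_add, Prod.fst_sub, Prod.snd_sub, Prod.smul_fst,
      Prod.smul_snd, smul_eq_mul] at h1 ⊢
    linear_combination h1
  · simp only [det, Prod.fst_add, Prod.snd_add, Prod.fst_sub, Prod.snd_sub, Prod.smul_fst,
      Prod.smul_snd, smul_eq_mul] at h2 ⊢
    linear_combination h2

/-! ### Curves between lattice points and their extension along lines. -/

/-- A point of `ℤ²` as a point of the plane. -/
def toPlane (x : ℤ × ℤ) : ℝ × ℝ := ((x.1 : ℝ), (x.2 : ℝ))

theorem toPlane_add (x y : ℤ × ℤ) : toPlane (x + y) = toPlane x + toPlane y := by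
  simp [toPlane]

theorem toPlane_neg (x : ℤ × ℤ) : toPlane (-x) = -toPlane x := by
  simp [toPlane]

theorem toPlane_sub (x y : ℤ × ℤ) : toPlane (x - y) = toPlane x - toPlane y := by
  simp [toPlane]

theorem toPlane_smul (k : ℤ) (x : ℤ × ℤ) : toPlane (k • x) = (k : ℝ) • toPlane x := by
  simp [toPlane]

theorem toPlane_injective : Function.Injective toPlane := by
  intro x y h
  simp only [toPlane, Prod.mk.injEq, Int.cast_inj] at h
  exact Prod.ext h.1 h.2

theorem cover_add_two (w : ℝ × ℝ) (u : ℤ × ℤ) : cover (w + 2 • toPlane u) = cover w := by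
  refine (cover_eq_iff.2 ⟨u.1, u.2, Or.inl ?_⟩).symm
  ext <;> simp [toPlane] <;> ring

theorem cover_two_sub (w : ℝ × ℝ) (u : ℤ × ℤ) : cover (2 • toPlane u - w) = cover w := by
  refine (cover_eq_iff.2 ⟨u.1, u.2, Or.inr ?_⟩).symm
  ext <;> simp [toPlane]

/-- The periodic extension of a curve between two lattice points by half turns. -/
theorem exists_periodic_extension (g : C(I, ℝ × ℝ)) {x v : ℤ × ℤ} (h0 : g 0 = toPlane x)
    (h1 : g 1 = toPlane x + toPlane v) :
    ∃ f : ℝ → ℝ × ℝ, Continuous f ∧ (∃ c, ∀ t : ℝ, ‖f t - (toPlane x + t • toPlane v)‖ ≤ c) ∧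
      ∀ t, ∃ s : I, cover (f t) = cover (g s) ∧
        ((s = 0 ∨ s = 1) → ∃ k : ℤ, f t = toPlane (x + k • v)) := by
  let δ : I → ℝ × ℝ := fun s => g s - toPlane x - (s : ℝ) • toPlane v
  have hδ0 : δ 0 = 0 := by simp [δ, h0]
  have hδ1 : δ 1 = 0 := by simp [δ, h1]
  have hδc : Continuous δ := by fun_prop
  -- The half turn about `x` corresponds to `t ↦ -t`, so the deviation `δ` from the line is
  -- continued to `[-1, 1]` as an odd function and then with period `2`. This is continuous because
  -- `δ` vanishes at `0` and `1`.
  let η : ℝ → ℝ × ℝ := fun t => δ (Set.projIcc 0 1 zero_le_one t) -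
    δ (Set.projIcc 0 1 zero_le_one (-t))
  have hηc : Continuous η := by
    have := continuous_projIcc (α := ℝ) (h := zero_le_one (α := ℝ))
    fun_prop
  have hp0 : ∀ t : ℝ, t ≤ 0 → δ (Set.projIcc 0 1 zero_le_one t) = 0 := by
    intro t ht
    rw [Set.projIcc_of_le_left _ ht]
    exact hδ0
  have : Fact ((0 : ℝ) < 2) := ⟨two_pos⟩
  let δ' : AddCircle (2 : ℝ) → ℝ × ℝ := AddCircle.liftIco 2 (-1) η
  have hδ'c : Continuous δ' := by
    refine AddCircle.liftIco_continuous ?_ hηc.continuousOn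
    norm_num [η]
    rw [hp0 (-1) (by norm_num), hδ1]
  refine ⟨fun t => toPlane x + t • toPlane v + δ' t, ?_, ?_, ?_⟩
  · have : Continuous (fun t : ℝ => δ' (t : AddCircle (2 : ℝ))) :=
      hδ'c.comp (AddCircle.continuous_mk' 2)
    fun_prop
  · obtain ⟨c, hc⟩ := (isCompact_range hδ'c).isBounded.exists_norm_le
    refine ⟨c, fun t => ?_⟩
    rw [add_sub_cancel_left]
    exact hc _ ⟨_, rfl⟩
  · intro t
    obtain ⟨k, hk⟩ : ∃ k : ℤ, t - 2 * k ∈ Set.Ico (-1 : ℝ) (-1 + 2) := by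
      refine ⟨⌊(t + 1) / 2⌋, ?_, ?_⟩
      · have := Int.floor_le ((t + 1) / 2)
        linarith
      · have := Int.lt_floor_add_one ((t + 1) / 2)
        linarith
    have ht : δ' t = η (t - 2 * k) := by
      have e : (t : AddCircle (2 : ℝ)) = ((t - 2 * k : ℝ) : AddCircle (2 : ℝ)) := by
        rw [AddCircle.coe_sub]
        have : ((2 * (k : ℝ) : ℝ) : AddCircle (2 : ℝ)) = 0 := by
          rw [AddCircle.coe_eq_zero_iff]
          exact ⟨k, by simp [mul_comm]⟩
        rw [this, sub_zero]
      rw [e]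
      exact AddCircle.liftIco_coe_apply hk
    set r := t - 2 * k with hr
    have htr : t = r + 2 * k := by rw [hr]; ring
    -- For `r ≥ 0` the point is a point of `g` translated by `2 k v`; for `r ≤ 0` it comes from `g`
    -- by the half turn about `x + k v`.
    rcases le_total 0 r with h | h
    · have hmem : r ∈ Set.Icc (0 : ℝ) 1 := ⟨h, by linarith [hk.2]⟩
      have hη : η r = g ⟨r, hmem⟩ - toPlane x - r • toPlane v := by
        simp only [η]
        rw [hp0 (-r) (by linarith), sub_zero, Set.projIcc_of_mem _ hmem]
      have hft : toPlane x + t • toPlane v + δ' t = g ⟨r, hmem⟩ + 2 • toPlane (k • v) := by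
        rw [ht, hη, htr, toPlane_smul]
        module
      refine ⟨⟨r, hmem⟩, ?_, ?_⟩
      · simp only [hft]
        exact cover_add_two _ _
      · rintro (hs | hs)
        · refine ⟨2 * k, ?_⟩
          simp only [hft]
          rw [hs, h0, toPlane_add, toPlane_smul, toPlane_smul]
          push_cast
          module
        · refine ⟨2 * k + 1, ?_⟩
          simp only [hft]
          rw [hs, h1, toPlane_add, toPlane_smul, toPlane_smul]
          push_cast
          module
    · have hmem : -r ∈ Set.Icc (0 : ℝ) 1 := ⟨by linarith, by linarith [hk.1]⟩
      have hη : η r = -(g ⟨-r, hmem⟩ - toPlane x - (-r) • toPlane v) := by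
        simp only [η]
        rw [hp0 r h, zero_sub, Set.projIcc_of_mem _ hmem]
      have hft : toPlane x + t • toPlane v + δ' t =
          2 • toPlane (x + k • v) - g ⟨-r, hmem⟩ := by
        rw [ht, hη, htr, toPlane_add, toPlane_smul]
        module
      refine ⟨⟨-r, hmem⟩, ?_, ?_⟩
      · simp only [hft]
        exact cover_two_sub _ _
      · rintro (hs | hs)
        · refine ⟨2 * k, ?_⟩
          simp only [hft]
          rw [hs, h0, toPlane_add, toPlane_add, toPlane_smul, toPlane_smul]
          push_cast
          module
        · refine ⟨2 * k - 1, ?_⟩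
          simp only [hft]
          rw [hs, h1, toPlane_add, toPlane_add, toPlane_smul, toPlane_smul]
          push_cast
          module

/-- Two curves between lattice points in different directions meet in the sphere; if they meet at
their ends only, then their lines meet in the lattice. -/
theorem exists_cover_eq (g g' : C(I, ℝ × ℝ)) {x v y v' : ℤ × ℤ} (h0 : g 0 = toPlane x)
    (h1 : g 1 = toPlane x + toPlane v) (h0' : g' 0 = toPlane y)
    (h1' : g' 1 = toPlane y + toPlane v') (hv : v.1 * v'.2 - v.2 * v'.1 ≠ 0) :
    ∃ s s' : I, cover (g s) = cover (g' s') ∧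
      ((s = 0 ∨ s = 1) → (s' = 0 ∨ s' = 1) → ∃ j k : ℤ, x + j • v = y + k • v') := by
  obtain ⟨f, hf, ⟨c, hc⟩, hfs⟩ := exists_periodic_extension g h0 h1
  obtain ⟨f', hf', ⟨c', hc'⟩, hfs'⟩ := exists_periodic_extension g' h0' h1'
  have hdet : det (toPlane v) (toPlane v') ≠ 0 := by
    simp only [det, toPlane]
    exact_mod_cast hv
  obtain ⟨t, t', htt⟩ := exists_crossing hdet hf hf' (c := max c c')
    (fun t => (hc t).trans (le_max_left _ _)) (fun t => (hc' t).trans (le_max_right _ _))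
  obtain ⟨s, hs, hs2⟩ := hfs t
  obtain ⟨s', hs', hs2'⟩ := hfs' t'
  refine ⟨s, s', by rw [← hs, ← hs', htt], fun e e' => ?_⟩
  obtain ⟨j, hj⟩ := hs2 e
  obtain ⟨k, hk⟩ := hs2' e'
  exact ⟨j, k, toPlane_injective (by rw [← hj, ← hk, htt])⟩

/-! ### Straight arcs -/

/-- During a contraction the end of the curve moves continuously in a finite set, so it stays at `f
1` and cannot arrive at `f 0`. -/
theorem not_isContractible {f : C(I, Sphere)} (hf : IsMarkedCurve f) (hne : f 0 ≠ f 1) :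
    ¬ IsContractible f := by
  rintro ⟨H, h0, h1, hH⟩
  apply hne
  have hm : f 0 ∈ marked := (hf 0).2 (Or.inl rfl)
  have := eq_of_mem_marked (f := fun t => H (t, 1)) (by fun_prop) (fun t => by
    by_cases ht : t = 1
    · subst ht
      rw [h1]
      exact hm
    · exact (hH t 1 ht).2 (Or.inr rfl)) 0 1
  simp only [h0, h1] at this
  exact this.symm

/-- The segment from a lattice point `x` to `x + v`. -/
def segmentMap (x v : ℤ × ℤ) : C(I, ℝ × ℝ) :=
  ⟨fun s => toPlane x + (s : ℝ) • toPlane v, by fun_prop⟩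

theorem segmentMap_apply (x v : ℤ × ℤ) (s : I) :
    segmentMap x v s = toPlane x + (s : ℝ) • toPlane v := rfl

theorem segmentMap_zero (x v : ℤ × ℤ) : segmentMap x v 0 = toPlane x := by
  simp [segmentMap_apply]

theorem segmentMap_one (x v : ℤ × ℤ) : segmentMap x v 1 = toPlane x + toPlane v := by
  simp [segmentMap_apply]

theorem isLattice_toPlane (x : ℤ × ℤ) : IsLattice (toPlane x) := ⟨x.1, x.2, rfl⟩

theorem isLattice_iff {w : ℝ × ℝ} : IsLattice w ↔ ∃ x : ℤ × ℤ, w = toPlane x :=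
  ⟨fun ⟨j, k, h⟩ => ⟨(j, k), h⟩, fun ⟨x, h⟩ => h ▸ isLattice_toPlane x⟩

/-- An integral multiple of a primitive vector has an integral coefficient. -/
theorem exists_int_of_smul_eq {v : ℤ × ℤ} (hv : IsCoprime v.1 v.2) {t m : ℝ} {x : ℤ × ℤ}
    (h : t • toPlane v = m • toPlane x) : ∃ k : ℤ, t = m * k := by
  obtain ⟨a, b, hab⟩ := hv
  have h1 := congrArg Prod.fst h
  have h2 := congrArg Prod.snd h
  simp only [toPlane, Prod.smul_fst, Prod.smul_snd, smul_eq_mul] at h1 h2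
  have hab' : (a : ℝ) * v.1 + b * v.2 = 1 := by exact_mod_cast hab
  refine ⟨a * x.1 + b * x.2, ?_⟩
  push_cast
  linear_combination a * h1 + b * h2 - t * hab'

theorem unitInterval_eq_zero_or_one {s : I} {k : ℤ} (h : (s : ℝ) = k) : s = 0 ∨ s = 1 := by
  have h0 : (0 : ℝ) ≤ k := h ▸ s.2.1
  have h1 : (k : ℝ) ≤ 1 := h ▸ s.2.2
  have h0' : 0 ≤ k := by exact_mod_cast h0
  have h1' : k ≤ 1 := by exact_mod_cast h1
  obtain rfl | rfl : k = 0 ∨ k = 1 := by lia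
  · left
    exact Subtype.ext (by simpa using h)
  · right
    exact Subtype.ext (by simpa using h)

theorem isLattice_segmentMap (x : ℤ × ℤ) {v : ℤ × ℤ} (hv : IsCoprime v.1 v.2) (s : I) :
    IsLattice (segmentMap x v s) ↔ s = 0 ∨ s = 1 := by
  constructor
  · intro h
    obtain ⟨y, hy⟩ := isLattice_iff.1 h
    obtain ⟨k, hk⟩ := exists_int_of_smul_eq hv (t := s) (m := 1) (x := y - x) (by
      rw [one_smul, toPlane_sub, ← hy, segmentMap_apply, add_sub_cancel_left])
    exact unitInterval_eq_zero_or_one (by simpa using hk)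
  · rintro (rfl | rfl)
    · rw [segmentMap_zero]
      exact isLattice_toPlane x
    · rw [segmentMap_one, ← toPlane_add]
      exact isLattice_toPlane _

theorem cover_eq_iff' {w w' : ℝ × ℝ} : cover w = cover w' ↔
    ∃ u : ℤ × ℤ, w' = (2 : ℝ) • toPlane u + w ∨ w' = (2 : ℝ) • toPlane u - w := by
  rw [cover_eq_iff]
  exact ⟨fun ⟨j, k, h⟩ => ⟨(j, k), h⟩, fun ⟨u, h⟩ => ⟨u.1, u.2, h⟩⟩

/-- As `v` is primitive, parameters with the same image have an even integer as difference
(translations) or as sum (half turns). In the unit interval both force equality. -/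
theorem cover_segmentMap_injective (x : ℤ × ℤ) {v : ℤ × ℤ} (hv : IsCoprime v.1 v.2) {s t : I}
    (h : cover (segmentMap x v s) = cover (segmentMap x v t)) : s = t := by
  obtain ⟨u, h | h⟩ := cover_eq_iff'.1 h
  · obtain ⟨k, hk⟩ := exists_int_of_smul_eq hv (t := t - s) (m := 2) (x := u) (by
      rw [segmentMap_apply, segmentMap_apply] at h
      rw [sub_smul]
      linear_combination h)
    have h0 := s.2.1
    have h1 := s.2.2
    have h0' := t.2.1
    have h1' := t.2.2
    have a : (-1 : ℝ) ≤ 2 * k := by linarith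
    have b : 2 * (k : ℝ) ≤ 1 := by linarith
    have a' : -1 ≤ 2 * k := by exact_mod_cast a
    have b' : 2 * k ≤ 1 := by exact_mod_cast b
    have hk0 : k = 0 := by lia
    rw [hk0] at hk
    apply Subtype.ext
    push_cast at hk
    linarith
  · obtain ⟨k, hk⟩ := exists_int_of_smul_eq hv (t := t + s) (m := 2) (x := u - x) (by
      rw [segmentMap_apply, segmentMap_apply] at h
      rw [toPlane_sub, smul_sub, add_smul, two_smul ℝ (toPlane x)]
      linear_combination h)
    have h0 := s.2.1
    have h1 := s.2.2
    have h0' := t.2.1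
    have h1' := t.2.2
    have a : (0 : ℝ) ≤ 2 * k := by linarith
    have b : 2 * (k : ℝ) ≤ 2 := by linarith
    have a' : 0 ≤ 2 * k := by exact_mod_cast a
    have b' : 2 * k ≤ 2 := by exact_mod_cast b
    apply Subtype.ext
    obtain rfl | rfl : k = 0 ∨ k = 1 := by lia
    · push_cast at hk
      linarith
    · push_cast at hk
      linarith

/-- The image of the segment from `x` to `x + v` in the sphere. -/
def segmentArc (x v : ℤ × ℤ) (hv : IsCoprime v.1 v.2) : ArcCurve where
  toMap := ⟨fun s => cover (segmentMap x v s), continuous_cover.comp (segmentMap x v).continuous⟩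
  isMarked s := by
    rw [ContinuousMap.coe_mk, cover_mem_marked]
    exact isLattice_segmentMap x hv s
  simple s t h := Or.inl (cover_segmentMap_injective x hv h)
  not_contractible := by
    refine not_isContractible (fun s => ?_) fun h => ?_
    · rw [ContinuousMap.coe_mk, cover_mem_marked]
      exact isLattice_segmentMap x hv s
    · exact zero_ne_one (cover_segmentMap_injective x hv h)

/-- Every curve that represents a straight arc lifts to a curve with the same endpoints as the
segment, up to the orientation. -/
theorem exists_lift_of_homotopic {f : C(I, Sphere)} {x v : ℤ × ℤ} {hv : IsCoprime v.1 v.2}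
    (h : Homotopic (segmentArc x v hv).toMap f ∨
      Homotopic (segmentArc x v hv).toMap (reverse f)) :
    ∃ g : C(I, ℝ × ℝ), ∃ x' v' : ℤ × ℤ, (∀ s, cover (g s) = f s) ∧ g 0 = toPlane x' ∧
      g 1 = toPlane x' + toPlane v' ∧ ((x' = x ∧ v' = v) ∨ (x' = x + v ∧ v' = -v)) := by
  rcases h with ⟨⟨H⟩⟩ | ⟨⟨H⟩⟩
  · obtain ⟨g, h1, h2, h3⟩ := exists_lift_of_homotopy (segmentMap x v) H.toContinuousMap
      (fun s => H.apply_zero s) (fun t s => H.prop' t s)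
    refine ⟨g, x, v, fun s => (h1 s).trans (H.apply_one s), ?_, ?_, Or.inl ⟨rfl, rfl⟩⟩
    · rw [h2, segmentMap_zero]
    · rw [h3, segmentMap_one]
  · obtain ⟨g, h1, h2, h3⟩ := exists_lift_of_homotopy (segmentMap x v) H.toContinuousMap
      (fun s => H.apply_zero s) (fun t s => H.prop' t s)
    refine ⟨g.comp ⟨unitInterval.symm, by fun_prop⟩, x + v, -v, fun s => ?_, ?_, ?_,
      Or.inr ⟨rfl, rfl⟩⟩
    · refine (h1 (unitInterval.symm s)).trans ((H.apply_one _).trans ?_)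
      simp [reverse]
    · simp [h3, segmentMap_one, toPlane_add]
    · simp [h2, segmentMap_zero, toPlane_add, toPlane_neg]

/-! ### Determinants and the compatibility of straight arcs. -/

/-- The determinant of two integral vectors. -/
def idet (v w : ℤ × ℤ) : ℤ := v.1 * w.2 - v.2 * w.1

theorem det_toPlane (v w : ℤ × ℤ) : det (toPlane v) (toPlane w) = idet v w := by
  simp [det, toPlane, idet]

theorem det_add_right (v w w' : ℝ × ℝ) : det v (w + w') = det v w + det v w' := by
  simp only [det, Prod.fst_add, Prod.snd_add]
  ring

theorem det_smul_right (v w : ℝ × ℝ) (t : ℝ) : det v (t • w) = t * det v w := by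
  simp only [det, Prod.smul_fst, Prod.smul_snd, smul_eq_mul]
  ring

theorem det_self (v : ℝ × ℝ) : det v v = 0 := by
  simp only [det]
  ring

theorem exists_idet_eq_one {v : ℤ × ℤ} (hv : IsCoprime v.1 v.2) : ∃ u, idet v u = 1 := by
  obtain ⟨a, b, hab⟩ := hv
  exact ⟨(-b, a), by simp only [idet]; linarith⟩

/-- Parallel segments of the same direction are disjoint if they are at an odd distance. -/
theorem even_of_cover_eq {x y v : ℤ × ℤ} {s t : I}
    (h : cover (segmentMap x v s) = cover (segmentMap y v t)) : Even (idet v y - idet v x) := by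
  -- `det v` is constant on lines of direction `v`, and deck transformations change it by a sign and
  -- an even integer.
  have hd : ∀ (x : ℤ × ℤ) (s : I), det (toPlane v) (segmentMap x v s) = idet v x := by
    intro x s
    rw [segmentMap_apply, det_add_right, det_smul_right, det_self, mul_zero, add_zero, det_toPlane]
  obtain ⟨u, h | h⟩ := cover_eq_iff'.1 h
  · have := congrArg (det (toPlane v)) h
    rw [det_add_right, det_smul_right, hd, hd, det_toPlane] at this
    have : idet v y = 2 * idet v u + idet v x := by exact_mod_cast this
    exact ⟨idet v u, by linarith⟩
  · have := congrArg (det (toPlane v)) h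
    rw [det_sub_right, det_smul_right, hd, hd, det_toPlane] at this
    have : idet v y = 2 * idet v u - idet v x := by exact_mod_cast this
    exact ⟨idet v u - idet v x, by linarith⟩

/-- Straight arcs of different directions are not homotopic. -/
theorem idet_eq_zero_of_toArc_eq {x v y v' : ℤ × ℤ} {hv : IsCoprime v.1 v.2}
    {hv' : IsCoprime v'.1 v'.2} (h : (segmentArc x v hv).toArc = (segmentArc y v' hv').toArc) :
    idet v v' = 0 := by
  by_contra hne
  obtain ⟨g, x', w, hg, h0, h1, hw⟩ := exists_lift_of_homotopic (Quotient.exact h)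
  obtain ⟨u, hu⟩ := exists_idet_eq_one hv'
  -- `g` lifts the segment at `y` of direction `v'` but has ends in direction `±v`. So it would have
  -- to cross the parallel segment at `y + u`, which is at the odd distance `1`.
  obtain ⟨s, s', hs, -⟩ := exists_cover_eq g (segmentMap (y + u) v') h0 h1
    (segmentMap_zero _ _) (segmentMap_one _ _) (by
      rcases hw with ⟨-, rfl⟩ | ⟨-, rfl⟩
      · exact hne
      · simp only [idet, Prod.fst_neg, Prod.snd_neg] at hne ⊢
        intro h
        apply hne
        linarith)
  rw [hg s] at hs
  have := even_of_cover_eq (x := y) (y := y + u) (v := v') (s := s) (t := s') hs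
  have e : idet v' (y + u) - idet v' y = 1 := by
    rw [← hu]
    simp only [idet, Prod.fst_add, Prod.snd_add]
    ring
  rw [e] at this
  exact absurd this (by decide)

/-- Modulo `2` both vectors are nonzero, and over the field with two elements linearly dependent
nonzero vectors are equal. -/
theorem parity_eq {v v' : ℤ × ℤ} (hv : IsCoprime v.1 v.2) (hv' : IsCoprime v'.1 v'.2)
    (h : Even (idet v v')) : Even (v.1 - v'.1) ∧ Even (v.2 - v'.2) := by
  have key : ∀ a b a' b' c d c' d' : ZMod 2, c * a + d * b = 1 → c' * a' + d' * b' = 1 →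
      a * b' - b * a' = 0 → a - a' = 0 ∧ b - b' = 0 := by decide
  obtain ⟨c, d, h1⟩ := hv
  obtain ⟨c', d', h2⟩ := hv'
  have := key v.1 v.2 v'.1 v'.2 c d c' d' (by exact_mod_cast congrArg (Int.cast : ℤ → ZMod 2) h1)
    (by exact_mod_cast congrArg (Int.cast : ℤ → ZMod 2) h2) (by
      have := (ZMod.intCast_zmod_eq_zero_iff_dvd (idet v v') 2).2 (even_iff_two_dvd.1 h)
      simpa [idet] using this)
  constructor
  · rw [even_iff_two_dvd]
    exact (ZMod.intCast_zmod_eq_zero_iff_dvd _ 2).1 (by push_cast; exact this.1)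
  · rw [even_iff_two_dvd]
    exact (ZMod.intCast_zmod_eq_zero_iff_dvd _ 2).1 (by push_cast; exact this.2)

/-- The determinants of compatible straight arcs are small. -/
theorem abs_idet_le_of_compatible {x v y v' : ℤ × ℤ} {hv : IsCoprime v.1 v.2}
    {hv' : IsCoprime v'.1 v'.2}
    (h : Compatible (segmentArc x v hv).toArc (segmentArc y v' hv').toArc) :
    |idet v v'| ≤ if Even (idet v x - idet v' y) then 2 else 1 := by
  by_cases hne : idet v v' = 0
  · rw [hne, abs_zero]
    split_ifs <;> norm_num
  rcases h with h | ⟨γ, δ, hγ, hδ, hdis⟩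
  · exact absurd (idet_eq_zero_of_toArc_eq h) hne
  obtain ⟨g, x₁, w, hg, h0, h1, hw⟩ := exists_lift_of_homotopic (Quotient.exact hγ.symm)
  obtain ⟨g', y₁, w', hg', h0', h1', hw'⟩ := exists_lift_of_homotopic (Quotient.exact hδ.symm)
  have hww : w.1 * w'.2 - w.2 * w'.1 ≠ 0 := by
    simp only [idet] at hne
    rcases hw with ⟨-, rfl⟩ | ⟨-, rfl⟩ <;> rcases hw' with ⟨-, rfl⟩ | ⟨-, rfl⟩ <;>
      (try simp only [Prod.fst_neg, Prod.snd_neg]) <;> intro h <;> apply hne <;> linarith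
  -- Translating the second lift by `2 u` does not change its image. The crossing that then exists
  -- lies over a marked point by disjointness, so it happens at ends of both curves.
  have key : ∀ u : ℤ × ℤ, ∃ j k : ℤ, x + j • v = y + 2 • u + k • v' := by
    intro u
    obtain ⟨s, s', hs, hss⟩ := exists_cover_eq g
      ⟨fun s => g' s + 2 • toPlane u, by fun_prop⟩ (y := y₁ + 2 • u) h0 h1
      (by simp [h0', toPlane]) (by
        simp only [ContinuousMap.coe_mk, h1', toPlane_add]
        simp only [toPlane]
        ext <;> simp <;> ring) hww
    simp only [ContinuousMap.coe_mk] at hs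
    rw [cover_add_two, hg, hg'] at hs
    have hm : γ.toMap s ∈ marked := hdis ⟨⟨s, rfl⟩, ⟨s', hs.symm⟩⟩
    obtain ⟨j, k, hjk⟩ := hss ((γ.isMarked s).1 hm) ((δ.isMarked s').1 (hs ▸ hm))
    rcases hw with ⟨rfl, rfl⟩ | ⟨rfl, rfl⟩ <;> rcases hw' with ⟨rfl, rfl⟩ | ⟨rfl, rfl⟩
    · exact ⟨j, k, hjk⟩
    · exact ⟨j, 1 - k, by linear_combination hjk⟩
    · exact ⟨1 - j, k, by linear_combination hjk⟩
    · exact ⟨1 - j, 1 - k, by linear_combination hjk⟩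
  obtain ⟨j₀, k₀, e0⟩ := key 0
  obtain ⟨j₁, k₁, e1⟩ := key (1, 0)
  obtain ⟨j₂, k₂, e2⟩ := key (0, 1)
  have a0 := congrArg Prod.fst e0
  have b0 := congrArg Prod.snd e0
  have a1 := congrArg Prod.fst e1
  have b1 := congrArg Prod.snd e1
  have a2 := congrArg Prod.fst e2
  have b2 := congrArg Prod.snd e2
  simp only [Prod.fst_add, Prod.snd_add, Prod.smul_fst, Prod.smul_snd] at a0 b0 a1 b1 a2 b2
  simp only [smul_eq_mul, nsmul_eq_mul, Prod.fst_zero, Prod.snd_zero, mul_zero, mul_one, add_zero,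
    Nat.cast_ofNat] at a0 b0 a1 b1 a2 b2
  obtain ⟨c, d, hcd⟩ := hv'
  -- Subtracting the relation for `u = 0` gives `(2, 0)` and `(0, 2)` as combinations of `v` and
  -- `v'`. Pairing with `v'` shows that the determinant divides `2 v'.1` and `2 v'.2`, and `v'` is
  -- primitive.
  have hdvd : idet v v' ∣ 2 := by
    refine ⟨d * (j₁ - j₀) * 1 - c * (j₂ - j₀), ?_⟩
    simp only [idet]
    linear_combination (-2) * hcd - d * (v'.2 * (a1 - a0) - v'.1 * (b1 - b0)) +
      c * (v'.2 * (a2 - a0) - v'.1 * (b2 - b0))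
  have hle : |idet v v'| ≤ 2 := Int.le_of_dvd two_pos ((abs_dvd _ _).2 hdvd)
  split_ifs with heven
  · exact hle
  · by_contra hlt
    apply heven
    have h2 : |idet v v'| = 2 := by lia
    have hev : Even (idet v v') := by
      rw [← even_abs, h2]
      exact even_two
    obtain ⟨p1, p2⟩ := parity_eq hv ⟨c, d, hcd⟩ hev
    -- An even determinant makes `v` and `v'` congruent modulo `2`, and the common lattice point for
    -- `u = 0` then compares the two parities.
    have e : idet v x - idet v' y = k₀ * idet v v' + (v.1 - v'.1) * y.2 - (v.2 - v'.2) * y.1 := by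
      simp only [idet]
      linear_combination v.1 * b0 - v.2 * a0
    rw [e]
    exact ((hev.mul_left _).add (p1.mul_right _)).sub (p2.mul_right _)

/-- Straight arcs of small determinant are disjoint. -/
theorem compatible_of_abs_idet_le {x v y v' : ℤ × ℤ} (hv : IsCoprime v.1 v.2)
    (hv' : IsCoprime v'.1 v'.2) (hne : idet v v' ≠ 0)
    (h : |idet v v'| ≤ if Even (idet v x - idet v' y) then 2 else 1) :
    Compatible (segmentArc x v hv).toArc (segmentArc y v' hv').toArc := by
  refine Or.inr ⟨_, _, rfl, rfl, ?_⟩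
  rintro z ⟨⟨s, hs⟩, ⟨s', hs'⟩⟩
  have hss : cover (segmentMap y v' s') = cover (segmentMap x v s) := hs'.trans hs.symm
  have hz : z = cover (segmentMap x v s) := hs.symm
  rw [hz, cover_mem_marked, isLattice_segmentMap x hv]
  -- Applying `det v'` to the coincidence eliminates the parameter `s'`. The unknown deck
  -- transformation contributes only an even integer and a sign.
  have key : ∃ t : ℤ, (s : ℝ) * idet v v' = t ∧ Even (t + idet v' (x - y)) := by
    obtain ⟨u, h | h⟩ := cover_eq_iff'.1 hss
    · have := congrArg (det (toPlane v')) h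
      simp only [segmentMap_apply, det_add_right, det_smul_right, det_self, det_toPlane] at this
      refine ⟨idet v' (x - y) - 2 * idet v' u, ?_, ?_⟩
      · simp only [idet, Prod.fst_sub, Prod.snd_sub] at this ⊢
        push_cast at this ⊢
        linarith
      · exact ⟨idet v' (x - y) - idet v' u, by ring⟩
    · have := congrArg (det (toPlane v')) h
      simp only [segmentMap_apply, det_add_right, det_sub_right, det_smul_right, det_self,
        det_toPlane] at this
      refine ⟨idet v' (x + y) - 2 * idet v' u, ?_, ?_⟩
      · simp only [idet, Prod.fst_add, Prod.snd_add] at this ⊢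
        push_cast at this ⊢
        linarith
      · refine ⟨idet v' x - idet v' u, ?_⟩
        simp only [idet, Prod.fst_add, Prod.snd_add, Prod.fst_sub, Prod.snd_sub]
        ring
  obtain ⟨t, ht, htp⟩ := key
  suffices hdvd : idet v v' ∣ t by
    obtain ⟨k, rfl⟩ := hdvd
    refine unitInterval_eq_zero_or_one (k := k) ?_
    have : (idet v v' : ℝ) ≠ 0 := by exact_mod_cast hne
    apply mul_right_cancel₀ this
    rw [ht]
    push_cast
    ring
  have hpos : 0 < |idet v v'| := abs_pos.2 hne
  split_ifs at h with heven
  · obtain h1 | h1 : |idet v v'| = 1 ∨ |idet v v'| = 2 := by lia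
    · rw [← abs_dvd, h1]
      exact one_dvd _
    · rw [← abs_dvd, h1]
      have hev : Even (idet v v') := by
        rw [← even_abs, h1]
        exact even_two
      obtain ⟨p1, p2⟩ := parity_eq hv hv' hev
      -- For determinant `±2` the directions agree modulo `2`; then the hypothesis on parities makes
      -- `t` even.
      have e : t = (t + idet v' (x - y)) - (idet v x - idet v' y) +
          ((v.1 - v'.1) * x.2 - (v.2 - v'.2) * x.1) := by
        simp only [idet, Prod.fst_sub, Prod.snd_sub]
        ring
      rw [← even_iff_two_dvd, e]
      exact (htp.sub heven).add ((p1.mul_right _).sub (p2.mul_right _))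
  · have h1 : |idet v v'| = 1 := by lia
    rw [← abs_dvd, h1]
    exact one_dvd _

/-- Parallel straight arcs of different kinds are disjoint. -/
theorem compatible_of_odd {x v y : ℤ × ℤ} (hv : IsCoprime v.1 v.2)
    (h : ¬ Even (idet v x - idet v y)) :
    Compatible (segmentArc x v hv).toArc (segmentArc y v hv).toArc := by
  refine Or.inr ⟨_, _, rfl, rfl, ?_⟩
  rintro z ⟨⟨s, hs⟩, ⟨s', hs'⟩⟩
  exact absurd (even_of_cover_eq (x := y) (y := x) (v := v) (s := s') (t := s) (hs'.trans hs.symm)) h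

/-! ### The pieces of the drawn curves -/

/-- The ordinate, over the abscissa `x`, of the piece of level `t` that runs from the ray `LO`
around `L`, then along a line, and possibly around `U` to the ray `UO`. -/
def graphHeight (κ t x : ℝ) : ℝ :=
  √(3 * t ^ 2 - (min (x + 1) 0) ^ 2) + (1 - 2 * κ) * √3 / 3 * max 0 (min (x + 1) (3 / 2)) +
    (√(3 * (t - κ) ^ 2 - (max (x - 1 / 2) 0) ^ 2) - √3 * |t - κ|)

theorem sqrt_three_mul_sq (t : ℝ) : √(3 * t ^ 2 - 0 ^ 2) = √3 * |t| := by
  rw [zero_pow two_ne_zero, sub_zero, Real.sqrt_mul (by norm_num), Real.sqrt_sq_eq_abs]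

/-- The clipping by `min` and `max` lets one term of `graphHeight` vary at a time: a circle about
`L` of radius `√3 t`, then a line, then a circle about `U` of radius `√3 (t - κ)`. -/
theorem graphHeight_left {κ t x : ℝ} (hx : x ≤ -1) :
    graphHeight κ t x = √(3 * t ^ 2 - (x + 1) ^ 2) := by
  rw [graphHeight, min_eq_left (by linarith), min_eq_left (by linarith), max_eq_left (by linarith),
    max_eq_right (by linarith), sqrt_three_mul_sq]
  ring

theorem graphHeight_middle {κ t x : ℝ} (ht : 0 ≤ t) (h1 : -1 ≤ x) (h2 : x ≤ 1 / 2) :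
    graphHeight κ t x = √3 * t + (1 - 2 * κ) * √3 / 3 * (x + 1) := by
  rw [graphHeight, min_eq_right (by linarith), min_eq_left (by linarith), max_eq_right (by linarith),
    max_eq_right (by linarith), sqrt_three_mul_sq, sqrt_three_mul_sq, abs_of_nonneg ht]
  ring

theorem graphHeight_right {κ t x : ℝ} (hc : 0 ≤ κ) (ht : κ ≤ t) (hx : 1 / 2 ≤ x) :
    graphHeight κ t x = √3 / 2 + √(3 * (t - κ) ^ 2 - (x - 1 / 2) ^ 2) := by
  rw [graphHeight, min_eq_right (by linarith), min_eq_right (by linarith), max_eq_right (by norm_num),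
    max_eq_left (by linarith), abs_of_nonneg (by linarith : (0 : ℝ) ≤ t - κ), sqrt_three_mul_sq,
    abs_of_nonneg (hc.trans ht)]
  ring

/-- The abscissa of the end of a piece. -/
def exitX (κ t : ℝ) : ℝ := if t < κ then -1 + 3 / 2 * (t / κ) else 1 / 2 + √3 / 2 * (t - κ)

/-- The parameter on a piece. -/
def frac (κ t u : ℝ) : ℝ := if t < κ then κ * u / t else (1 - κ) * u / (1 - t)

/-- The abscissa of a point of a piece. -/
def abscissa (κ t u : ℝ) : ℝ := -1 - √3 * t + frac κ t u * (exitX κ t + 1 + √3 * t)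

/-- The pieces in the sector `LUO`. -/
def sideCurve (κ t u : ℝ) : ℂ := ⟨abscissa κ t u, graphHeight κ t (abscissa κ t u)⟩

theorem continuous_sideCurve (κ t : ℝ) : Continuous (sideCurve κ t) := by
  have h1 : Continuous (abscissa κ t) := by
    unfold abscissa frac
    split_ifs <;> fun_prop
  have h2 : Continuous fun u => graphHeight κ t (abscissa κ t u) := by
    unfold graphHeight
    fun_prop
  have e : sideCurve κ t = fun u => ((abscissa κ t u : ℝ) : ℂ) +
      ((graphHeight κ t (abscissa κ t u) : ℝ) : ℂ) * Complex.I := by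
    funext u
    apply Complex.ext <;> simp [sideCurve]
  rw [e]
  fun_prop

section Side

variable {κ l u o : ℝ}

theorem exitX_pos (h0 : 0 < κ) {t : ℝ} (ht : 0 < t) : 0 < exitX κ t + 1 + √3 * t := by
  have := sqrt_three_pos
  unfold exitX
  split_ifs with h
  · have : 0 < t / κ := by positivity
    have : 0 < √3 * t := by positivity
    linarith
  · have : 0 ≤ √3 * (t - κ) := mul_nonneg (by positivity) (by linarith)
    have : 0 < √3 * t := by positivity
    linarith

/-- The parameter lies in the unit interval; it is `0` on the ray `LO` only, and `1` at the end. -/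
theorem frac_mem (h0 : 0 < κ) (h1 : κ < 1) (hl : 0 ≤ l) (hu : 0 ≤ u) (ho : 0 < o)
    (hs : l + u + o = 1) (hlu : 0 < l + u) :
    0 ≤ frac κ (κ * u + o) u ∧ frac κ (κ * u + o) u ≤ 1 ∧
      (frac κ (κ * u + o) u = 0 → u = 0) ∧ (κ * u + o < κ → frac κ (κ * u + o) u < 1) ∧
      (κ ≤ κ * u + o → frac κ (κ * u + o) u = 1 → l = 0) := by
  have ht : 0 < κ * u + o := by positivity
  have ht1 : 1 - (κ * u + o) = l + (1 - κ) * u := by linear_combination -hs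
  have ht1' : 0 < l + (1 - κ) * u := by
    rcases hl.lt_or_eq with h | h
    · have : 0 ≤ (1 - κ) * u := mul_nonneg (by linarith) hu
      linarith
    · have : 0 < (1 - κ) * u := mul_pos (by linarith) (by linarith)
      linarith
  unfold frac
  split_ifs with h
  · refine ⟨by positivity, ?_, ?_, ?_, ?_⟩
    · rw [div_le_one ht]
      linarith
    · intro h
      rw [div_eq_zero_iff] at h
      rcases h with h | h
      · exact (mul_eq_zero.1 h).resolve_left h0.ne'
      · linarith
    · intro _
      rw [div_lt_one ht]
      linarith
    · intro h'
      linarith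
  · rw [ht1]
    refine ⟨div_nonneg (mul_nonneg (by linarith) hu) ht1'.le, ?_, ?_, ?_, ?_⟩
    · rw [div_le_one ht1']
      linarith
    · intro h
      rw [div_eq_zero_iff] at h
      rcases h with h | h
      · exact (mul_eq_zero.1 h).resolve_left (by linarith)
      · linarith
    · intro h'
      linarith
    · intro _ h'
      rw [div_eq_one_iff_eq ht1'.ne'] at h'
      linarith

/-- On the line `κ u + o = t` of the face, `frac` is `u` divided by its largest value there. This is
attained on the edge `o = 0` if `t < κ` and on the edge `l = 0` otherwise. The abscissa runs
affinely in `frac` from the ray `LO` to `exitX`, where the piece reaches the segment `LU` or the ray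
`UO`. -/
theorem abscissa_mem (h0 : 0 < κ) (h1 : κ < 1) (hl : 0 ≤ l) (hu : 0 ≤ u) (ho : 0 < o)
    (hs : l + u + o = 1) (hlu : 0 < l + u) :
    -1 - √3 * (κ * u + o) ≤ abscissa κ (κ * u + o) u ∧
      abscissa κ (κ * u + o) u ≤ exitX κ (κ * u + o) ∧
      (abscissa κ (κ * u + o) u = -1 - √3 * (κ * u + o) → u = 0) ∧
      (κ * u + o < κ → abscissa κ (κ * u + o) u < exitX κ (κ * u + o)) ∧
      (κ ≤ κ * u + o → abscissa κ (κ * u + o) u = exitX κ (κ * u + o) → l = 0) := by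
  obtain ⟨f0, f1, f2, f3, f4⟩ := frac_mem h0 h1 hl hu ho hs hlu
  have ht : 0 < κ * u + o := by positivity
  have hX := exitX_pos h0 ht
  set t := κ * u + o
  set f := frac κ t u
  set E := exitX κ t + 1 + √3 * t with hE
  have hd : abscissa κ t u = -1 - √3 * t + f * E := rfl
  refine ⟨?_, ?_, ?_, ?_, ?_⟩
  · rw [hd]
    have : 0 ≤ f * E := mul_nonneg f0 hX.le
    linarith
  · rw [hd]
    have : f * E ≤ 1 * E := mul_le_mul_of_nonneg_right f1 hX.le
    linarith
  · intro h
    rw [hd] at h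
    have : f * E = 0 := by linarith
    exact f2 ((mul_eq_zero.1 this).resolve_right hX.ne')
  · intro hlt
    rw [hd]
    have : f * E < 1 * E := mul_lt_mul_of_pos_right (f3 hlt) hX
    linarith
  · intro hle h
    rw [hd] at h
    have : f * E = 1 * E := by linarith
    exact f4 hle (mul_right_cancel₀ hX.ne' this)

/-- The pieces in the sector `LUO` lie in this sector. -/
theorem sideCurve_sector (h0 : 0 < κ) (h1 : κ < 1) (hl : 0 ≤ l) (hu : 0 ≤ u) (ho : 0 < o)
    (hs : l + u + o = 1) (hlu : 0 < l + u) :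
    let z := sideCurve κ (κ * u + o) u
    baryD z < 0 ∧ baryD z ≤ baryL z ∧ baryD z ≤ baryU z ∧ (baryL z = baryD z → l = 0) ∧
      (baryU z = baryD z → u = 0) := by
  obtain ⟨a1, a2, a3, a4, a5⟩ := abscissa_mem h0 h1 hl hu ho hs hlu
  have ht : 0 < κ * u + o := by positivity
  intro z
  have h3 := sqrt_three_pos
  have h33 := sqrt_three_sq
  have hre : z.re = abscissa κ (κ * u + o) u := rfl
  have him : z.im = graphHeight κ (κ * u + o) z.re := rfl
  rw [← hre] at a1 a2 a3 a4 a5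
  have hu1 : κ * u + o = κ → u = 1 → False := fun h h' => by
    rw [h'] at h
    linarith
  set t := κ * u + o
  clear_value z
  -- it is enough to know the position relative to the lines `LU`, `LO` and `UO`
  suffices h : 1 + z.re - √3 * z.im < 0 ∧ 0 ≤ z.im ∧ (z.im = 0 → u = 0) ∧
      0 ≤ √3 * z.im - 3 * z.re ∧ (√3 * z.im - 3 * z.re = 0 → l = 0) by
    obtain ⟨b1, b2, b3, b4, b5⟩ := h
    have b2' : 0 ≤ √3 * z.im := by positivity
    simp only [baryL, baryU, baryD]
    refine ⟨by linarith, by linarith, by linarith, fun h => b5 (by linarith), fun h => b3 ?_⟩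
    have : √3 * z.im = 0 := by linarith
    exact (mul_eq_zero.1 this).resolve_left h3.ne'
  rcases le_or_gt z.re (-1) with c1 | c1
  · rw [graphHeight_left c1] at him
    have hrad : 0 ≤ 3 * t ^ 2 - (z.re + 1) ^ 2 := by
      have e : 3 * t ^ 2 - (z.re + 1) ^ 2 = (√3 * t - (z.re + 1)) * (√3 * t + (z.re + 1)) := by
        linear_combination -t ^ 2 * h33
      rw [e]
      have : 0 < √3 * t := by positivity
      exact mul_nonneg (by linarith) (by linarith)
    have hn : 0 ≤ z.im := him ▸ Real.sqrt_nonneg _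
    have hn' : 0 ≤ √3 * z.im := by positivity
    refine ⟨?_, hn, fun h => a3 ?_, by linarith, fun h => by linarith⟩
    · rcases c1.lt_or_eq with c | c
      · linarith
      · have : 0 < z.im := by
          rw [him, c]
          exact Real.sqrt_pos.2 (by norm_num; positivity)
        have : 0 < √3 * z.im := by positivity
        linarith
    · rw [h, eq_comm, Real.sqrt_eq_zero hrad] at him
      have e : (√3 * t - (z.re + 1)) * (√3 * t + (z.re + 1)) = 0 := by
        linear_combination him + t ^ 2 * h33
      have : 0 < √3 * t := by positivity
      rcases mul_eq_zero.1 e with e | e <;> linarith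
  · have hD : z.re ≤ 1 / 2 → 1 + z.re - √3 * z.im < 0 := by
      intro c2
      rw [graphHeight_middle ht.le c1.le c2] at him
      have e : 1 + z.re - √3 * z.im = 2 * κ * (z.re + 1) - 3 * t := by
        rw [him]
        linear_combination (-t - (1 - 2 * κ) / 3 * (z.re + 1)) * h33
      rw [e]
      rcases lt_or_ge t κ with c | c
      · have h5 := a4 c
        rw [exitX, if_pos c] at h5
        have : z.re + 1 < 3 / 2 * (t / κ) := by linarith
        have : 2 * κ * (z.re + 1) < 2 * κ * (3 / 2 * (t / κ)) := by gcongr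
        have e2 : 2 * κ * (3 / 2 * (t / κ)) = 3 * t := by field_simp
        linarith
      · have h6 : 2 * κ * (z.re + 1) ≤ 3 * κ := by nlinarith
        rcases h6.lt_or_eq with h7 | h7
        · linarith
        · rcases c.lt_or_eq with c' | c'
          · linarith
          -- Equality would mean that the point is `U`, reached at `t = κ`, where `l = 0` and hence
          -- `o = 0`.
          · exfalso
            have hz : z.re = 1 / 2 := by
              have : κ * (2 * (z.re + 1) - 3) = 0 := by linarith
              have := (mul_eq_zero.1 this).resolve_left h0.ne'
              linarith
            have := a5 c (by
              rw [exitX, if_neg (not_lt.2 c), ← c', hz]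
              ring)
            have ho0 : (1 - κ) * o = 0 := by
              have h8 : t = κ * u + o := rfl
              linear_combination -h8 - c' - κ * hs + κ * this
            rcases mul_eq_zero.1 ho0 with h | h <;> linarith
    rcases le_or_gt z.re (1 / 2) with c2 | c2
    · have hD' := hD c2
      have hn : 0 < z.im := by
        by_contra hneg
        push Not at hneg
        have : √3 * z.im ≤ 0 := mul_nonpos_of_nonneg_of_nonpos h3.le hneg
        linarith
      exact ⟨hD', hn.le, fun h => by linarith, by linarith, fun h => by linarith⟩
    · have hlt : κ ≤ t := by
        by_contra hlt
        push Not at hlt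
        rw [exitX, if_pos hlt] at a2
        have : t / κ < 1 := by rwa [div_lt_one h0]
        linarith
      rw [graphHeight_right h0.le hlt c2.le] at him
      rw [exitX, if_neg (not_lt.2 hlt)] at a2 a5
      -- The bound by `exitX` keeps the point of the circle on or above the ray from `U` to `O`,
      -- whose gradient is `√3`.
      have hrad : 3 * (z.re - 1 / 2) ^ 2 ≤ 3 * (t - κ) ^ 2 - (z.re - 1 / 2) ^ 2 := by
        have : (2 * (z.re - 1 / 2)) ^ 2 ≤ (√3 * (t - κ)) ^ 2 := by
          apply pow_le_pow_left₀ (by linarith)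
          linarith
        rw [mul_pow √3, Real.sq_sqrt (by norm_num)] at this
        linarith
      have hroot : √3 * (z.re - 1 / 2) ≤ √(3 * (t - κ) ^ 2 - (z.re - 1 / 2) ^ 2) := by
        apply Real.le_sqrt_of_sq_le
        rw [mul_pow, Real.sq_sqrt (by norm_num)]
        exact hrad
      have hy : z.im = √3 / 2 + √(3 * (t - κ) ^ 2 - (z.re - 1 / 2) ^ 2) := him
      set w := √(3 * (t - κ) ^ 2 - (z.re - 1 / 2) ^ 2) with hw
      have hw3 : 3 * (z.re - 1 / 2) ≤ √3 * w := by
        calc 3 * (z.re - 1 / 2) = √3 * (√3 * (z.re - 1 / 2)) := by linear_combination -(z.re - 1 / 2) * h33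
          _ ≤ √3 * w := by gcongr
      have e3 : √3 * z.im = 3 / 2 + √3 * w := by
        rw [hy]
        linear_combination h33 / 2
      have hwpos : 0 ≤ w := Real.sqrt_nonneg _
      refine ⟨by linarith, by rw [hy]; positivity, fun h => ?_, by linarith, fun h => a5 hlt ?_⟩
      · have : 0 < z.im := by rw [hy]; positivity
        linarith
      · have e4 : w = √3 * (z.re - 1 / 2) := by
          have : √3 * w = √3 * (√3 * (z.re - 1 / 2)) := by
            linear_combination h - e3 - (z.re - 1 / 2) * h33
          exact mul_left_cancel₀ h3.ne' this
        have e5 : 3 * (t - κ) ^ 2 - (z.re - 1 / 2) ^ 2 = 3 * (z.re - 1 / 2) ^ 2 := by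
          have : w ^ 2 = 3 * (t - κ) ^ 2 - (z.re - 1 / 2) ^ 2 :=
            Real.sq_sqrt (by nlinarith [sq_nonneg (z.re - 1 / 2)])
          rw [← this, e4, mul_pow, Real.sq_sqrt (by norm_num)]
        have e6 : (2 * (z.re - 1 / 2)) ^ 2 = (√3 * (t - κ)) ^ 2 := by
          rw [mul_pow √3, Real.sq_sqrt (by norm_num)]
          linarith
        have e7 := (pow_left_inj₀ (by linarith) (mul_nonneg h3.le (by linarith)) two_ne_zero).1 e6
        linarith

end Side

theorem graphHeight_left_inj {κ t t' x : ℝ} (ht : 0 ≤ t) (ht' : 0 ≤ t') (hx : x ≤ -1)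
    (h1 : -1 - √3 * t ≤ x) (h1' : -1 - √3 * t' ≤ x) (h : graphHeight κ t x = graphHeight κ t' x) :
    t = t' := by
  have h3 := sqrt_three_pos
  have h33 := sqrt_three_sq
  have hrad : ∀ t : ℝ, 0 ≤ t → -1 - √3 * t ≤ x → 0 ≤ 3 * t ^ 2 - (x + 1) ^ 2 := by
    intro t ht h1
    have e : 3 * t ^ 2 - (x + 1) ^ 2 = (√3 * t - (x + 1)) * (√3 * t + (x + 1)) := by
      linear_combination -t ^ 2 * h33
    rw [e]
    have : 0 ≤ √3 * t := by positivity
    exact mul_nonneg (by linarith) (by linarith)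
  rw [graphHeight_left hx, graphHeight_left hx, Real.sqrt_inj (hrad t ht h1) (hrad t' ht' h1')] at h
  exact (pow_left_inj₀ ht ht' two_ne_zero).1 (by linarith)

theorem graphHeight_right_inj {κ t t' x : ℝ} (hc : 0 ≤ κ) (ht : κ ≤ t) (ht' : κ ≤ t')
    (hx : 1 / 2 ≤ x) (h1 : x - 1 / 2 ≤ √3 * (t - κ)) (h1' : x - 1 / 2 ≤ √3 * (t' - κ))
    (h : graphHeight κ t x = graphHeight κ t' x) : t = t' := by
  have hrad : ∀ t : ℝ, x - 1 / 2 ≤ √3 * (t - κ) → 0 ≤ 3 * (t - κ) ^ 2 - (x - 1 / 2) ^ 2 := by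
    intro t h1
    have : (x - 1 / 2) ^ 2 ≤ (√3 * (t - κ)) ^ 2 := pow_le_pow_left₀ (by linarith) h1 2
    rw [mul_pow, Real.sq_sqrt (by norm_num)] at this
    linarith
  rw [graphHeight_right hc ht hx, graphHeight_right hc ht' hx, add_right_inj,
    Real.sqrt_inj (hrad t h1) (hrad t' h1')] at h
  have := (pow_left_inj₀ (sub_nonneg.2 ht) (sub_nonneg.2 ht') two_ne_zero).1 (by linarith)
  linarith

theorem exitX_sub_le {κ t : ℝ} (ht : κ ≤ t) : exitX κ t - 1 / 2 ≤ √3 * (t - κ) := by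
  rw [exitX, if_neg (not_lt.2 ht)]
  have : 0 ≤ √3 * (t - κ) := mul_nonneg sqrt_three_pos.le (by linarith)
  linarith

theorem exitX_le_half {κ t : ℝ} (h0 : 0 < κ) (ht : t < κ) : exitX κ t < 1 / 2 := by
  rw [exitX, if_pos ht]
  have : t / κ < 1 := by rwa [div_lt_one h0]
  linarith

/-- Over a fixed abscissa the pieces of different levels have different heights, being concentric
circles or parallel lines. Thus the point determines the level, and on one level the abscissa
determines `u`. -/
theorem sideCurve_inj {κ l u o l' u' o' : ℝ} (h0 : 0 < κ) (h1 : κ < 1) (hl : 0 ≤ l) (hu : 0 ≤ u)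
    (ho : 0 < o) (hs : l + u + o = 1) (hlu : 0 < l + u) (hl' : 0 ≤ l') (hu' : 0 ≤ u')
    (ho' : 0 < o') (hs' : l' + u' + o' = 1) (hlu' : 0 < l' + u')
    (h : sideCurve κ (κ * u + o) u = sideCurve κ (κ * u' + o') u') : u = u' ∧ o = o' := by
  obtain ⟨a1, a2, -, -, -⟩ := abscissa_mem h0 h1 hl hu ho hs hlu
  obtain ⟨b1, b2, -, -, -⟩ := abscissa_mem h0 h1 hl' hu' ho' hs' hlu'
  have hre : abscissa κ (κ * u + o) u = abscissa κ (κ * u' + o') u' := congrArg Complex.re h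
  have him : graphHeight κ (κ * u + o) (abscissa κ (κ * u + o) u) =
    graphHeight κ (κ * u' + o') (abscissa κ (κ * u' + o') u') := congrArg Complex.im h
  have ht : 0 < κ * u + o := by positivity
  have ht' : 0 < κ * u' + o' := by positivity
  have ht1 : κ * u + o < 1 := by
    nlinarith
  have hX := exitX_pos h0 ht
  have key : κ * u + o = κ * u' + o' := by
    rw [← hre] at b1 b2 him
    set t := κ * u + o
    set t' := κ * u' + o'
    set x := abscissa κ t u
    rcases le_total x (-1) with c1 | c1
    · exact graphHeight_left_inj ht.le ht'.le c1 a1 b1 him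
    · rcases le_or_gt x (1 / 2) with c2 | c2
      · rw [graphHeight_middle ht.le c1 c2, graphHeight_middle ht'.le c1 c2, add_left_inj] at him
        exact mul_left_cancel₀ sqrt_three_pos.ne' him
      · have e : κ ≤ t := by
          by_contra hlt
          linarith [exitX_le_half h0 (not_le.1 hlt)]
        have e' : κ ≤ t' := by
          by_contra hlt
          linarith [exitX_le_half h0 (not_le.1 hlt)]
        exact graphHeight_right_inj h0.le e e' c2.le (by linarith [exitX_sub_le e])
          (by linarith [exitX_sub_le e']) him
  rw [← key] at hre
  have hf : frac κ (κ * u + o) u = frac κ (κ * u + o) u' := by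
    unfold abscissa at hre
    exact mul_right_cancel₀ hX.ne' (by linarith)
  have hu : u = u' := by
    unfold frac at hf
    split_ifs at hf
    · rw [div_left_inj' ht.ne'] at hf
      exact mul_left_cancel₀ h0.ne' hf
    · rw [div_left_inj' (by linarith)] at hf
      exact mul_left_cancel₀ (by linarith) hf
  subst hu
  exact ⟨rfl, by linarith⟩

/-- The pieces in the sector `UDO` that belong to semicircles with centre `U`. -/
def capCurve (κ d o : ℝ) : ℂ :=
  ⟨1 / 2 + √3 * (d + (1 - κ) * o) * ((o / 2) / √(o ^ 2 - √3 * o * d + d ^ 2)),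
    √3 / 2 + √3 * (d + (1 - κ) * o) * ((√3 / 2 * o - d) / √(o ^ 2 - √3 * o * d + d ^ 2))⟩

/-- The ray in the sector `UDO`. -/
def rayPoint (κ o : ℝ) : ℂ := ⟨1 / (2 * (1 - o)), √3 * (κ - 1 / 2)⟩

/-! ### Semicircles and ray between the directions `UO` and `DO`. -/

section Cap

variable {κ u d o : ℝ}

/-- The root in `capCurve` is the length of `o e + d f`, where `e` and `f` are the unit vectors from
`U` towards `O` and `D`. The point lies in this direction from `U`. -/
theorem cap_norm_sq (o d : ℝ) : o ^ 2 - √3 * o * d + d ^ 2 = (o / 2) ^ 2 + (√3 / 2 * o - d) ^ 2 := by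
  linear_combination -o ^ 2 / 4 * sqrt_three_sq

theorem cap_norm_pos (ho : 0 < o) (d : ℝ) : 0 < √(o ^ 2 - √3 * o * d + d ^ 2) := by
  rw [cap_norm_sq]
  positivity

theorem sq_cap_norm (o d : ℝ) : √(o ^ 2 - √3 * o * d + d ^ 2) ^ 2 = o ^ 2 - √3 * o * d + d ^ 2 := by
  rw [Real.sq_sqrt]
  rw [cap_norm_sq]
  positivity

theorem abs_le_cap_norm (o d : ℝ) : |√3 / 2 * o - d| ≤ √(o ^ 2 - √3 * o * d + d ^ 2) := by
  rw [cap_norm_sq]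
  apply Real.abs_le_sqrt
  nlinarith [sq_nonneg o]

theorem norm_capCurve_sub (h1 : κ < 1) (hd : 0 ≤ d) (ho : 0 ≤ o) :
    ‖capCurve κ d o - U‖ = √3 * (d + (1 - κ) * o) := by
  have h3 := sqrt_three_pos
  have hδ : 0 ≤ √3 * (d + (1 - κ) * o) :=
    mul_nonneg h3.le (add_nonneg hd (mul_nonneg (by linarith) ho))
  rw [← Real.sqrt_sq hδ, ← Real.sqrt_sq (norm_nonneg _), Complex.sq_norm, Complex.normSq_apply]
  congr 1
  simp only [Complex.sub_re, Complex.sub_im, capCurve, U]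
  set δ := √3 * (d + (1 - κ) * o) with hδ'
  have hN := sq_cap_norm o d
  set N := √(o ^ 2 - √3 * o * d + d ^ 2)
  by_cases h0 : N = 0
  · have h0' : (o / 2) ^ 2 + (√3 / 2 * o - d) ^ 2 = 0 := by
      rw [← cap_norm_sq, ← hN, h0]
      norm_num
    have e1 : o = 0 := by nlinarith [sq_nonneg o, sq_nonneg (√3 / 2 * o - d)]
    have e2 : d = 0 := by
      rw [e1] at h0'
      simpa using h0'
    rw [hδ', e1, e2]
    norm_num
  · have e : ((o / 2) / N) ^ 2 + ((√3 / 2 * o - d) / N) ^ 2 = 1 := by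
      rw [div_pow, div_pow (_ - _), ← add_div, ← cap_norm_sq, ← hN]
      exact div_self (pow_ne_zero 2 h0)
    linear_combination δ ^ 2 * e

/-- The inequality between `u` and `d` says that the radius about `U` is less than `√3 (1 - κ)`, the
distance of `U` from the line of the ray. -/
theorem capCurve_im_gt (h1 : κ < 1) (hd : 0 ≤ d) (ho : 0 ≤ o) (hs : u + d + o = 1)
    (h : κ * d < (1 - κ) * u) : √3 * (κ - 1 / 2) < (capCurve κ d o).im := by
  have h3 := sqrt_three_pos
  have e := norm_capCurve_sub h1 hd ho
  have e2 := Complex.abs_im_le_norm (capCurve κ d o - U)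
  rw [e] at e2
  have e3 := (abs_le.1 e2).1
  simp only [Complex.sub_im, U] at e3
  have : √3 * (d + (1 - κ) * o) < √3 * (1 - κ) := by
    apply mul_lt_mul_of_pos_left _ h3
    nlinarith
  linarith

theorem capCurve_sector (h1 : κ < 1) (h0 : 0 < κ) (hd : 0 ≤ d) (ho : 0 < o) (hs : u + d + o = 1)
    (h : κ * d < (1 - κ) * u) :
    let z := capCurve κ d o
    baryL z < 0 ∧ baryL z ≤ baryD z ∧ baryL z < baryU z ∧ (baryL z = baryD z → d = 0) := by
  intro z
  have h3 := sqrt_three_pos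
  have h33 := sqrt_three_sq
  have hre : z.re = 1 / 2 + √3 * (d + (1 - κ) * o) *
    ((o / 2) / √(o ^ 2 - √3 * o * d + d ^ 2)) := rfl
  have him : z.im = √3 / 2 + √3 * (d + (1 - κ) * o) *
    ((√3 / 2 * o - d) / √(o ^ 2 - √3 * o * d + d ^ 2)) := rfl
  have hN := cap_norm_pos ho d
  have hle := neg_le_of_abs_le (abs_le_cap_norm o d)
  set N := √(o ^ 2 - √3 * o * d + d ^ 2)
  have hδ : 0 < √3 * (d + (1 - κ) * o) :=
    mul_pos h3 (add_pos_of_nonneg_of_pos hd (mul_pos (by linarith) ho))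
  have hδ1 : d + (1 - κ) * o < 1 := by nlinarith
  clear_value z
  have eL : baryL z = -(√3 * (d + (1 - κ) * o) * o / N) / 3 := by
    simp only [baryL, hre]
    ring
  have eD : baryD z - baryL z = √3 * (d + (1 - κ) * o) * (√3 * d / N) / 3 := by
    simp only [baryL, baryD, hre, him]
    field_simp
    linear_combination (-N - √3 * (d + (1 - κ) * o) * o) * h33
  have eU : baryU z - baryL z = 1 + √3 * (d + (1 - κ) * o) * ((3 * o - √3 * d) / N) / 3 := by
    simp only [baryL, baryU, hre, him]
    field_simp
    linear_combination (N + √3 * (d + (1 - κ) * o) * o) * h33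
  refine ⟨?_, ?_, ?_, ?_⟩
  · rw [eL]
    have : 0 < √3 * (d + (1 - κ) * o) * o / N := by positivity
    linarith
  · have : 0 ≤ √3 * (d + (1 - κ) * o) * (√3 * d / N) / 3 := by positivity
    linarith
  -- The unit direction has ordinate at least `-1`, and the radius is less than `√3`, the distance
  -- of `U` and `D`. So the circle stays on the side of `U` of the ray `DO`.
  · have b1 : -√3 ≤ (3 * o - √3 * d) / N := by
      rw [le_div_iff₀ hN]
      have : √3 * (-N) ≤ √3 * (√3 / 2 * o - d) := mul_le_mul_of_nonneg_left hle h3.le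
      have e : √3 * (√3 / 2 * o - d) = 3 / 2 * o - √3 * d := by linear_combination o / 2 * h33
      linarith
    have b2 : √3 * (d + (1 - κ) * o) * (-√3) ≤
        √3 * (d + (1 - κ) * o) * ((3 * o - √3 * d) / N) := mul_le_mul_of_nonneg_left b1 hδ.le
    have b3 : √3 * (d + (1 - κ) * o) * (-√3) = -3 * (d + (1 - κ) * o) := by
      linear_combination -(d + (1 - κ) * o) * h33
    linarith
  · intro e
    have e2 : √3 * (d + (1 - κ) * o) * (√3 / N / 3) * d = 0 := by
      linear_combination -eD - e
    exact (mul_eq_zero.1 e2).resolve_left (by positivity)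

/-- The direction from `U` gives the ratio of `d` and `o`, and the radius gives `d + (1 - κ) o`. -/
theorem capCurve_inj {d' o' : ℝ} (h1 : κ < 1) (hd : 0 ≤ d) (ho : 0 < o) (hd' : 0 ≤ d')
    (ho' : 0 < o') (h : capCurve κ d o = capCurve κ d' o') : d = d' ∧ o = o' := by
  have h3 := sqrt_three_pos
  have e1 := norm_capCurve_sub h1 hd ho.le
  have e2 := norm_capCurve_sub h1 hd' ho'.le
  rw [h, e2] at e1
  have hδ : 0 < √3 * (d + (1 - κ) * o) :=
    mul_pos h3 (add_pos_of_nonneg_of_pos hd (mul_pos (by linarith) ho))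
  have hre := congrArg Complex.re h
  have him := congrArg Complex.im h
  simp only [capCurve, e1, add_right_inj] at hre him
  have hre := mul_left_cancel₀ hδ.ne' hre
  have him := mul_left_cancel₀ hδ.ne' him
  have e3 := mul_left_cancel₀ h3.ne' e1
  have hN := cap_norm_pos ho d
  have hN' := cap_norm_pos ho' d'
  rw [div_eq_div_iff hN.ne' hN'.ne'] at hre him
  set N := √(o ^ 2 - √3 * o * d + d ^ 2)
  set N' := √(o' ^ 2 - √3 * o' * d' + d' ^ 2)
  have f1 : o * N' = o' * N := by linarith
  have f2 : d * N' = d' * N := by linear_combination √3 / 2 * f1 - him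
  have f3 : (d + (1 - κ) * o) * N' = (d + (1 - κ) * o) * N := by
    linear_combination f2 + (1 - κ) * f1 + N * e3
  have f4 : N' = N :=
    mul_left_cancel₀ (add_pos_of_nonneg_of_pos hd (mul_pos (by linarith) ho)).ne' f3
  rw [f4] at f1 f2
  exact ⟨mul_right_cancel₀ hN.ne' f2, mul_right_cancel₀ hN.ne' f1⟩

theorem rayPoint_sector (h1 : κ < 1) (h0 : 0 < κ) (ho : 0 < o) (ho1 : o < 1) :
    let z := rayPoint κ o
    baryL z < 0 ∧ baryL z < baryD z ∧ baryL z < baryU z := by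
  intro z
  have h33 := sqrt_three_sq
  have hre : 1 / 2 < z.re := by
    change 1 / 2 < 1 / (2 * (1 - o))
    rw [div_lt_div_iff₀ (by norm_num) (by linarith)]
    linarith
  have him : √3 * z.im = 3 * (κ - 1 / 2) := by
    change √3 * (√3 * (κ - 1 / 2)) = _
    linear_combination (κ - 1 / 2) * h33
  simp only [baryL, baryU, baryD]
  refine ⟨by linarith, by linarith, by linarith⟩

end Cap

/-! ### Values on the common edges of the faces -/

theorem sideCurve_of_o_eq_zero {κ l u : ℝ} (h0 : 0 < κ) (h1 : κ < 1) (hl : 0 ≤ l) (hu : 0 ≤ u)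
    (hs : l + u = 1) : sideCurve κ (κ * u + 0) u = ⟨u / 2 - l, √3 / 2 * u⟩ := by
  have hl' : l = 1 - u := by linarith
  rw [add_zero]
  have e : abscissa κ (κ * u) u = u / 2 - l := by
    rcases (show u ≤ 1 by linarith).lt_or_eq with c | c
    · have hlt : κ * u < κ := by nlinarith
      rcases hu.lt_or_eq with c2 | c2
      · have hne : κ * u ≠ 0 := by positivity
        rw [abscissa, frac, exitX, if_pos hlt, if_pos hlt, div_self hne, mul_div_cancel_left₀ _ h0.ne']
        linarith
      · rw [abscissa, frac, exitX, if_pos hlt, if_pos hlt, ← c2, hl', ← c2]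
        norm_num
    · rw [c, mul_one, abscissa, frac, exitX, if_neg (lt_irrefl _), if_neg (lt_irrefl _), mul_one,
        div_self (by linarith), hl', c]
      norm_num
  rw [sideCurve, e]
  congr 1
  rw [graphHeight_middle (by positivity) (by linarith) (by linarith), hl']
  ring

theorem sideCurve_of_u_eq_zero {κ o : ℝ} (ho : 0 ≤ o) :
    sideCurve κ o 0 = ⟨-1 - √3 * o, 0⟩ := by
  have hf : frac κ o 0 = 0 := by
    unfold frac
    split_ifs <;> simp
  have e : abscissa κ o 0 = -1 - √3 * o := by
    rw [abscissa, hf]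
    ring
  have h3 : 0 ≤ √3 * o := by positivity
  rw [sideCurve, e]
  congr 1
  rw [graphHeight_left (by linarith)]
  apply Real.sqrt_eq_zero_of_nonpos
  have : 3 * o ^ 2 - (-1 - √3 * o + 1) ^ 2 = 0 := by linear_combination -o ^ 2 * sqrt_three_sq
  rw [this]

theorem sideCurve_eq_capCurve {κ u o : ℝ} (h0 : 0 < κ) (h1 : κ < 1) (hu : 0 < u) (ho : 0 < o)
    (hs : u + o = 1) : sideCurve κ (κ * u + o) u = capCurve κ 0 o := by
  have h3 := sqrt_three_pos
  have e : abscissa κ (κ * u + o) u = 1 / 2 + √3 / 2 * ((1 - κ) * o) := by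
    have hu' : u = 1 - o := by linarith
    have hpos : 0 ≤ (1 - κ) * o := mul_nonneg (by linarith) ho.le
    have hlt : ¬ κ * u + o < κ := by
      rw [hu']
      linarith
    have hd : 1 - (κ * u + o) = (1 - κ) * u := by rw [hu']; ring
    rw [abscissa, frac, exitX, if_neg hlt, if_neg hlt, hd,
      div_self (mul_pos (by linarith) hu).ne', hu']
    ring
  have hpos : 0 ≤ √3 * ((1 - κ) * o) := mul_nonneg h3.le (mul_nonneg (by linarith) ho.le)
  have ht : κ * u + o - κ = (1 - κ) * o := by linear_combination κ * hs
  rw [sideCurve, e, capCurve]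
  congr 1
  · norm_num
    rw [Real.sqrt_sq ho.le]
    field_simp
  · rw [graphHeight_right h0.le (by nlinarith [mul_nonneg (sub_nonneg.2 h1.le) ho.le])
      (by linarith), ht]
    norm_num
    rw [Real.sqrt_sq ho.le]
    have e1 : 3 * ((1 - κ) * o) ^ 2 - (√3 / 2 * ((1 - κ) * o)) ^ 2 = (3 / 2 * ((1 - κ) * o)) ^ 2 := by
      linear_combination -((1 - κ) * o) ^ 2 / 4 * sqrt_three_sq
    rw [e1, Real.sqrt_sq (by nlinarith [mul_nonneg (sub_nonneg.2 h1.le) ho.le])]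
    field_simp
    linear_combination -(1 - κ) * sqrt_three_sq

theorem capCurve_of_o_eq_zero {κ d : ℝ} (hd : 0 ≤ d) :
    capCurve κ d 0 = ⟨1 / 2, √3 / 2 - √3 * d⟩ := by
  rw [capCurve]
  congr 1
  · norm_num
  · norm_num
    rw [Real.sqrt_sq hd]
    rcases hd.lt_or_eq with c | c
    · field_simp
      ring
    · rw [← c]
      norm_num

/-! ### The drawing as a map on the surface of the tetrahedron -/

/-- The map of the surface of the tetrahedron to the sphere that maps the lines of slope `r / s`,
where `κ = s / (r + s)`, to drawn curves. -/
def drawPoint (κ : ℝ) (b : Weights) : ℂ :=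
  if b.o = 0 then affinePoint b
  else if b.d = 0 then sideCurve κ (κ * b.u + b.o) b.u
  else if b.u = 0 then conj (sideCurve (1 - κ) ((1 - κ) * b.d + b.o) b.d)
  else if κ * b.d < (1 - κ) * b.u then capCurve κ b.d b.o
  else if (1 - κ) * b.u < κ * b.d then conj (capCurve (1 - κ) b.u b.o)
  else rayPoint κ b.o

/-- The reflection of the tetrahedron that exchanges `U` and `D`. -/
def Weights.swap (b : Weights) : Weights := ⟨b.l, b.d, b.u⟩

theorem Weights.swap_swap (b : Weights) : b.swap.swap = b := rfl

theorem Weights.swap_o (b : Weights) : b.swap.o = b.o := by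
  simp only [Weights.o, Weights.swap]
  ring

theorem Weights.sum_eq (b : Weights) : b.l + b.u + b.d + b.o = 1 := by
  simp only [Weights.o]
  ring

theorem Weights.OnSurface.swap {b : Weights} (hb : b.OnSurface) : b.swap.OnSurface := by
  obtain ⟨h1, h2, h3, h4, h5⟩ := hb
  refine ⟨h1, h3, h2, by rwa [Weights.swap_o], ?_⟩
  rw [Weights.swap_o]
  simp only [Weights.swap]
  tauto

theorem affinePoint_swap (b : Weights) : affinePoint b.swap = conj (affinePoint b) := by
  apply Complex.ext
  · rw [Complex.conj_re]
    simp only [affinePoint, Weights.swap_o]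
    simp only [Weights.swap]
    ring
  · rw [Complex.conj_im]
    simp only [affinePoint, Weights.swap_o]
    simp only [Weights.swap]
    ring

section Faces

variable {κ : ℝ} {b b' : Weights}

/-- Complex conjugation exchanges `U` and `D`, and with them `κ` and `1 - κ`; this reduces later
statements to one of two mirror cases. -/
theorem drawPoint_swap (ho : 0 ≤ b.o) :
    drawPoint (1 - κ) b.swap = conj (drawPoint κ b) := by
  have hd : b.swap.d = b.u := rfl
  have hu : b.swap.u = b.d := rfl
  rw [drawPoint, drawPoint, Weights.swap_o, hd, hu, sub_sub_cancel]
  split_ifs with c1 c2 c3 c4 c5 c6 c7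
  · exact affinePoint_swap b
  · rw [c2, c3, mul_zero, mul_zero, zero_add, sideCurve_of_u_eq_zero ho,
      sideCurve_of_u_eq_zero ho]
    apply Complex.ext <;> simp
  · rw [Complex.conj_conj]
  · rfl
  · linarith
  · rw [Complex.conj_conj]
  · rfl
  · apply Complex.ext
    · rw [Complex.conj_re]
      rfl
    · rw [Complex.conj_im]
      simp only [rayPoint]
      ring

theorem drawPoint_of_o (h : b.o = 0) : drawPoint κ b = affinePoint b := by
  rw [drawPoint, if_pos h]

theorem affinePoint_of_o (h : b.o = 0) :
    affinePoint b = ⟨(b.u + b.d) / 2 - b.l, √3 / 2 * (b.u - b.d)⟩ := by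
  rw [affinePoint, h]
  norm_num

/-- The cases of `drawPoint` give precedence to earlier faces; agreement on the common edge makes
the formula valid on the whole closed face. -/
theorem drawPoint_of_d (h0 : 0 < κ) (h1 : κ < 1) (hb : b.OnSurface) (h : b.d = 0) :
    drawPoint κ b = sideCurve κ (κ * b.u + b.o) b.u := by
  by_cases ho : b.o = 0
  · rw [drawPoint_of_o ho, affinePoint_of_o ho, ho,
      sideCurve_of_o_eq_zero h0 h1 hb.l_nonneg hb.u_nonneg (by linarith [b.sum_eq]), h]
    norm_num
  · rw [drawPoint, if_neg ho, if_pos h]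

theorem drawPoint_of_lt (h0 : 0 < κ) (h1 : κ < 1) (hb : b.OnSurface) (h : b.l = 0)
    (hlt : κ * b.d < (1 - κ) * b.u) : drawPoint κ b = capCurve κ b.d b.o := by
  have hs := b.sum_eq
  have hd := hb.d_nonneg
  have hu : b.u ≠ 0 := by
    intro hu
    rw [hu, mul_zero] at hlt
    nlinarith
  by_cases ho : b.o = 0
  · rw [drawPoint_of_o ho, affinePoint_of_o ho, ho, capCurve_of_o_eq_zero hd, h,
      show b.u = 1 - b.d by linarith]
    congr 1 <;> ring
  · by_cases hd0 : b.d = 0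
    · rw [drawPoint_of_d h0 h1 hb hd0, hd0,
        sideCurve_eq_capCurve h0 h1 (hb.u_nonneg.lt_of_ne' hu) (hb.o_nonneg.lt_of_ne' ho)
          (by linarith)]
    · rw [drawPoint, if_neg ho, if_neg hd0, if_neg hu, if_pos hlt]

theorem drawPoint_of_gt (h0 : 0 < κ) (h1 : κ < 1) (hb : b.OnSurface) (h : b.l = 0)
    (hlt : (1 - κ) * b.u < κ * b.d) : drawPoint κ b = conj (capCurve (1 - κ) b.u b.o) := by
  have e := drawPoint_swap (κ := 1 - κ) (b := b.swap) hb.swap.o_nonneg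
  rw [sub_sub_cancel, Weights.swap_swap, drawPoint_of_lt (b := b.swap) (by linarith) (by linarith)
    hb.swap h (by rwa [sub_sub_cancel]), Weights.swap_o] at e
  exact e

theorem weights_of_eq (h : b.l = 0) (he : κ * b.d = (1 - κ) * b.u) :
    b.u = κ * (1 - b.o) ∧ b.d = (1 - κ) * (1 - b.o) := by
  have hs := b.sum_eq
  rw [h] at hs
  constructor
  · linear_combination κ * hs - he
  · linear_combination (1 - κ) * hs + he

theorem drawPoint_of_eq (h0 : 0 < κ) (h1 : κ < 1) (h : b.l = 0) (ho1 : b.o < 1)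
    (he : κ * b.d = (1 - κ) * b.u) : drawPoint κ b = rayPoint κ b.o := by
  obtain ⟨eu, ed⟩ := weights_of_eq h he
  by_cases ho : b.o = 0
  · rw [drawPoint_of_o ho, affinePoint_of_o ho, rayPoint, eu, ed, h, ho]
    congr 1 <;> ring
  · have hu : b.u ≠ 0 := by
      rw [eu]
      exact (mul_pos h0 (by linarith)).ne'
    have hd : b.d ≠ 0 := by
      rw [ed]
      exact (mul_pos (by linarith) (by linarith)).ne'
    rw [drawPoint, if_neg ho, if_neg hd, if_neg hu, if_neg (by linarith), if_neg (by linarith)]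

/-! ### Sectors -/

theorem drawPoint_sector_o (hb : b.OnSurface) (h : b.o = 0) :
    0 ≤ baryL (drawPoint κ b) ∧ 0 ≤ baryU (drawPoint κ b) ∧ 0 ≤ baryD (drawPoint κ b) := by
  have hs := b.sum_eq
  have h33 := sqrt_three_sq
  have e : √3 * (√3 / 2 * (b.u - b.d)) = 3 / 2 * (b.u - b.d) := by
    linear_combination (b.u - b.d) / 2 * h33
  rw [drawPoint_of_o h, affinePoint_of_o h]
  simp only [baryL, baryU, baryD, e]
  have := hb.l_nonneg
  have := hb.u_nonneg
  have := hb.d_nonneg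
  refine ⟨by linarith, by linarith, by linarith⟩

/-- The sector of this face is where `baryD` is negative and smallest. Ties occur on the rays
bounding the sector, and the last two clauses say that only edges of the face are mapped there. -/
theorem drawPoint_sector_d (h0 : 0 < κ) (h1 : κ < 1) (hb : b.OnSurface) (h : b.d = 0)
    (ho : 0 < b.o) (ho1 : b.o < 1) :
    let z := drawPoint κ b
    baryD z < 0 ∧ baryD z ≤ baryL z ∧ baryD z ≤ baryU z ∧ (baryL z = baryD z → b.l = 0) ∧
      (baryU z = baryD z → b.u = 0) := by
  have hs := b.sum_eq
  rw [drawPoint_of_d h0 h1 hb h]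
  exact sideCurve_sector h0 h1 hb.l_nonneg hb.u_nonneg ho (by linarith) (by linarith)

theorem baryL_conj (z : ℂ) : baryL (conj z) = baryL z := by
  simp [baryL]

theorem baryU_conj (z : ℂ) : baryU (conj z) = baryD z := by
  simp [baryU, baryD, sub_eq_add_neg]

theorem baryD_conj (z : ℂ) : baryD (conj z) = baryU z := by
  simp [baryU, baryD]

theorem drawPoint_eq_conj (hb : b.OnSurface) :
    drawPoint κ b = conj (drawPoint (1 - κ) b.swap) := by
  rw [drawPoint_swap hb.o_nonneg, Complex.conj_conj]

theorem drawPoint_sector_u (h0 : 0 < κ) (h1 : κ < 1) (hb : b.OnSurface) (h : b.u = 0)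
    (ho : 0 < b.o) (ho1 : b.o < 1) :
    let z := drawPoint κ b
    baryU z < 0 ∧ baryU z ≤ baryL z ∧ baryU z ≤ baryD z ∧ (baryL z = baryU z → b.l = 0) ∧
      (baryD z = baryU z → b.d = 0) := by
  have e := drawPoint_sector_d (κ := 1 - κ) (b := b.swap) (by linarith) (by linarith) hb.swap h
    (by rwa [Weights.swap_o]) (by rwa [Weights.swap_o])
  rw [drawPoint_eq_conj hb]
  simp only [baryL_conj, baryU_conj, baryD_conj]
  exact e

theorem drawPoint_sector_l (h0 : 0 < κ) (h1 : κ < 1) (hb : b.OnSurface) (h : b.l = 0)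
    (ho : 0 < b.o) (ho1 : b.o < 1) :
    let z := drawPoint κ b
    baryL z < 0 ∧ baryL z ≤ baryU z ∧ baryL z ≤ baryD z ∧ (baryU z = baryL z → b.u = 0) ∧
      (baryD z = baryL z → b.d = 0) := by
  have hs := b.sum_eq
  intro z
  rcases lt_trichotomy (κ * b.d) ((1 - κ) * b.u) with c | c | c
  · have e : z = capCurve κ b.d b.o := drawPoint_of_lt h0 h1 hb h c
    obtain ⟨a1, a2, a3, a4⟩ := capCurve_sector h1 h0 hb.d_nonneg ho (by linarith) c
    rw [e]
    exact ⟨a1, a3.le, a2, fun h => (a3.ne' h).elim, fun h => a4 h.symm⟩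
  · have e : z = rayPoint κ b.o := drawPoint_of_eq h0 h1 h ho1 c
    obtain ⟨a1, a2, a3⟩ := rayPoint_sector h1 h0 ho ho1
    rw [e]
    exact ⟨a1, a3.le, a2.le, fun h => (a3.ne' h).elim, fun h => (a2.ne' h).elim⟩
  · have e : z = conj (capCurve (1 - κ) b.u b.o) := drawPoint_of_gt h0 h1 hb h c
    obtain ⟨a1, a2, a3, a4⟩ := capCurve_sector (κ := 1 - κ) (d := b.u) (o := b.o) (u := b.d)
      (by linarith) (by linarith) hb.u_nonneg ho (by linarith) (by rwa [sub_sub_cancel])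
    rw [e, baryL_conj, baryU_conj, baryD_conj]
    exact ⟨a1, a2, a3.le, fun h => a4 h.symm, fun h => (a3.ne' h).elim⟩

/-! ### Injectivity -/

theorem Weights.ext_of_d {b b' : Weights} (h : b.d = b'.d) (hu : b.u = b'.u) (ho : b.o = b'.o) :
    b = b' := by
  have hs := b.sum_eq
  have hs' := b'.sum_eq
  exact Weights.ext (by linarith) hu h

theorem drawPoint_inj_d (h0 : 0 < κ) (h1 : κ < 1) (hb : b.OnSurface) (hb' : b'.OnSurface)
    (h : b.d = 0) (h' : b'.d = 0) (ho : 0 < b.o) (ho1 : b.o < 1) (ho' : 0 < b'.o) (ho1' : b'.o < 1)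
    (he : drawPoint κ b = drawPoint κ b') : b = b' := by
  have hs := b.sum_eq
  have hs' := b'.sum_eq
  rw [drawPoint_of_d h0 h1 hb h, drawPoint_of_d h0 h1 hb' h'] at he
  obtain ⟨e1, e2⟩ := sideCurve_inj h0 h1 hb.l_nonneg hb.u_nonneg ho (by linarith) (by linarith)
    hb'.l_nonneg hb'.u_nonneg ho' (by linarith) (by linarith) he
  exact Weights.ext_of_d (h.trans h'.symm) e1 e2

theorem drawPoint_swap_eq (hb : b.OnSurface) (hb' : b'.OnSurface)
    (he : drawPoint κ b = drawPoint κ b') :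
    drawPoint (1 - κ) b.swap = drawPoint (1 - κ) b'.swap := by
  rw [drawPoint_swap hb.o_nonneg, drawPoint_swap hb'.o_nonneg, he]

theorem drawPoint_inj_u (h0 : 0 < κ) (h1 : κ < 1) (hb : b.OnSurface) (hb' : b'.OnSurface)
    (h : b.u = 0) (h' : b'.u = 0) (ho : 0 < b.o) (ho1 : b.o < 1) (ho' : 0 < b'.o) (ho1' : b'.o < 1)
    (he : drawPoint κ b = drawPoint κ b') : b = b' := by
  have := drawPoint_inj_d (κ := 1 - κ) (by linarith) (by linarith) hb.swap hb'.swap h h'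
    (by rwa [Weights.swap_o]) (by rwa [Weights.swap_o]) (by rwa [Weights.swap_o])
    (by rwa [Weights.swap_o]) (drawPoint_swap_eq hb hb' he)
  rw [← b.swap_swap, ← b'.swap_swap, this]

/-- The height of the horizontal ray separates the semicircles about `U` from those about `D`. -/
theorem drawPoint_im_of_lt (h0 : 0 < κ) (h1 : κ < 1) (hb : b.OnSurface) (h : b.l = 0)
    (hlt : κ * b.d < (1 - κ) * b.u) : √3 * (κ - 1 / 2) < (drawPoint κ b).im := by
  rw [drawPoint_of_lt h0 h1 hb h hlt]
  exact capCurve_im_gt h1 hb.d_nonneg hb.o_nonneg (by linarith [b.sum_eq]) hlt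

theorem drawPoint_im_of_gt (h0 : 0 < κ) (h1 : κ < 1) (hb : b.OnSurface) (h : b.l = 0)
    (hlt : (1 - κ) * b.u < κ * b.d) : (drawPoint κ b).im < √3 * (κ - 1 / 2) := by
  have := drawPoint_im_of_lt (κ := 1 - κ) (b := b.swap) (by linarith) (by linarith) hb.swap h
    (by rwa [sub_sub_cancel])
  rw [drawPoint_eq_conj hb, Complex.conj_im]
  linarith

theorem drawPoint_im_of_eq (h0 : 0 < κ) (h1 : κ < 1) (h : b.l = 0)
    (ho1 : b.o < 1) (he : κ * b.d = (1 - κ) * b.u) : (drawPoint κ b).im = √3 * (κ - 1 / 2) := by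
  rw [drawPoint_of_eq h0 h1 h ho1 he]
  rfl

theorem drawPoint_inj_lt (h0 : 0 < κ) (h1 : κ < 1) (hb : b.OnSurface) (hb' : b'.OnSurface)
    (h : b.l = 0) (h' : b'.l = 0) (ho : 0 < b.o) (ho' : 0 < b'.o)
    (hlt : κ * b.d < (1 - κ) * b.u) (hlt' : κ * b'.d < (1 - κ) * b'.u)
    (he : drawPoint κ b = drawPoint κ b') : b = b' := by
  have hs := b.sum_eq
  have hs' := b'.sum_eq
  rw [drawPoint_of_lt h0 h1 hb h hlt, drawPoint_of_lt h0 h1 hb' h' hlt'] at he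
  obtain ⟨e1, e2⟩ := capCurve_inj h1 hb.d_nonneg ho hb'.d_nonneg ho' he
  exact Weights.ext_of_d e1 (by linarith) e2

theorem drawPoint_inj_l (h0 : 0 < κ) (h1 : κ < 1) (hb : b.OnSurface) (hb' : b'.OnSurface)
    (h : b.l = 0) (h' : b'.l = 0) (ho : 0 < b.o) (ho1 : b.o < 1) (ho' : 0 < b'.o) (ho1' : b'.o < 1)
    (he : drawPoint κ b = drawPoint κ b') : b = b' := by
  have hs := b.sum_eq
  have hs' := b'.sum_eq
  have him := congrArg Complex.im he
  rcases lt_trichotomy (κ * b.d) ((1 - κ) * b.u) with c | c | c <;>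
    rcases lt_trichotomy (κ * b'.d) ((1 - κ) * b'.u) with c' | c' | c'
  · exact drawPoint_inj_lt h0 h1 hb hb' h h' ho ho' c c' he
  · linarith [drawPoint_im_of_lt h0 h1 hb h c, drawPoint_im_of_eq h0 h1 h' ho1' c']
  · linarith [drawPoint_im_of_lt h0 h1 hb h c, drawPoint_im_of_gt h0 h1 hb' h' c']
  · linarith [drawPoint_im_of_eq h0 h1 h ho1 c, drawPoint_im_of_lt h0 h1 hb' h' c']
  · obtain ⟨eu, ed⟩ := weights_of_eq h c
    obtain ⟨eu', ed'⟩ := weights_of_eq h' c'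
    rw [drawPoint_of_eq h0 h1 h ho1 c, drawPoint_of_eq h0 h1 h' ho1' c'] at he
    have hre : 1 / (2 * (1 - b.o)) = 1 / (2 * (1 - b'.o)) := congrArg Complex.re he
    rw [div_eq_div_iff (by linarith) (by linarith)] at hre
    have ho : b.o = b'.o := by linarith
    exact Weights.ext_of_d (by rw [ed, ed', ho]) (by rw [eu, eu', ho]) ho
  · linarith [drawPoint_im_of_eq h0 h1 h ho1 c, drawPoint_im_of_gt h0 h1 hb' h' c']
  · linarith [drawPoint_im_of_gt h0 h1 hb h c, drawPoint_im_of_lt h0 h1 hb' h' c']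
  · linarith [drawPoint_im_of_gt h0 h1 hb h c, drawPoint_im_of_eq h0 h1 h' ho1' c']
  · have := drawPoint_inj_lt (κ := 1 - κ) (by linarith) (by linarith) hb.swap hb'.swap h h'
      (by rwa [Weights.swap_o]) (by rwa [Weights.swap_o]) (by rwa [sub_sub_cancel])
      (by rwa [sub_sub_cancel]) (drawPoint_swap_eq hb hb' he)
    rw [← b.swap_swap, ← b'.swap_swap, this]

theorem drawPoint_neg (h0 : 0 < κ) (h1 : κ < 1) (hb : b.OnSurface) (ho : 0 < b.o) (ho1 : b.o < 1) :
    baryL (drawPoint κ b) < 0 ∨ baryU (drawPoint κ b) < 0 ∨ baryD (drawPoint κ b) < 0 := by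
  rcases hb.face with h | h | h | h
  · linarith
  · exact Or.inl (drawPoint_sector_l h0 h1 hb h ho ho1).1
  · exact Or.inr (Or.inl (drawPoint_sector_u h0 h1 hb h ho ho1).1)
  · exact Or.inr (Or.inr (drawPoint_sector_d h0 h1 hb h ho ho1).1)

/-- The signs of the barycentric coordinates separate the triangle from the sectors. If points of
two different faces had the same image in the outer region, it would lie on the ray between the
sectors, and the clauses on ties bring both points to a common face. -/
theorem drawPoint_injOn (h0 : 0 < κ) (h1 : κ < 1) (hb : b.OnSurface) (hb' : b'.OnSurface)
    (ho1 : b.o < 1) (ho1' : b'.o < 1) (he : drawPoint κ b = drawPoint κ b') : b = b' := by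
  rcases hb.o_nonneg.eq_or_lt with ho | ho <;> rcases hb'.o_nonneg.eq_or_lt with ho' | ho'
  · apply toSphere_injOn hb hb'
    rw [toSphere, toSphere, if_neg ho1.ne, if_neg ho1'.ne, ← drawPoint_of_o ho.symm (κ := κ),
      ← drawPoint_of_o ho'.symm (κ := κ), he]
  · have e := drawPoint_neg h0 h1 hb' ho' ho1'
    obtain ⟨e1, e2, e3⟩ := drawPoint_sector_o (κ := κ) hb ho.symm
    rw [← he] at e
    rcases e with e | e | e <;> linarith
  · have e := drawPoint_neg h0 h1 hb ho ho1
    obtain ⟨e1, e2, e3⟩ := drawPoint_sector_o (κ := κ) hb' ho'.symm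
    rw [he] at e
    rcases e with e | e | e <;> linarith
  · have il := fun h h' => drawPoint_inj_l h0 h1 hb hb' h h' ho ho1 ho' ho1' he
    have iu := fun h h' => drawPoint_inj_u h0 h1 hb hb' h h' ho ho1 ho' ho1' he
    have id := fun h h' => drawPoint_inj_d h0 h1 hb hb' h h' ho ho1 ho' ho1' he
    have sl := fun h => drawPoint_sector_l h0 h1 hb h ho ho1
    have su := fun h => drawPoint_sector_u h0 h1 hb h ho ho1
    have sd := fun h => drawPoint_sector_d h0 h1 hb h ho ho1
    have sl' := fun h => drawPoint_sector_l h0 h1 hb' h ho' ho1'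
    have su' := fun h => drawPoint_sector_u h0 h1 hb' h ho' ho1'
    have sd' := fun h => drawPoint_sector_d h0 h1 hb' h ho' ho1'
    rw [← he] at sl' su' sd'
    rcases hb.face with h | h | h | h
    · linarith
    · rcases hb'.face with h' | h' | h' | h'
      · linarith
      · exact il h h'
      · obtain ⟨-, a, -, c, -⟩ := sl h
        obtain ⟨-, a', -, -, -⟩ := su' h'
        exact iu (c (le_antisymm a' a)) h'
      · obtain ⟨-, -, a, -, c⟩ := sl h
        obtain ⟨-, a', -, -, -⟩ := sd' h'
        exact id (c (le_antisymm a' a)) h'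
    · rcases hb'.face with h' | h' | h' | h'
      · linarith
      · obtain ⟨-, a, -, c, -⟩ := su h
        obtain ⟨-, a', -, -, -⟩ := sl' h'
        exact il (c (le_antisymm a' a)) h'
      · exact iu h h'
      · obtain ⟨-, -, a, -, c⟩ := su h
        obtain ⟨-, -, a', -, -⟩ := sd' h'
        exact id (c (le_antisymm a' a)) h'
    · rcases hb'.face with h' | h' | h' | h'
      · linarith
      · obtain ⟨-, a, -, c, -⟩ := sd h
        obtain ⟨-, -, a', -, -⟩ := sl' h'
        exact il (c (le_antisymm a' a)) h'
      · obtain ⟨-, -, a, -, c⟩ := sd h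
        obtain ⟨-, -, a', -, -⟩ := su' h'
        exact iu (c (le_antisymm a' a)) h'
      · exact id h h'

end Faces

/-! ### Levels -/

/-- The integers that are congruent to `c` modulo `2`. -/
def IsLevel (c : ℤ) (x : ℝ) : Prop := ∃ m : ℤ, Even (m + c) ∧ x = m

theorem IsLevel.reflect {c : ℤ} {x : ℝ} (h : IsLevel c x) (j : ℤ) : IsLevel c (2 * j - x) := by
  obtain ⟨m, hm, rfl⟩ := h
  refine ⟨2 * j - m, ?_, by push_cast; ring⟩
  obtain ⟨k, hk⟩ := hm
  exact ⟨j + c - k, by linear_combination -hk⟩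

theorem isLevel_congr {c : ℤ} {x y : ℝ} (h : ∃ j : ℤ, y = 2 * j - x) : IsLevel c x ↔ IsLevel c y := by
  obtain ⟨j, rfl⟩ := h
  refine ⟨fun h => h.reflect j, fun h => ?_⟩
  have := h.reflect j
  rwa [sub_sub_cancel] at this

theorem isLevel_neg {c : ℤ} {x : ℝ} : IsLevel c (-x) ↔ IsLevel c x :=
  isLevel_congr ⟨0, by push_cast; ring⟩

/-- The points of the tetrahedron that belong to a line of slope `r / s`, or to one of its parallels
of the same parity. -/
def HasLevel (r s : ℕ) (c : ℤ) (b : Weights) : Prop :=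
  IsLevel c (s * (unfold b).2 - r * (unfold b).1 + (r + s))

section Levels

variable {r s : ℕ} {c : ℤ} {b : Weights}

/-- The shift by `r + s` in `HasLevel` puts level `0` at `L`; then `U` has level `s`, `D` has level
`-r`, and `O`, approached in the face `d = 0`, has level `r + s`. -/
theorem hasLevel_of_o (h : b.o = 0) : HasLevel r s c b ↔ IsLevel c (s * b.u - r * b.d) := by
  have hs := b.sum_eq
  rw [HasLevel, unfold, if_pos h]
  have hl : b.l = 1 - b.u - b.d := by linarith
  rw [hl]
  ring_nf

theorem hasLevel_of_d (h : b.d = 0) :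
    HasLevel r s c b ↔ IsLevel c (s * b.u + (r + s) * b.o) := by
  have hs := b.sum_eq
  by_cases ho : b.o = 0
  · rw [hasLevel_of_o ho, h, ho]
    ring_nf
  · rw [HasLevel, unfold, if_neg ho, if_pos h]
    have hl : b.l = 1 - b.u - b.o := by linarith
    rw [hl]
    ring_nf

theorem hasLevel_of_u (h : b.u = 0) :
    HasLevel r s c b ↔ IsLevel c (r * b.d + (r + s) * b.o) := by
  have hs := b.sum_eq
  by_cases ho : b.o = 0
  · rw [hasLevel_of_o ho, h, ho, ← isLevel_neg]
    ring_nf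
  · by_cases hd : b.d = 0
    · rw [hasLevel_of_d hd, h, hd]
      ring_nf
    · rw [HasLevel, unfold, if_neg ho, if_neg hd, if_pos h, ← isLevel_neg]
      have hl : b.l = 1 - b.d - b.o := by linarith
      rw [hl]
      ring_nf

theorem hasLevel_of_l (h : b.l = 0) :
    HasLevel r s c b ↔ IsLevel c (s * b.u - r * b.d + (s - r) * b.o) := by
  have hs := b.sum_eq
  by_cases ho : b.o = 0
  · rw [hasLevel_of_o ho, ho]
    ring_nf
  · by_cases hd : b.d = 0
    · rw [hasLevel_of_d hd]
      -- On the edge `UO` the formulas of the two faces differ by a half turn about a lift of `U`,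
      -- which replaces a level `x` by `2 s - x`.
      apply isLevel_congr
      refine ⟨s, ?_⟩
      push_cast
      have hu : b.u = 1 - b.o := by linarith
      rw [hd, hu]
      ring
    · by_cases hu : b.u = 0
      · rw [hasLevel_of_u hu, ← isLevel_neg]
        apply isLevel_congr
        refine ⟨-r, ?_⟩
        push_cast
        have hd : b.d = 1 - b.o := by linarith
        rw [hu, hd]
        ring
      · rw [HasLevel, unfold, if_neg ho, if_neg hd, if_neg hu]
        have hl : b.u = 1 - b.d - b.o := by linarith
        rw [hl]
        ring_nf

theorem HasLevel.swap (hb : b.OnSurface) (h : HasLevel r s c b) : HasLevel s r c b.swap := by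
  have ho := b.swap_o
  rcases hb.face with hf | hf | hf | hf
  · rw [hasLevel_of_o hf, ← isLevel_neg] at h
    rw [hasLevel_of_o (ho.trans hf)]
    simpa [Weights.swap] using h
  · rw [hasLevel_of_l hf, ← isLevel_neg] at h
    rw [hasLevel_of_l (b := b.swap) hf, ho]
    convert h using 1
    simp only [Weights.swap]
    ring
  · rw [hasLevel_of_u hf] at h
    rw [hasLevel_of_d (b := b.swap) hf, ho]
    convert h using 1
    simp only [Weights.swap]
    ring
  · rw [hasLevel_of_d hf] at h
    rw [hasLevel_of_u (b := b.swap) hf, ho]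
    convert h using 1
    simp only [Weights.swap]
    ring

/-- A deck transformation adds an even integer to the level or reflects it in an integer, so the
choice of the lift does not matter. -/
theorem hasLevel_weights {w : ℝ × ℝ} (h : IsLevel c (s * w.2 - r * w.1 + (r + s))) :
    HasLevel r s c (weights w) := by
  have e := weights_unfold (weights_onSurface w)
  obtain ⟨j, k, e | e⟩ := weights_eq_iff.1 e.symm
  · rw [HasLevel, e]
    obtain ⟨m, hm, hx⟩ := h
    refine ⟨m + 2 * (s * k - r * j), ?_, ?_⟩
    · obtain ⟨i, hi⟩ := hm
      exact ⟨i + (s * k - r * j), by linear_combination hi⟩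
    · push_cast
      rw [← hx]
      ring
  · rw [HasLevel, e]
    refine (isLevel_congr ⟨s * k - r * j + r + s, ?_⟩).1 h
    push_cast
    ring

theorem hasLevel_segment {x : ℤ × ℤ} (hc : Even (idet (s, r) x + (r + s) + c)) (t : I) :
    HasLevel r s c (weights (segmentMap x (s, r) t)) := by
  apply hasLevel_weights
  refine ⟨idet (s, r) x + (r + s), hc, ?_⟩
  simp only [idet, segmentMap_apply, toPlane]
  push_cast
  simp
  ring

theorem exists_segment_of_hasLevel (hv : IsCoprime (s : ℤ) (r : ℤ)) {x : ℤ × ℤ}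
    (hc : Even (idet (s, r) x + (r + s) + c)) (hb : b.OnSurface) (h : HasLevel r s c b) :
    ∃ t : I, weights (segmentMap x (s, r) t) = b := by
  obtain ⟨m, hm, hw⟩ := h
  obtain ⟨u, hu⟩ := exists_idet_eq_one (v := ((s : ℤ), (r : ℤ))) hv
  have hev : Even (idet (s, r) x + (r + s) - m) := by
    have := hc.sub hm
    rwa [add_sub_add_right_eq_sub] at this
  obtain ⟨j, hj⟩ := hev
  set w := unfold b with hwdef
  have hdet : det (toPlane (s, r)) (w + (2 : ℝ) • toPlane (j • u) - toPlane x) = 0 := by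
    have h1 : det (toPlane (s, r)) (toPlane u) = 1 := by
      rw [det_toPlane, hu]
      norm_num
    have h2 : det (toPlane (s, r)) (toPlane x) = idet (s, r) x := det_toPlane _ _
    have h3 : det (toPlane (s, r)) w = s * w.2 - r * w.1 := by
      simp [det, toPlane]
    have h4 : (idet (s, r) x : ℝ) + (r + s) - m = j + j := by exact_mod_cast hj
    rw [det_sub_right, det_add_right, toPlane_smul, det_smul_right, det_smul_right, h1, h2, h3]
    linarith
  obtain ⟨t, ht⟩ : ∃ t : ℝ, w + (2 : ℝ) • toPlane (j • u) - toPlane x = t • toPlane (s, r) := by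
    set y := w + (2 : ℝ) • toPlane (j • u) - toPlane x
    have hd : (s : ℝ) * y.2 - r * y.1 = 0 := by simpa [det, toPlane] using hdet
    obtain ⟨a, a', ha⟩ := hv
    have ha' : (a : ℝ) * s + a' * r = 1 := by exact_mod_cast ha
    refine ⟨a * y.1 + a' * y.2, Prod.ext ?_ ?_⟩
    · simp only [toPlane, Prod.smul_fst, smul_eq_mul, Int.cast_natCast]
      linear_combination -y.1 * ha' - a' * hd
    · simp only [toPlane, Prod.smul_snd, smul_eq_mul, Int.cast_natCast]
      linear_combination -y.2 * ha' + a * hd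
  -- The line through `x` has been reached by a translation. Translation by `2 k v` brings the
  -- parameter into `[-1, 1]`, and the half turn about `x` removes its sign.
  set k := round (t / 2)
  have hk : |t - 2 * k| ≤ 1 := by
    have := abs_sub_round (t / 2)
    rw [abs_le] at this ⊢
    constructor <;> linarith [this.1, this.2]
  refine ⟨⟨|t - 2 * k|, abs_nonneg _, hk⟩, ?_⟩
  have hw : w = toPlane x + t • toPlane (s, r) - (2 : ℝ) • toPlane (j • u) := by
    rw [← ht]
    abel
  rw [← weights_unfold hb, ← hwdef]
  apply toSphere_injOn (weights_onSurface _) (weights_onSurface _)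
  change cover _ = cover _
  rw [cover_eq_iff', segmentMap_apply]
  rcases abs_cases (t - 2 * k) with ⟨e, -⟩ | ⟨e, -⟩
  · refine ⟨k • ((s : ℤ), (r : ℤ)) - j • u, Or.inl ?_⟩
    rw [hw]
    change _ = (2 : ℝ) • toPlane (k • ((s : ℤ), (r : ℤ)) - j • u) + (toPlane x + |t - 2 * k| • _)
    rw [e, toPlane_sub, toPlane_smul k, sub_smul, smul_sub, smul_smul]
    abel
  · refine ⟨k • ((s : ℤ), (r : ℤ)) - j • u + x, Or.inr ?_⟩
    rw [hw]
    change _ = (2 : ℝ) • toPlane (k • ((s : ℤ), (r : ℤ)) - j • u + x) -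
      (toPlane x + |t - 2 * k| • _)
    rw [e, toPlane_add, toPlane_sub, toPlane_smul k, neg_smul, sub_smul, smul_add, smul_sub,
      smul_smul, two_smul ℝ (toPlane x)]
    abel

end Levels

/-! ### Continuity of drawn curves -/

/-- The quotient `s / (r + s)`. -/
def ratio (r s : ℕ) : ℝ := s / (r + s)

section Ratio

variable {r s : ℕ}

theorem sum_pos_of_pos (hr : 0 < r) : (0 : ℝ) < r + s := by positivity

theorem ratio_mul (hr : 0 < r) : (r + s : ℝ) * ratio r s = s := by
  have := sum_pos_of_pos (s := s) hr
  rw [ratio]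
  field_simp

theorem ratio_pos (hr : 0 < r) (hs : 0 < s) : 0 < ratio r s := by
  rw [ratio]
  positivity

theorem one_sub_ratio (hr : 0 < r) : 1 - ratio r s = ratio s r := by
  have := sum_pos_of_pos (s := s) hr
  rw [ratio, ratio, add_comm (s : ℝ)]
  field_simp
  ring

theorem ratio_lt_one (hr : 0 < r) (hs : 0 < s) : ratio r s < 1 := by
  have := one_sub_ratio (s := s) hr
  have := ratio_pos hs hr
  linarith

end Ratio

/-- A continuous function with integral values is locally constant. This is what makes drawn curves
continuous, although `drawPoint` jumps where semicircles give way to the ray: a family of fixed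
slope and parity stays locally on one piece. -/
theorem eventually_eq_of_isLevel {X : Type*} [TopologicalSpace X] {f : X → ℝ} {c : ℤ} {x₀ : X}
    {P : X → Prop} (hf : ContinuousAt f x₀) (h0 : P x₀) (h : ∀ x, P x → IsLevel c (f x)) :
    ∀ᶠ x in 𝓝 x₀, P x → f x = f x₀ := by
  have h1 : ∀ᶠ x in 𝓝 x₀, |f x - f x₀| < 1 :=
    (hf.sub continuousAt_const).abs.eventually_lt continuousAt_const (by simp)
  filter_upwards [h1] with x hx hP
  obtain ⟨m, -, hm⟩ := h x hP
  obtain ⟨k, -, hk⟩ := h x₀ h0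
  rw [hm, hk] at hx ⊢
  have : |m - k| < 1 := by exact_mod_cast hx
  rw [Int.abs_lt_one_iff] at this
  rw [sub_eq_zero.1 this]

/-- A path, or another family of points, on the surface of the tetrahedron that stays on the lines
of slope `r / s` and of given parity. -/
structure LevelFamily {X : Type*} [TopologicalSpace X] (r s : ℕ) (c : ℤ) (b : X → Weights) :
    Prop where
  continuous_l : Continuous fun x => (b x).l
  continuous_u : Continuous fun x => (b x).u
  continuous_d : Continuous fun x => (b x).d
  onSurface : ∀ x, (b x).OnSurface
  hasLevel : ∀ x, HasLevel r s c (b x)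

namespace LevelFamily

variable {X : Type*} [TopologicalSpace X] {r s : ℕ} {c : ℤ} {b : X → Weights} {x₀ : X}

theorem continuous_o (hb : LevelFamily r s c b) : Continuous fun x => (b x).o := by
  have := hb.continuous_l
  have := hb.continuous_u
  have := hb.continuous_d
  unfold Weights.o
  fun_prop

theorem swap (hb : LevelFamily r s c b) : LevelFamily s r c fun x => (b x).swap :=
  ⟨hb.continuous_l, hb.continuous_d, hb.continuous_u, fun x => (hb.onSurface x).swap,
    fun x => (hb.hasLevel x).swap (hb.onSurface x)⟩

theorem continuousWithinAt_d (hb : LevelFamily r s c b) (hr : 0 < r) (hs : 0 < s)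
    (h0 : (b x₀).d = 0) :
    ContinuousWithinAt (fun x => drawPoint (ratio r s) (b x)) {x | (b x).d = 0} x₀ := by
  have hn := sum_pos_of_pos (s := s) hr
  have hu := hb.continuous_u
  have ho := hb.continuous_o
  have ev := eventually_eq_of_isLevel (f := fun x => s * (b x).u + (r + s) * (b x).o) (x₀ := x₀)
    (P := fun x => (b x).d = 0) (c := c) (by fun_prop) h0
    fun x hx => (hasLevel_of_d hx).1 (hb.hasLevel x)
  set t := ratio r s * (b x₀).u + (b x₀).o with ht
  have hc : ContinuousWithinAt (fun x => sideCurve (ratio r s) t (b x).u) {x | (b x).d = 0} x₀ :=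
    ((continuous_sideCurve _ t).comp hu).continuousWithinAt
  have he : ∀ᶠ x in 𝓝 x₀, (b x).d = 0 →
      drawPoint (ratio r s) (b x) = sideCurve (ratio r s) t (b x).u := by
    filter_upwards [ev] with x hx hd
    rw [drawPoint_of_d (ratio_pos hr hs) (ratio_lt_one hr hs) (hb.onSurface x) hd]
    congr 1
    have := hx hd
    apply mul_left_cancel₀ hn.ne'
    rw [ht]
    linear_combination this + ((b x).u - (b x₀).u) * ratio_mul (s := s) hr
  refine hc.congr_of_eventuallyEq ?_ (he.self_of_nhds h0)
  exact eventually_nhdsWithin_iff.2 he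

theorem continuousWithinAt_conj (hb : LevelFamily r s c b) (hr : 0 < r) {S : Set X}
    (h : ContinuousWithinAt (fun x => drawPoint (ratio s r) (b x).swap) S x₀) :
    ContinuousWithinAt (fun x => drawPoint (ratio r s) (b x)) S x₀ := by
  have e : (fun x => drawPoint (ratio r s) (b x)) =
      fun x => conj (drawPoint (ratio s r) (b x).swap) := by
    funext x
    rw [drawPoint_eq_conj (hb.onSurface x), one_sub_ratio hr]
  rw [e]
  exact Complex.continuous_conj.continuousAt.comp_continuousWithinAt h

theorem continuousWithinAt_o (hb : LevelFamily r s c b) :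
    ContinuousWithinAt (fun x => drawPoint (ratio r s) (b x)) {x | (b x).o = 0} x₀ := by
  by_cases h0 : (b x₀).o = 0
  · have hl := hb.continuous_l
    have hu := hb.continuous_u
    have hd := hb.continuous_d
    have hc : Continuous fun x => ((((b x).u + (b x).d) / 2 - (b x).l : ℝ) : ℂ) +
        ((√3 / 2 * ((b x).u - (b x).d) : ℝ) : ℂ) * Complex.I := by fun_prop
    have he : ∀ x, (b x).o = 0 → drawPoint (ratio r s) (b x) =
        ((((b x).u + (b x).d) / 2 - (b x).l : ℝ) : ℂ) +
        ((√3 / 2 * ((b x).u - (b x).d) : ℝ) : ℂ) * Complex.I := by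
      intro x hx
      rw [drawPoint_of_o hx, affinePoint_of_o hx]
      apply Complex.ext <;> simp [-Complex.ofReal_div]
    exact (hc.continuousWithinAt).congr he (he x₀ h0)
  · have ho := hb.continuous_o
    refine continuousWithinAt_of_notMem_closure ?_
    rw [(isClosed_eq ho continuous_const).closure_eq]
    exact h0

/-- At `U`, where `d = o = 0`, the direction is undefined but the radius tends to `0`. -/
theorem continuousAt_capCurve {κ : ℝ} (h1 : κ < 1) {d o : X → ℝ} (hd : Continuous d)
    (ho : Continuous o) (hd0 : ∀ x, 0 ≤ d x) (ho0 : ∀ x, 0 ≤ o x) :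
    ContinuousAt (fun x => capCurve κ (d x) (o x)) x₀ := by
  by_cases h : √(o x₀ ^ 2 - √3 * o x₀ * d x₀ + d x₀ ^ 2) = 0
  · have h2 : (o x₀ / 2) ^ 2 + (√3 / 2 * o x₀ - d x₀) ^ 2 = 0 := by
      rw [← cap_norm_sq, ← sq_cap_norm, h]
      norm_num
    have e1 : o x₀ = 0 := by nlinarith [sq_nonneg (o x₀), sq_nonneg (√3 / 2 * o x₀ - d x₀)]
    have e2 : d x₀ = 0 := by
      rw [e1] at h2
      simpa using h2
    have e3 : capCurve κ (d x₀) (o x₀) = U := by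
      rw [e1, e2, capCurve_of_o_eq_zero le_rfl, U]
      norm_num
    rw [ContinuousAt, e3, tendsto_iff_norm_sub_tendsto_zero]
    have e4 : (fun x => ‖capCurve κ (d x) (o x) - U‖) =
        fun x => √3 * (d x + (1 - κ) * o x) := by
      funext x
      exact norm_capCurve_sub h1 (hd0 x) (ho0 x)
    rw [e4]
    have hc : Continuous fun x => √3 * (d x + (1 - κ) * o x) := by fun_prop
    have := hc.tendsto x₀
    rw [e1, e2] at this
    simpa using this
  · have e : (fun x => capCurve κ (d x) (o x)) = fun x =>
        ((1 / 2 + √3 * (d x + (1 - κ) * o x) *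
          ((o x / 2) / √(o x ^ 2 - √3 * o x * d x + d x ^ 2)) : ℝ) : ℂ) +
        ((√3 / 2 + √3 * (d x + (1 - κ) * o x) *
          ((√3 / 2 * o x - d x) / √(o x ^ 2 - √3 * o x * d x + d x ^ 2)) : ℝ) : ℂ) *
            Complex.I := by
      funext x
      apply Complex.ext <;> simp [capCurve, -Complex.ofReal_div]
    rw [e]
    have hd' := hd.continuousAt (x := x₀)
    have ho' := ho.continuousAt (x := x₀)
    have hN : ContinuousAt (fun x => √(o x ^ 2 - √3 * o x * d x + d x ^ 2)) x₀ := by fun_prop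
    refine ContinuousAt.add ?_ (ContinuousAt.mul ?_ continuousAt_const)
    · refine Complex.continuous_ofReal.continuousAt.comp ?_
      have := ContinuousAt.div (f := fun x => o x / 2) (by fun_prop) hN h
      fun_prop
    · refine Complex.continuous_ofReal.continuousAt.comp ?_
      have := ContinuousAt.div (f := fun x => √3 / 2 * o x - d x) (by fun_prop) hN h
      fun_prop

theorem continuousWithinAt_lt (hb : LevelFamily r s c b) (hr : 0 < r) (hs : 0 < s)
    (h0 : (b x₀).l = 0) (h : ratio r s * (b x₀).d < (1 - ratio r s) * (b x₀).u) :
    ContinuousWithinAt (fun x => drawPoint (ratio r s) (b x)) {x | (b x).l = 0} x₀ := by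
  have hu := hb.continuous_u
  have hd := hb.continuous_d
  have ev : ∀ᶠ x in 𝓝 x₀, ratio r s * (b x).d < (1 - ratio r s) * (b x).u :=
    (continuous_const.mul hd).continuousAt.eventually_lt (continuous_const.mul hu).continuousAt h
  have he : ∀ᶠ x in 𝓝 x₀, (b x).l = 0 →
      drawPoint (ratio r s) (b x) = capCurve (ratio r s) (b x).d (b x).o := by
    filter_upwards [ev] with x hx hl
    exact drawPoint_of_lt (ratio_pos hr hs) (ratio_lt_one hr hs) (hb.onSurface x) hl hx
  have hc := (continuousAt_capCurve (ratio_lt_one hr hs) hd hb.continuous_o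
    (fun x => (hb.onSurface x).d_nonneg) (fun x => (hb.onSurface x).o_nonneg)
    (x₀ := x₀)).continuousWithinAt (s := {x | (b x).l = 0})
  exact hc.congr_of_eventuallyEq (eventually_nhdsWithin_iff.2 he) (he.self_of_nhds h0)

/-- On the face `l = 0` the ray is the line of level `s - r`, and the level is locally constant. -/
theorem eventually_ray_l (hb : LevelFamily r s c b) (hr : 0 < r) (h0 : (b x₀).l = 0)
    (h : ratio r s * (b x₀).d = (1 - ratio r s) * (b x₀).u) :
    ∀ᶠ x in 𝓝 x₀, (b x).l = 0 → ratio r s * (b x).d = (1 - ratio r s) * (b x).u := by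
  have hn := sum_pos_of_pos (s := s) hr
  have hu := hb.continuous_u
  have hd := hb.continuous_d
  have ho := hb.continuous_o
  have ev := eventually_eq_of_isLevel (f := fun x => s * (b x).u - r * (b x).d + (s - r) * (b x).o)
    (x₀ := x₀) (P := fun x => (b x).l = 0) (c := c) (by fun_prop) h0
    fun x hx => (hasLevel_of_l hx).1 (hb.hasLevel x)
  filter_upwards [ev] with x hx hl
  have e1 := hx hl
  have s1 := (b x).sum_eq
  have s2 := (b x₀).sum_eq
  have m1 := ratio_mul (s := s) hr
  have e2 : s * (b x₀).d = r * (b x₀).u := by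
    linear_combination (r + s) * h - ((b x₀).d + (b x₀).u) * m1
  have e3 : s * (b x).d = r * (b x).u := by
    linear_combination e2 - e1 + (s - r) * (s1 - s2 - hl + h0)
  apply mul_left_cancel₀ hn.ne'
  linear_combination e3 + ((b x).d + (b x).u) * m1

theorem continuousWithinAt_l (hb : LevelFamily r s c b) (hr : 0 < r) (hs : 0 < s)
    (ho1 : (b x₀).o < 1) (h0 : (b x₀).l = 0) :
    ContinuousWithinAt (fun x => drawPoint (ratio r s) (b x)) {x | (b x).l = 0} x₀ := by
  rcases lt_trichotomy (ratio r s * (b x₀).d) ((1 - ratio r s) * (b x₀).u) with h | h | h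
  · exact hb.continuousWithinAt_lt hr hs h0 h
  · have ho := hb.continuous_o
    have ev1 : ∀ᶠ x in 𝓝 x₀, (b x).o < 1 :=
      ho.continuousAt.eventually_lt continuousAt_const ho1
    have he : ∀ᶠ x in 𝓝 x₀, (b x).l = 0 →
        drawPoint (ratio r s) (b x) = rayPoint (ratio r s) (b x).o := by
      filter_upwards [hb.eventually_ray_l hr h0 h, ev1] with x hx hx1 hl
      exact drawPoint_of_eq (ratio_pos hr hs) (ratio_lt_one hr hs) hl hx1 (hx hl)
    have hc : ContinuousAt (fun x => rayPoint (ratio r s) (b x).o) x₀ := by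
      have e : (fun x => rayPoint (ratio r s) (b x).o) = fun x =>
          ((1 / (2 * (1 - (b x).o)) : ℝ) : ℂ) + ((√3 * (ratio r s - 1 / 2) : ℝ) : ℂ) *
            Complex.I := by
        funext x
        rw [rayPoint]
        generalize 1 / (2 * (1 - (b x).o)) = y
        apply Complex.ext <;> simp
      rw [e]
      refine ContinuousAt.add ?_ continuousAt_const
      refine Complex.continuous_ofReal.continuousAt.comp ?_
      exact ContinuousAt.div continuousAt_const
        (continuous_const.mul (continuous_const.sub ho)).continuousAt (by linarith)
    exact hc.continuousWithinAt.congr_of_eventuallyEq (eventually_nhdsWithin_iff.2 he)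
      (he.self_of_nhds h0)
  · apply hb.continuousWithinAt_conj hr
    refine hb.swap.continuousWithinAt_lt hs hr h0 ?_
    rw [one_sub_ratio hs, ← one_sub_ratio (s := s) hr]
    exact h

/-- The preimages of the four faces form a finite closed cover, so continuity within each of them is
enough. -/
theorem continuousAt_drawPoint (hb : LevelFamily r s c b) (hr : 0 < r) (hs : 0 < s)
    (ho1 : (b x₀).o < 1) : ContinuousAt (fun x => drawPoint (ratio r s) (b x)) x₀ := by
  have hl := hb.continuous_l
  have hu := hb.continuous_u
  have hd := hb.continuous_d
  have out : ∀ {f : X → ℝ}, Continuous f → f x₀ ≠ 0 →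
      ContinuousWithinAt (fun x => drawPoint (ratio r s) (b x)) {x | f x = 0} x₀ := by
    intro f hf h
    refine continuousWithinAt_of_notMem_closure ?_
    rw [(isClosed_eq hf continuous_const).closure_eq]
    exact h
  have c1 : ContinuousWithinAt (fun x => drawPoint (ratio r s) (b x)) {x | (b x).l = 0} x₀ := by
    by_cases h : (b x₀).l = 0
    · exact hb.continuousWithinAt_l hr hs ho1 h
    · exact out hl h
  have c2 : ContinuousWithinAt (fun x => drawPoint (ratio r s) (b x)) {x | (b x).u = 0} x₀ := by
    by_cases h : (b x₀).u = 0
    · exact hb.continuousWithinAt_conj hr (hb.swap.continuousWithinAt_d hs hr h)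
    · exact out hu h
  have c3 : ContinuousWithinAt (fun x => drawPoint (ratio r s) (b x)) {x | (b x).d = 0} x₀ := by
    by_cases h : (b x₀).d = 0
    · exact hb.continuousWithinAt_d hr hs h
    · exact out hd h
  have c4 := hb.continuousWithinAt_o (x₀ := x₀)
  rw [← continuousWithinAt_univ]
  refine (c4.union (c1.union (c2.union c3))).mono fun x _ => ?_
  exact (hb.onSurface x).face

/-- On the faces `u = 0` and `d = 0` the level `r + s` of `O` is a maximum attained at `O` only.
Hence a family can reach `O` only along the ray in the face `l = 0`. -/
theorem eventually_ray (hb : LevelFamily r s c b) (hr : 0 < r) (hs : 0 < s) (h1 : (b x₀).o = 1) :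
    ∀ᶠ x in 𝓝 x₀, (b x).o = 1 ∨
      ((b x).l = 0 ∧ ratio r s * (b x).d = (1 - ratio r s) * (b x).u) := by
  have hn := sum_pos_of_pos (s := s) hr
  have hs0 : (0 : ℝ) < s := by positivity
  have hr0 : (0 : ℝ) < r := by positivity
  have hu := hb.continuous_u
  have hd := hb.continuous_d
  have ho := hb.continuous_o
  have s0 := (b x₀).sum_eq
  have l0 := (hb.onSurface x₀).l_nonneg
  have u0 := (hb.onSurface x₀).u_nonneg
  have d0 := (hb.onSurface x₀).d_nonneg
  have zl : (b x₀).l = 0 := by linarith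
  have zu : (b x₀).u = 0 := by linarith
  have zd : (b x₀).d = 0 := by linarith
  have ev0 : ∀ᶠ x in 𝓝 x₀, (b x).o ≠ 0 := ho.continuousAt.eventually_ne (by rw [h1]; exact one_ne_zero)
  have ev1 := hb.eventually_ray_l hr zl (by rw [zu, zd, mul_zero, mul_zero])
  have ev2 := eventually_eq_of_isLevel (f := fun x => s * (b x).u + (r + s) * (b x).o) (x₀ := x₀)
    (P := fun x => (b x).d = 0) (c := c) (by fun_prop) zd
    fun x hx => (hasLevel_of_d hx).1 (hb.hasLevel x)
  have ev3 := eventually_eq_of_isLevel (f := fun x => r * (b x).d + (r + s) * (b x).o) (x₀ := x₀)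
    (P := fun x => (b x).u = 0) (c := c) (by fun_prop) zu
    fun x hx => (hasLevel_of_u hx).1 (hb.hasLevel x)
  filter_upwards [ev0, ev1, ev2, ev3] with x x0 x1 x2 x3
  have s1 := (b x).sum_eq
  have hl := (hb.onSurface x).l_nonneg
  have hu := (hb.onSurface x).u_nonneg
  have hd := (hb.onSurface x).d_nonneg
  rcases (hb.onSurface x).face with h | h | h | h
  · exact absurd h x0
  · exact Or.inr ⟨h, x1 h⟩
  · left
    have e := x3 h
    simp only [zd, h1] at e
    have p1 : 0 ≤ s * (b x).d := by positivity
    have e2 : (r + s) * (b x).l + s * (b x).d = 0 := by linear_combination (r + s) * (s1 - h) - e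
    have p2 : 0 ≤ (r + s) * (b x).l := by positivity
    have q1 : (b x).l = 0 := by
      have : (r + s) * (b x).l = 0 := by linarith
      exact (mul_eq_zero.1 this).resolve_left hn.ne'
    have q2 : (b x).d = 0 := by
      have : s * (b x).d = 0 := by linarith
      exact (mul_eq_zero.1 this).resolve_left hs0.ne'
    linarith
  · left
    have e := x2 h
    simp only [zu, h1] at e
    have p1 : 0 ≤ r * (b x).u := by positivity
    have e2 : (r + s) * (b x).l + r * (b x).u = 0 := by linear_combination (r + s) * (s1 - h) - e
    have p2 : 0 ≤ (r + s) * (b x).l := by positivity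
    have q1 : (b x).l = 0 := by
      have : (r + s) * (b x).l = 0 := by linarith
      exact (mul_eq_zero.1 this).resolve_left hn.ne'
    have q2 : (b x).u = 0 := by
      have : r * (b x).u = 0 := by linarith
      exact (mul_eq_zero.1 this).resolve_left hr0.ne'
    linarith

end LevelFamily

/-! ### The homotopy between straight curves and drawn curves -/

/-- The point that divides the segment between the images of a point of the tetrahedron on a straight
and on a drawn curve. -/
def blendPoint (κ τ : ℝ) (b : Weights) : ℂ :=
  ((1 - τ : ℝ) : ℂ) * affinePoint b + (τ : ℂ) * drawPoint κ b

/-- The homotopy between straight curves and drawn curves. -/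
def blend (κ τ : ℝ) (b : Weights) : Sphere :=
  if b.o = 1 then OnePoint.infty else (blendPoint κ τ b : Sphere)

theorem blend_zero (κ : ℝ) (b : Weights) : blend κ 0 b = toSphere b := by
  simp [blend, blendPoint, toSphere]

theorem continuousAt_affinePoint {X : Type*} [TopologicalSpace X] {b : X → Weights} {x₀ : X}
    (hu : Continuous fun x => (b x).u) (hd : Continuous fun x => (b x).d)
    (hl : Continuous fun x => (b x).l) (ho : Continuous fun x => (b x).o) (h : (b x₀).o < 1) :
    ContinuousAt (fun x => affinePoint (b x)) x₀ := by
  have h2 : (1 - (b x₀).o) ^ 2 ≠ 0 := pow_ne_zero 2 (by linarith)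
  have e : (fun x => affinePoint (b x)) = fun x =>
      ((((b x).u + (b x).d) / 2 - (b x).l : ℝ) / ((1 - (b x).o) ^ 2 : ℝ) : ℂ) +
      ((√3 / 2 * ((b x).u - (b x).d) : ℝ) / ((1 - (b x).o) ^ 2 : ℝ) : ℂ) * Complex.I := by
    funext x
    rw [← Complex.ofReal_div, ← Complex.ofReal_div, affinePoint]
    generalize (((b x).u + (b x).d) / 2 - (b x).l) / (1 - (b x).o) ^ 2 = y
    generalize √3 / 2 * ((b x).u - (b x).d) / (1 - (b x).o) ^ 2 = y'
    apply Complex.ext <;> simp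
  rw [e]
  have h3 : (((1 - (b x₀).o) ^ 2 : ℝ) : ℂ) ≠ 0 := by exact_mod_cast h2
  have cd : Continuous fun x => (((1 - (b x).o) ^ 2 : ℝ) : ℂ) := by fun_prop
  refine ContinuousAt.add ?_ (ContinuousAt.mul ?_ continuousAt_const)
  · exact ContinuousAt.div (Continuous.continuousAt (by fun_prop)) cd.continuousAt h3
  · exact ContinuousAt.div (Continuous.continuousAt (by fun_prop)) cd.continuousAt h3

theorem LevelFamily.comp {X Y : Type*} [TopologicalSpace X] [TopologicalSpace Y] {r s : ℕ} {c : ℤ}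
    {b : X → Weights} (hb : LevelFamily r s c b) {f : Y → X} (hf : Continuous f) :
    LevelFamily r s c fun y => b (f y) :=
  ⟨hb.continuous_l.comp hf, hb.continuous_u.comp hf, hb.continuous_d.comp hf,
    fun _ => hb.onSurface _, fun _ => hb.hasLevel _⟩

theorem LevelFamily.continuous_blend {X : Type*} [TopologicalSpace X] {r s : ℕ} {c : ℤ}
    {b : X → Weights} (hb : LevelFamily r s c b) (hr : 0 < r) (hs : 0 < s) {τ : X → ℝ}
    (hτ : Continuous τ) : Continuous fun x => blend (ratio r s) (τ x) (b x) := by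
  rw [continuous_iff_continuousAt]
  intro x₀
  have ho := hb.continuous_o
  by_cases h : (b x₀).o = 1
  · have h0 : blend (ratio r s) (τ x₀) (b x₀) = OnePoint.infty := if_pos h
    rw [ContinuousAt, h0]
    refine tendsto_infty_of_bound (g := fun x => blendPoint (ratio r s) (τ x) (b x))
      (c := fun x => 1 - (b x).o) (k := 1 / 2) (by norm_num)
      (continuous_const.sub ho).continuousAt (by simp [h]) ?_
    filter_upwards [hb.eventually_ray hr hs h] with x hx
    by_cases h1 : (b x).o = 1
    · exact Or.inl (if_pos h1)
    · right
      obtain ⟨hl, he⟩ := hx.resolve_left h1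
      refine ⟨if_neg h1, ?_⟩
      have hlt : (b x).o < 1 := lt_of_le_of_ne (hb.onSurface x).o_le_one h1
      have hpos : 0 < 1 - (b x).o := by linarith
      have hsum := (b x).sum_eq
      -- On the ray, straight and drawn points have the same abscissa, so the interpolation cannot
      -- prevent escape to `O`.
      have hre : (blendPoint (ratio r s) (τ x) (b x)).re = 1 / (2 * (1 - (b x).o)) := by
        have e1 : (affinePoint (b x)).re = 1 / (2 * (1 - (b x).o)) := by
          rw [affinePoint, hl, show (b x).u + (b x).d = 1 - (b x).o by linarith]
          field_simp
          ring
        have e2 : (drawPoint (ratio r s) (b x)).re = 1 / (2 * (1 - (b x).o)) := by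
          rw [drawPoint_of_eq (ratio_pos hr hs) (ratio_lt_one hr hs) hl hlt he]
          rfl
        rw [blendPoint, Complex.add_re, Complex.re_ofReal_mul, Complex.re_ofReal_mul, e1, e2]
        ring
      have hle := Complex.abs_re_le_norm (blendPoint (ratio r s) (τ x) (b x))
      rw [hre, abs_of_pos (by positivity)] at hle
      rw [abs_of_pos hpos]
      calc (1 : ℝ) / 2 = 1 / (2 * (1 - (b x).o)) * (1 - (b x).o) := by field_simp
        _ ≤ _ := mul_le_mul_of_nonneg_right hle hpos.le
  · have hlt : (b x₀).o < 1 := lt_of_le_of_ne (hb.onSurface x₀).o_le_one h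
    have hne : ∀ᶠ x in 𝓝 x₀, (b x).o ≠ 1 := ho.continuousAt.eventually_ne h
    have h1 := hb.continuousAt_drawPoint hr hs hlt
    have h2 := continuousAt_affinePoint hb.continuous_u hb.continuous_d hb.continuous_l ho hlt
    have h3 : ContinuousAt (fun x => blendPoint (ratio r s) (τ x) (b x)) x₀ := by
      unfold blendPoint
      refine ContinuousAt.add (ContinuousAt.mul (Continuous.continuousAt (by fun_prop)) h2)
        (ContinuousAt.mul (Continuous.continuousAt (by fun_prop)) h1)
    refine (OnePoint.continuous_coe.continuousAt.comp h3).congr ?_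
    filter_upwards [hne] with x hx
    exact (if_neg hx).symm

theorem affinePoint_neg {b : Weights} (ho : 0 < b.o) (ho1 : b.o < 1) :
    (b.l = 0 → baryL (affinePoint b) < 0) ∧ (b.u = 0 → baryU (affinePoint b) < 0) ∧
      (b.d = 0 → baryD (affinePoint b) < 0) := by
  have hs := b.sum_eq
  have h33 := sqrt_three_sq
  have hp : 0 < 1 - b.o := by linarith
  have key : ∀ w : ℝ, w = 0 → (1 + (3 * w - (1 - b.o)) / (1 - b.o) ^ 2) / 3 < 0 := by
    intro w hw
    have e : (1 + (3 * w - (1 - b.o)) / (1 - b.o) ^ 2) / 3 = -(b.o / (1 - b.o)) / 3 := by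
      rw [hw]
      field_simp
      ring
    rw [e]
    have : 0 < b.o / (1 - b.o) := by positivity
    linarith
  refine ⟨fun h => ?_, fun h => ?_, fun h => ?_⟩
  · convert key b.l h using 1
    simp only [baryL, affinePoint]
    rw [show (b.u + b.d) / 2 - b.l = (1 - b.o) / 2 - 3 / 2 * b.l by linarith]
    ring
  · convert key b.u h using 1
    simp only [baryU, affinePoint]
    rw [← hs]
    ring_nf
    rw [Real.sq_sqrt (by norm_num)]
    ring
  · convert key b.d h using 1
    simp only [baryD, affinePoint]
    rw [← hs]
    ring_nf
    rw [Real.sq_sqrt (by norm_num)]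
    ring

theorem bary_vertices_nonneg {z : ℂ} (h : z = L ∨ z = U ∨ z = D) :
    0 ≤ baryL z ∧ 0 ≤ baryU z ∧ 0 ≤ baryD z := by
  have h33 := sqrt_three_sq
  have e : √3 * (√3 / 2) = 3 / 2 := by linear_combination h33 / 2
  rcases h with rfl | rfl | rfl
  · norm_num [baryL, baryU, baryD, L]
  · simp only [baryL, baryU, baryD, U, e]
    norm_num
  · simp only [baryL, baryU, baryD, D, mul_neg, e]
    norm_num

theorem coe_mem_marked {z : ℂ} : (z : Sphere) ∈ marked ↔ z = L ∨ z = U ∨ z = D := by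
  simp [marked]

theorem Weights.IsVertex.o_eq {b : Weights} (h : b.IsVertex) : b.o = 0 ∨ b.o = 1 := by
  rcases h with rfl | rfl | rfl | rfl <;> norm_num [Weights.o]

/-- On the triangle the interpolation is constant. On another face the straight and the drawn point
have the same negative barycentric coordinate, and so has every convex combination; the punctures
`L`, `U`, `D` have none. -/
theorem blend_mem_marked {κ τ : ℝ} (h0 : 0 < κ) (h1 : κ < 1) (ht : 0 ≤ τ) (ht1 : τ ≤ 1)
    {b : Weights} (hb : b.OnSurface) : blend κ τ b ∈ marked ↔ b.IsVertex := by
  have hs := b.sum_eq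
  by_cases ho1 : b.o = 1
  · have := toSphere_mem_marked hb
    rw [toSphere, if_pos ho1] at this
    rw [blend, if_pos ho1]
    exact this
  · rcases hb.o_nonneg.eq_or_lt with ho | ho
    · have e : blend κ τ b = toSphere b := by
        rw [blend, toSphere, if_neg ho1, if_neg ho1, blendPoint, drawPoint_of_o ho.symm]
        push_cast
        ring_nf
      rw [e]
      exact toSphere_mem_marked hb
    · have hlt : b.o < 1 := lt_of_le_of_ne hb.o_le_one ho1
      refine iff_of_false ?_ fun h => ?_
      · rw [blend, if_neg ho1, coe_mem_marked]
        intro h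
        obtain ⟨c1, c2, c3⟩ := bary_vertices_nonneg h
        obtain ⟨a1, a2, a3⟩ := affinePoint_neg ho hlt
        have comb : ∀ x y : ℝ, x < 0 → y < 0 → (1 - τ) * x + τ * y < 0 := by
          intro x y hx hy
          rcases ht.eq_or_lt with h | h
          · rw [← h]
            linarith
          · have e1 : (1 - τ) * x ≤ 0 := mul_nonpos_of_nonneg_of_nonpos (by linarith) hx.le
            have e2 : τ * y < 0 := mul_neg_of_pos_of_neg h hy
            linarith
        have eL : baryL (blendPoint κ τ b) =
            (1 - τ) * baryL (affinePoint b) + τ * baryL (drawPoint κ b) := by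
          simp only [baryL, blendPoint, Complex.add_re, Complex.re_ofReal_mul]
          ring
        have eU : baryU (blendPoint κ τ b) =
            (1 - τ) * baryU (affinePoint b) + τ * baryU (drawPoint κ b) := by
          simp only [baryU, blendPoint, Complex.add_re, Complex.re_ofReal_mul, Complex.add_im,
            Complex.im_ofReal_mul]
          ring
        have eD : baryD (blendPoint κ τ b) =
            (1 - τ) * baryD (affinePoint b) + τ * baryD (drawPoint κ b) := by
          simp only [baryD, blendPoint, Complex.add_re, Complex.re_ofReal_mul, Complex.add_im,
            Complex.im_ofReal_mul]
          ring
        rcases hb.face with hf | hf | hf | hf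
        · linarith
        · linarith [comb _ _ (a1 hf) (drawPoint_sector_l h0 h1 hb hf ho hlt).1]
        · linarith [comb _ _ (a2 hf) (drawPoint_sector_u h0 h1 hb hf ho hlt).1]
        · linarith [comb _ _ (a3 hf) (drawPoint_sector_d h0 h1 hb hf ho hlt).1]
      · rcases h.o_eq with e | e <;> linarith

theorem blend_one_injOn {κ : ℝ} (h0 : 0 < κ) (h1 : κ < 1) {b b' : Weights} (hb : b.OnSurface)
    (hb' : b'.OnSurface) (h : blend κ 1 b = blend κ 1 b') : b = b' := by
  have e : ∀ b : Weights, blendPoint κ 1 b = drawPoint κ b := fun b => by simp [blendPoint]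
  rw [blend, blend, e, e] at h
  split_ifs at h with c c' c'
  · apply toSphere_injOn hb hb'
    rw [toSphere, toSphere, if_pos c, if_pos c']
  · exact absurd h.symm (OnePoint.coe_ne_infty _)
  · exact absurd h (OnePoint.coe_ne_infty _)
  · exact drawPoint_injOn h0 h1 hb hb' (lt_of_le_of_ne hb.o_le_one c)
      (lt_of_le_of_ne hb'.o_le_one c') (OnePoint.coe_injective h)

section DrawnArc

variable {r s : ℕ} {x : ℤ × ℤ}

theorem levelFamily_segment (r s : ℕ) (x : ℤ × ℤ) :
    LevelFamily r s (idet (s, r) x + (r + s)) fun t : I => weights (segmentMap x (s, r) t) := by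
  obtain ⟨cl, cu, cd, -⟩ := continuous_weights
  have hc := (segmentMap x (s, r)).continuous
  exact ⟨cl.comp hc, cu.comp hc, cd.comp hc, fun t => weights_onSurface _,
    fun t => hasLevel_segment ⟨_, rfl⟩ t⟩

/-- The drawn curve of slope `r / s`. -/
def drawnArc (hr : 0 < r) (hs : 0 < s) (hv : IsCoprime (s : ℤ) (r : ℤ)) (x : ℤ × ℤ) : ArcCurve where
  toMap := ⟨fun t => blend (ratio r s) 1 (weights (segmentMap x (s, r) t)),
    (levelFamily_segment r s x).continuous_blend hr hs continuous_const⟩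
  isMarked t := by
    rw [ContinuousMap.coe_mk, blend_mem_marked (ratio_pos hr hs) (ratio_lt_one hr hs) zero_le_one
      le_rfl (weights_onSurface _), weights_isVertex]
    exact isLattice_segmentMap x hv t
  simple t t' h := Or.inl (cover_segmentMap_injective x hv (congrArg toSphere
    (blend_one_injOn (ratio_pos hr hs) (ratio_lt_one hr hs) (weights_onSurface _)
      (weights_onSurface _) h)))
  not_contractible := by
    refine not_isContractible (fun t => ?_) fun h => ?_
    · rw [ContinuousMap.coe_mk, blend_mem_marked (ratio_pos hr hs) (ratio_lt_one hr hs) zero_le_one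
        le_rfl (weights_onSurface _), weights_isVertex]
      exact isLattice_segmentMap x hv t
    · exact zero_ne_one (cover_segmentMap_injective x hv (congrArg toSphere
        (blend_one_injOn (ratio_pos hr hs) (ratio_lt_one hr hs) (weights_onSurface _)
          (weights_onSurface _) h)))

theorem drawnArc_toArc (hr : 0 < r) (hs : 0 < s) (hv : IsCoprime (s : ℤ) (r : ℤ)) (x : ℤ × ℤ) :
    (drawnArc hr hs hv x).toArc = (segmentArc x (s, r) hv).toArc := by
  apply Quotient.sound
  left
  refine ContinuousMap.HomotopicWith.symm ⟨⟨⟨⟨fun p : I × I =>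
    blend (ratio r s) p.1 (weights (segmentMap x (s, r) p.2)), ?_⟩, ?_, ?_⟩, ?_⟩⟩
  · exact ((levelFamily_segment r s x).comp continuous_snd).continuous_blend hr hs
      (continuous_subtype_val.comp continuous_fst)
  · intro t
    exact blend_zero _ _
  · intro t
    rfl
  · intro τ t
    change blend (ratio r s) τ (weights (segmentMap x (s, r) t)) ∈ marked ↔ _
    rw [blend_mem_marked (ratio_pos hr hs) (ratio_lt_one hr hs) τ.2.1 τ.2.2 (weights_onSurface _),
      weights_isVertex]
    exact isLattice_segmentMap x hv t

/-- The points of a drawn curve. -/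
theorem mem_trace_drawnArc (hr : 0 < r) (hs : 0 < s) (hv : IsCoprime (s : ℤ) (r : ℤ)) (x : ℤ × ℤ)
    {z : Sphere} : z ∈ (drawnArc hr hs hv x).trace ↔
      ∃ b : Weights, b.OnSurface ∧ HasLevel r s (idet (s, r) x + (r + s)) b ∧
        blend (ratio r s) 1 b = z := by
  constructor
  · rintro ⟨t, rfl⟩
    exact ⟨_, weights_onSurface _, (levelFamily_segment r s x).hasLevel t, rfl⟩
  · rintro ⟨b, hb, hl, rfl⟩
    obtain ⟨t, rfl⟩ := exists_segment_of_hasLevel hv ⟨_, rfl⟩ hb hl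
    exact ⟨t, rfl⟩

end DrawnArc

/-! ### The points of the drawn curves in the plane -/

/-- The point lies on one of the semicircles, segments, or on the ray of the drawing. -/
def OnDrawing (r s : ℕ) (c : ℤ) (z : ℂ) : Prop :=
  (z.re ≤ -1 ∧ ∃ k : ℤ, Even (k + c) ∧ 0 < k ∧ k < r + s ∧ ‖z - L‖ = k * halfStep r s) ∨
  (-1 ≤ z.re ∧ z.re ≤ 1 / 2 ∧ ∃ k : ℤ, Even (k + c) ∧ |k| < r + s ∧
    z.im = k * halfStep r s + (1 - 2 * ratio r s) * √3 / 3 * (z.re + 1)) ∨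
  (1 / 2 ≤ z.re ∧ ∃ k : ℤ, Even (k + c) ∧ s < k ∧ k < r + s ∧ ‖z - U‖ = (k - s) * halfStep r s) ∨
  (1 / 2 ≤ z.re ∧ ∃ k : ℤ, Even (k + c) ∧ r < k ∧ k < r + s ∧ ‖z - D‖ = (k - r) * halfStep r s) ∨
  (1 / 2 ≤ z.re ∧ Even ((s : ℤ) - r + c) ∧ z.im = √3 * (ratio r s - 1 / 2))

section Planar

variable {r s : ℕ} {c : ℤ} {z : ℂ} {b : Weights}

theorem halfStep_comm (r s : ℕ) : halfStep r s = halfStep s r := by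
  rw [halfStep, halfStep, add_comm]

theorem mul_halfStep (hr : 0 < r) (t : ℝ) : (r + s) * t * halfStep r s = √3 * t := by
  have := sum_pos_of_pos (s := s) hr
  rw [halfStep]
  field_simp

theorem conj_L : conj L = L := by
  apply Complex.ext <;> simp [L]

theorem conj_U : conj U = D := by
  apply Complex.ext <;> simp [U, D]

theorem conj_D : conj D = U := by
  apply Complex.ext <;> simp [U, D]

theorem norm_conj_sub (z w : ℂ) : ‖conj z - w‖ = ‖z - conj w‖ := by
  rw [← Complex.norm_conj, map_sub, Complex.conj_conj]

theorem OnDrawing.conj (hr : 0 < r) (h : OnDrawing r s c z) : OnDrawing s r c (conj z) := by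
  have hh := one_sub_ratio (s := s) hr
  rcases h with ⟨h1, k, h2, h3, h4, h5⟩ | ⟨h1, h1', k, h2, h3, h4⟩ | ⟨h1, k, h2, h3, h4, h5⟩ |
    ⟨h1, k, h2, h3, h4, h5⟩ | ⟨h1, h2, h3⟩
  · refine Or.inl ⟨h1, k, h2, h3, by lia, ?_⟩
    rw [norm_conj_sub, conj_L, halfStep_comm, h5]
  · refine Or.inr (Or.inl ⟨h1, h1', -k, ?_, ?_, ?_⟩)
    · obtain ⟨i, hi⟩ := h2
      exact ⟨i - k, by linear_combination hi⟩
    · rw [abs_neg]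
      lia
    · rw [Complex.conj_im, Complex.conj_re, h4, halfStep_comm, ← hh]
      push_cast
      ring
  · refine Or.inr (Or.inr (Or.inr (Or.inl ⟨h1, k, h2, h3, by lia, ?_⟩)))
    rw [norm_conj_sub, conj_D, halfStep_comm, h5]
  · refine Or.inr (Or.inr (Or.inl ⟨h1, k, h2, h3, by lia, ?_⟩))
    rw [norm_conj_sub, conj_U, halfStep_comm, h5]
  · refine Or.inr (Or.inr (Or.inr (Or.inr ⟨h1, ?_, ?_⟩)))
    · obtain ⟨i, hi⟩ := h2
      exact ⟨i + r - s, by linear_combination hi⟩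
    · rw [Complex.conj_im, h3, ← hh]
      ring

theorem norm_eq_of_sq {w : ℂ} {t : ℝ} (ht : 0 ≤ t) (h : w.re ^ 2 + w.im ^ 2 = t ^ 2) : ‖w‖ = t := by
  rw [← Real.sqrt_sq ht, ← Real.sqrt_sq (norm_nonneg w), Complex.sq_norm, Complex.normSq_apply]
  congr 1
  linarith

theorem norm_sq_eq (w : ℂ) : ‖w‖ ^ 2 = w.re ^ 2 + w.im ^ 2 := by
  rw [Complex.sq_norm, Complex.normSq_apply]
  ring

/-- The points of the drawing on the face that is opposite to `O`. -/
theorem onDrawing_of_o (hr : 0 < r) (hs : 0 < s) (hb : b.OnSurface) (hl : HasLevel r s c b)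
    (h : b.o = 0) : OnDrawing r s c (drawPoint (ratio r s) b) := by
  have hsum := b.sum_eq
  have l0 := hb.l_nonneg
  have u0 := hb.u_nonneg
  have d0 := hb.d_nonneg
  have hn := sum_pos_of_pos (s := s) hr
  have hr' : (0 : ℝ) < r := by positivity
  have hs' : (0 : ℝ) < s := by positivity
  obtain ⟨k, hk, e⟩ := (hasLevel_of_o h).1 hl
  rw [drawPoint_of_o h, affinePoint_of_o h]
  refine Or.inr (Or.inl ⟨?_, ?_, k, hk, ?_, ?_⟩)
  · change -1 ≤ (b.u + b.d) / 2 - b.l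
    linarith
  · change (b.u + b.d) / 2 - b.l ≤ 1 / 2
    linarith
  · have a1 : (k : ℝ) < r + s := by nlinarith
    have a2 : -(r + s : ℝ) < k := by nlinarith
    rw [abs_lt]
    exact ⟨by exact_mod_cast a2, by exact_mod_cast a1⟩
  · change √3 / 2 * (b.u - b.d) = k * halfStep r s +
      (1 - 2 * ratio r s) * √3 / 3 * ((b.u + b.d) / 2 - b.l + 1)
    have e2 : (k : ℝ) = (r + s) * (ratio r s * b.u - (1 - ratio r s) * b.d) := by
      linear_combination -e - (b.u + b.d) * ratio_mul (s := s) hr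
    rw [e2, mul_halfStep hr]
    linear_combination √3 / 3 * (1 - 2 * ratio r s) * (hsum - h)

/-- The integral level is `k = (r + s) t`, so a radius `√3 t` is `k` half steps; the three ranges of
the abscissa give the three types of pieces. -/
theorem onDrawing_of_d (hr : 0 < r) (hs : 0 < s) (hb : b.OnSurface) (hl : HasLevel r s c b)
    (ho : 0 < b.o) (ho1 : b.o < 1) (h : b.d = 0) :
    OnDrawing r s c (drawPoint (ratio r s) b) := by
  have hsum := b.sum_eq
  have l0 := hb.l_nonneg
  have u0 := hb.u_nonneg
  have hn := sum_pos_of_pos (s := s) hr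
  have hr' : (0 : ℝ) < r := by positivity
  have hs' : (0 : ℝ) < s := by positivity
  have h3 := sqrt_three_pos
  have h33 := sqrt_three_sq
  have c0 := ratio_pos hr hs
  have c1 := ratio_lt_one hr hs
  obtain ⟨k, hk, e⟩ := (hasLevel_of_d h).1 hl
  have k0 : 0 < k := by
    have : (0 : ℝ) < k := by
      rw [← e]
      positivity
    exact_mod_cast this
  have k1 : k < r + s := by
    have : (k : ℝ) < r + s := by
      rw [← e]
      rcases l0.eq_or_lt with hl0 | hl0
      · have : 0 < b.u := by linarith
        nlinarith [mul_pos hr' this]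
      · nlinarith [mul_pos hn hl0, mul_nonneg hr'.le u0]
    exact_mod_cast this
  rw [drawPoint_of_d c0 c1 hb h]
  obtain ⟨a1, a2, -, -, -⟩ := abscissa_mem c0 c1 l0 u0 ho (by linarith) (by linarith)
  have ht : (k : ℝ) = (r + s) * (ratio r s * b.u + b.o) := by
    linear_combination -e - b.u * ratio_mul (s := s) hr
  have tpos : 0 < ratio r s * b.u + b.o := by positivity
  set t := ratio r s * b.u + b.o
  set x := abscissa (ratio r s) t b.u with hx
  have hz : sideCurve (ratio r s) t b.u = ⟨x, graphHeight (ratio r s) t x⟩ := rfl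
  rw [hz]
  rcases le_or_gt x (-1) with cx | cx
  · refine Or.inl ⟨cx, k, hk, k0, k1, ?_⟩
    rw [ht, mul_halfStep hr, graphHeight_left cx]
    apply norm_eq_of_sq (by positivity)
    have hrad : 0 ≤ 3 * t ^ 2 - (x + 1) ^ 2 := by
      have e : 3 * t ^ 2 - (x + 1) ^ 2 = (√3 * t - (x + 1)) * (√3 * t + (x + 1)) := by
        linear_combination -t ^ 2 * h33
      rw [e]
      have : 0 < √3 * t := by positivity
      exact mul_nonneg (by linarith) (by linarith)
    simp only [Complex.sub_re, Complex.sub_im, L]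
    norm_num
    rw [Real.sq_sqrt hrad]
    linear_combination -t ^ 2 * h33
  · rcases le_or_gt x (1 / 2) with cx' | cx'
    · refine Or.inr (Or.inl ⟨cx.le, cx', k, hk, ?_, ?_⟩)
      · rwa [abs_of_pos k0]
      · change graphHeight _ _ _ = _
        rw [graphHeight_middle tpos.le cx.le cx', ht, mul_halfStep hr]
    · have hlt : ratio r s ≤ t := by
        by_contra hlt
        linarith [exitX_le_half c0 (not_le.1 hlt)]
      have hle := exitX_sub_le hlt
      have hlt' : ratio r s < t := by
        have : 0 < √3 * (t - ratio r s) := by linarith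
        have := pos_of_mul_pos_right this h3.le
        linarith
      have e2 : (k : ℝ) - s = (r + s) * (t - ratio r s) := by
        linear_combination ht + ratio_mul (s := s) hr
      refine Or.inr (Or.inr (Or.inl ⟨cx'.le, k, hk, ?_, k1, ?_⟩))
      · have : (0 : ℝ) < k - s := by
          rw [e2]
          exact mul_pos hn (by linarith)
        have : (s : ℝ) < k := by linarith
        exact_mod_cast this
      · rw [e2, mul_halfStep hr, graphHeight_right c0.le hlt cx'.le]
        apply norm_eq_of_sq (mul_nonneg h3.le (by linarith))
        have hrad : 0 ≤ 3 * (t - ratio r s) ^ 2 - (x - 1 / 2) ^ 2 := by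
          have : (x - 1 / 2) ^ 2 ≤ (√3 * (t - ratio r s)) ^ 2 :=
            pow_le_pow_left₀ (by linarith) (by linarith) 2
          rw [mul_pow, Real.sq_sqrt (by norm_num)] at this
          linarith
        simp only [Complex.sub_re, Complex.sub_im, U, add_sub_cancel_left]
        rw [Real.sq_sqrt hrad]
        linear_combination -(t - ratio r s) ^ 2 * h33

theorem onDrawing_of_lt (hr : 0 < r) (hs : 0 < s) (hb : b.OnSurface) (hl : HasLevel r s c b)
    (ho : 0 < b.o) (h : b.l = 0) (hlt : ratio r s * b.d < (1 - ratio r s) * b.u) :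
    OnDrawing r s c (drawPoint (ratio r s) b) := by
  have hsum := b.sum_eq
  have d0 := hb.d_nonneg
  have hn := sum_pos_of_pos (s := s) hr
  have hr' : (0 : ℝ) < r := by positivity
  have c1 := ratio_lt_one hr hs
  have hm := ratio_mul (s := s) hr
  obtain ⟨k, hk, e⟩ := (hasLevel_of_l h).1 ((hasLevel_of_l h).2 (((hasLevel_of_l h).1 hl)))
  have e1 : 2 * (s : ℝ) - k - s = (r + s) * b.d + r * b.o := by
    linear_combination e + s * (h - hsum)
  rw [drawPoint_of_lt (ratio_pos hr hs) c1 hb h hlt]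
  have hnorm := norm_capCurve_sub c1 d0 ho.le
  -- Semicircles about `U` are indexed by levels of the face `d = 0`; the half turn about a lift of
  -- `U` converts `k` to `2 s - k`.
  refine Or.inr (Or.inr (Or.inl ⟨?_, 2 * s - k, ?_, ?_, ?_, ?_⟩))
  · have hN := cap_norm_pos ho b.d
    have hc : 0 ≤ b.d + (1 - ratio r s) * b.o :=
      add_nonneg d0 (mul_nonneg (by linarith) ho.le)
    change 1 / 2 ≤ 1 / 2 + _
    have : 0 ≤ √3 * (b.d + (1 - ratio r s) * b.o) *
        ((b.o / 2) / √(b.o ^ 2 - √3 * b.o * b.d + b.d ^ 2)) := by positivity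
    linarith
  · obtain ⟨i, hi⟩ := hk
    exact ⟨s - k + i, by linear_combination hi⟩
  · have : (0 : ℝ) < 2 * s - k - s := by
      rw [e1]
      positivity
    have : (s : ℝ) < 2 * s - k := by linarith
    exact_mod_cast this
  · have e2 : (r + s) * (ratio r s * b.d) < (r + s) * ((1 - ratio r s) * b.u) :=
      mul_lt_mul_of_pos_left hlt hn
    have e4 : (r + s) * (ratio r s * b.d) = s * b.d := by linear_combination b.d * hm
    have e5 : (r + s) * ((1 - ratio r s) * b.u) = r * b.u := by linear_combination -b.u * hm
    have e3 : (s : ℝ) * b.d < r * b.u := by linarith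
    have : 2 * (s : ℝ) - k < r + s := by
      have : b.u = 1 - b.d - b.o := by linarith
      rw [this] at e3
      linarith
    exact_mod_cast this
  · rw [hnorm, ← mul_halfStep hr]
    congr 1
    push_cast
    linear_combination -e1 - b.o * hm

theorem onDrawing_of_eq (hr : 0 < r) (hs : 0 < s) (hl : HasLevel r s c b)
    (ho : 0 < b.o) (ho1 : b.o < 1) (h : b.l = 0)
    (he : ratio r s * b.d = (1 - ratio r s) * b.u) :
    OnDrawing r s c (drawPoint (ratio r s) b) := by
  have hsum := b.sum_eq
  have hm := ratio_mul (s := s) hr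
  obtain ⟨k, hk, e⟩ := (hasLevel_of_l h).1 hl
  rw [drawPoint_of_eq (ratio_pos hr hs) (ratio_lt_one hr hs) h ho1 he]
  refine Or.inr (Or.inr (Or.inr (Or.inr ⟨?_, ?_, rfl⟩)))
  · change 1 / 2 ≤ 1 / (2 * (1 - b.o))
    rw [div_le_div_iff₀ (by norm_num) (by linarith)]
    linarith
  · obtain ⟨eu, ed⟩ := weights_of_eq h he
    have : (k : ℝ) = s - r := by
      rw [← e, eu, ed]
      linear_combination (1 - b.o) * hm
    have : k = s - r := by exact_mod_cast this
    rwa [← this]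

theorem onDrawing_drawPoint (hr : 0 < r) (hs : 0 < s) (hb : b.OnSurface) (hl : HasLevel r s c b)
    (ho1 : b.o < 1) : OnDrawing r s c (drawPoint (ratio r s) b) := by
  rcases hb.o_nonneg.eq_or_lt with ho | ho
  · exact onDrawing_of_o hr hs hb hl ho.symm
  have mirror : OnDrawing s r c (drawPoint (ratio s r) b.swap) →
      OnDrawing r s c (drawPoint (ratio r s) b) := by
    intro h
    rw [drawPoint_eq_conj hb, one_sub_ratio hr]
    exact h.conj hs
  have hb' := hb.swap
  have hl' := hl.swap hb
  have ho' : 0 < b.swap.o := by rwa [b.swap_o]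
  have ho1' : b.swap.o < 1 := by rwa [b.swap_o]
  rcases hb.face with h | h | h | h
  · linarith
  · rcases lt_trichotomy (ratio r s * b.d) ((1 - ratio r s) * b.u) with h' | h' | h'
    · exact onDrawing_of_lt hr hs hb hl ho h h'
    · exact onDrawing_of_eq hr hs hl ho ho1 h h'
    · refine mirror (onDrawing_of_lt hs hr hb' hl' ho' h ?_)
      rw [one_sub_ratio hs, ← one_sub_ratio (s := s) hr]
      exact h'
  · exact mirror (onDrawing_of_d hs hr hb' hl' ho' ho1' h)
  · exact onDrawing_of_d hr hs hb hl ho ho1 h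

/-! ### Every point of the drawing lies on the drawn curve -/

/-- The abscissa gives the value `y` of `frac`, and `u` is `y` times its maximum on the level, `t /
κ` or `(1 - t) / (1 - κ)`. -/
theorem exists_weights_of_abscissa {κ t x : ℝ} (h0 : 0 < κ) (h1 : κ < 1) (ht : 0 < t) (ht1 : t < 1)
    (hx : -1 - √3 * t ≤ x) (hx1 : x ≤ exitX κ t) :
    ∃ b : Weights, b.OnSurface ∧ b.o < 1 ∧ b.d = 0 ∧ κ * b.u + b.o = t ∧ abscissa κ t b.u = x := by
  have hE := exitX_pos h0 ht
  obtain ⟨y, y0, y1, hy⟩ : ∃ y : ℝ, 0 ≤ y ∧ y ≤ 1 ∧ -1 - √3 * t + y * (exitX κ t + 1 + √3 * t) = x := by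
    refine ⟨(x + 1 + √3 * t) / (exitX κ t + 1 + √3 * t), div_nonneg (by linarith) hE.le, ?_, ?_⟩
    · rw [div_le_one hE]
      linarith
    · rw [div_mul_cancel₀ _ hE.ne']
      ring
  have build : ∀ u : ℝ, 0 ≤ u → 0 ≤ t - κ * u → t - κ * u < 1 → 0 ≤ 1 - u - (t - κ * u) →
      frac κ t u = y → ∃ b : Weights, b.OnSurface ∧ b.o < 1 ∧ b.d = 0 ∧ κ * b.u + b.o = t ∧
        abscissa κ t b.u = x := by
    intro u hu ho ho1 hl hf
    have eo : (⟨1 - u - (t - κ * u), u, 0⟩ : Weights).o = t - κ * u := by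
      simp only [Weights.o]
      ring
    refine ⟨⟨1 - u - (t - κ * u), u, 0⟩, ⟨hl, hu, le_rfl, ?_, ?_⟩, ?_, rfl, ?_, ?_⟩
    · rwa [eo]
    · exact Or.inr (Or.inr (Or.inr rfl))
    · rwa [eo]
    · rw [eo]
      ring
    · rw [abscissa, hf, hy]
  rcases lt_or_ge t κ with c | c
  · have e1 : κ * (y * t / κ) = y * t := by field_simp
    have e2 : t / κ ≤ 1 := by
      rw [div_le_one h0]
      exact c.le
    have e3 : y * (t / κ) ≤ y * 1 := mul_le_mul_of_nonneg_left e2 y0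
    have e4 : y * t / κ = y * (t / κ) := mul_div_assoc _ _ _
    apply build (y * t / κ) (by positivity)
    · rw [e1]
      nlinarith
    · rw [e1]
      nlinarith
    · rw [e1, e4]
      nlinarith
    · rw [frac, if_pos c, e1]
      field_simp
  · have p : 0 < 1 - κ := by linarith
    have e1 : (1 - κ) * (y * (1 - t) / (1 - κ)) = y * (1 - t) := by field_simp
    set u := y * (1 - t) / (1 - κ) with hu
    have u0 : 0 ≤ u := div_nonneg (mul_nonneg y0 (by linarith)) p.le
    have u1 : u ≤ 1 := by
      rw [hu, div_le_one p]
      nlinarith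
    apply build u u0
    · nlinarith
    · nlinarith
    · nlinarith
    · rw [frac, if_neg (not_lt.2 c), e1]
      exact mul_div_cancel_right₀ _ (by linarith)

/-- The point lies on the drawn curves. -/
def IsDrawn (r s : ℕ) (c : ℤ) (z : ℂ) : Prop :=
  ∃ b : Weights, b.OnSurface ∧ HasLevel r s c b ∧ b.o < 1 ∧ drawPoint (ratio r s) b = z

theorem IsDrawn.conj (hr : 0 < r) (h : IsDrawn r s c z) : IsDrawn s r c (conj z) := by
  obtain ⟨b, h1, h2, h3, rfl⟩ := h
  refine ⟨b.swap, h1.swap, h2.swap h1, by rwa [b.swap_o], ?_⟩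
  rw [← one_sub_ratio hr, drawPoint_swap h1.o_nonneg]

theorem isDrawn_graph (hr : 0 < r) (hs : 0 < s) {k : ℤ} (hk : Even (k + c)) {t x : ℝ}
    (ht : (k : ℝ) = (r + s) * t) (k0 : 0 < k) (k1 : k < r + s) (hx : -1 - √3 * t ≤ x)
    (hx1 : x ≤ exitX (ratio r s) t) : IsDrawn r s c ⟨x, graphHeight (ratio r s) t x⟩ := by
  have hn := sum_pos_of_pos (s := s) hr
  have c0 := ratio_pos hr hs
  have c1 := ratio_lt_one hr hs
  have t0 : 0 < t := by
    have : (0 : ℝ) < k := by exact_mod_cast k0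
    rw [ht] at this
    exact pos_of_mul_pos_right this hn.le
  have t1 : t < 1 := by
    have : (k : ℝ) < r + s := by exact_mod_cast k1
    by_contra h
    push Not at h
    nlinarith
  obtain ⟨b, b1, b2, b3, b4, b5⟩ := exists_weights_of_abscissa c0 c1 t0 t1 hx hx1
  refine ⟨b, b1, (hasLevel_of_d b3).2 ⟨k, hk, ?_⟩, b2, ?_⟩
  · rw [ht, ← b4]
    linear_combination -b.u * ratio_mul (s := s) hr
  · rw [drawPoint_of_d c0 c1 b1 b3, b4, sideCurve, b5]

theorem exists_ratio (hr : 0 < r) (k : ℤ) : ∃ t : ℝ, (k : ℝ) = (r + s) * t := by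
  have hn := sum_pos_of_pos (s := s) hr
  exact ⟨k / (r + s), by field_simp⟩

theorem isDrawn_left (hr : 0 < r) (hs : 0 < s) {k : ℤ} (hk : Even (k + c)) (k0 : 0 < k)
    (k1 : k < r + s) (hre : z.re ≤ -1) (hz : ‖z - L‖ = k * halfStep r s) (him : 0 ≤ z.im) :
    IsDrawn r s c z := by
  have h33 := sqrt_three_sq
  have h3 := sqrt_three_pos
  have hn := sum_pos_of_pos (s := s) hr
  have c0 := ratio_pos hr hs
  obtain ⟨t, ht⟩ := exists_ratio (s := s) hr k
  have t0 : 0 < t := by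
    have : (0 : ℝ) < k := by exact_mod_cast k0
    rw [ht] at this
    exact pos_of_mul_pos_right this hn.le
  rw [ht, mul_halfStep hr] at hz
  have hle := Complex.abs_re_le_norm (z - L)
  have hsq := norm_sq_eq (z - L)
  rw [hz] at hle hsq
  simp only [Complex.sub_re, Complex.sub_im, L, Complex.neg_re, Complex.one_re, Complex.neg_im,
    Complex.one_im] at hle hsq
  have hx := (abs_le.1 hle).1
  have hE := exitX_pos c0 t0
  have : 0 ≤ exitX (ratio r s) t + 1 := by
    unfold exitX
    split_ifs with h
    · have : 0 ≤ t / ratio r s := by positivity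
      linarith
    · have : 0 ≤ √3 * (t - ratio r s) := mul_nonneg h3.le (by linarith)
      linarith
  convert isDrawn_graph hr hs hk ht k0 k1 (x := z.re) (by linarith) (by linarith) using 1
  apply Complex.ext
  · rfl
  · change z.im = graphHeight _ _ _
    rw [graphHeight_left hre, eq_comm, Real.sqrt_eq_iff_mul_self_eq]
    · linear_combination hsq - t ^ 2 * h33
    · nlinarith
    · exact him

theorem isDrawn_middle_of_neg (hr : 0 < r) (hs : 0 < s) {k : ℤ} (hk : Even (k + c))
    (k1 : |k| < r + s) (h1 : -1 ≤ z.re) (h2 : z.re ≤ 1 / 2)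
    (hz : z.im = k * halfStep r s + (1 - 2 * ratio r s) * √3 / 3 * (z.re + 1))
    (hD : baryD z < 0) : IsDrawn r s c z := by
  have h33 := sqrt_three_sq
  have h3 := sqrt_three_pos
  have hn := sum_pos_of_pos (s := s) hr
  have c0 := ratio_pos hr hs
  obtain ⟨t, ht⟩ := exists_ratio (s := s) hr k
  rw [ht, mul_halfStep hr] at hz
  have hD' : 2 * ratio r s * (z.re + 1) < 3 * t := by
    simp only [baryD] at hD
    have e : √3 * z.im = 3 * t + (1 - 2 * ratio r s) * (z.re + 1) := by
      rw [hz]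
      linear_combination (t + (1 - 2 * ratio r s) / 3 * (z.re + 1)) * h33
    linarith
  have t0 : 0 < t := by
    have : 0 ≤ 2 * ratio r s * (z.re + 1) := mul_nonneg (by linarith) (by linarith)
    linarith
  have k0 : 0 < k := by
    have : (0 : ℝ) < k := by
      rw [ht]
      positivity
    exact_mod_cast this
  rw [abs_of_pos k0] at k1
  have : 0 < √3 * t := by positivity
  convert isDrawn_graph hr hs hk ht k0 k1 (x := z.re) (by linarith) ?_ using 1
  · apply Complex.ext
    · rfl
    · change z.im = graphHeight _ _ _
      rw [graphHeight_middle t0.le h1 h2, hz]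
  · unfold exitX
    split_ifs with h
    · have : z.re + 1 ≤ 3 / 2 * (t / ratio r s) := by
        rw [← mul_div_assoc, le_div_iff₀ c0]
        linarith
      linarith
    · have : 0 ≤ √3 * (t - ratio r s) := mul_nonneg h3.le (by linarith)
      linarith

/-- In this vertical strip a point lies above `LU`, below `LD` or in the triangle; these are the
faces `d = 0`, `u = 0` and `o = 0`. -/
theorem isDrawn_middle (hr : 0 < r) (hs : 0 < s) {k : ℤ} (hk : Even (k + c))
    (k1 : |k| < r + s) (h1 : -1 ≤ z.re) (h2 : z.re ≤ 1 / 2)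
    (hz : z.im = k * halfStep r s + (1 - 2 * ratio r s) * √3 / 3 * (z.re + 1)) :
    IsDrawn r s c z := by
  rcases lt_or_ge (baryD z) 0 with hD | hD
  · exact isDrawn_middle_of_neg hr hs hk k1 h1 h2 hz hD
  rcases lt_or_ge (baryU z) 0 with hU | hU
  · have : IsDrawn s r c (conj z) := by
      refine isDrawn_middle_of_neg hs hr (k := -k) ?_ ?_ h1 h2 ?_ (by rwa [baryD_conj])
      · obtain ⟨i, hi⟩ := hk
        exact ⟨i - k, by linear_combination hi⟩
      · rw [abs_neg]
        lia
      · rw [Complex.conj_im, Complex.conj_re, hz, halfStep_comm, ← one_sub_ratio (s := s) hr]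
        push_cast
        ring
    simpa using this.conj hs
  have h33 := sqrt_three_sq
  have hm := ratio_mul (s := s) hr
  have hL : 0 ≤ baryL z := by
    simp only [baryL]
    linarith
  have ho : (⟨baryL z, baryU z, baryD z⟩ : Weights).o = 0 := by
    simp only [Weights.o, baryL, baryU, baryD]
    ring
  refine ⟨⟨baryL z, baryU z, baryD z⟩, ⟨hL, hU, hD, by rw [ho], Or.inl ho⟩,
    (hasLevel_of_o ho).2 ⟨k, hk, ?_⟩, by rw [ho]; exact one_pos, ?_⟩
  · obtain ⟨t, ht⟩ := exists_ratio (s := s) hr k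
    rw [ht, mul_halfStep hr] at hz
    have e : √3 * z.im = 3 * t + (1 - 2 * ratio r s) * (z.re + 1) := by
      rw [hz]
      linear_combination (t + (1 - 2 * ratio r s) / 3 * (z.re + 1)) * h33
    simp only [baryU, baryD]
    rw [ht]
    linear_combination (r + s) / 3 * e - 2 / 3 * (z.re + 1) * hm
  · rw [drawPoint_of_o ho, affinePoint_of_o ho]
    apply Complex.ext
    · simp only [baryL, baryU, baryD]
      ring
    · simp only [baryU, baryD]
      linear_combination z.im / 3 * h33

theorem isDrawn_right (hr : 0 < r) (hs : 0 < s) {k : ℤ} (hk : Even (k + c)) (k0 : s < k)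
    (k1 : k < r + s) (hre : 1 / 2 ≤ z.re) (hz : ‖z - U‖ = (k - s) * halfStep r s) :
    IsDrawn r s c z := by
  have h33 := sqrt_three_sq
  have h3 := sqrt_three_pos
  have hn := sum_pos_of_pos (s := s) hr
  have c0 := ratio_pos hr hs
  have c1 := ratio_lt_one hr hs
  have hm := ratio_mul (s := s) hr
  obtain ⟨t, ht⟩ := exists_ratio (s := s) hr k
  have e1 : (k : ℝ) - s = (r + s) * (t - ratio r s) := by linear_combination ht + hm
  have t0 : ratio r s < t := by
    have : (0 : ℝ) < k - s := sub_pos.2 (by exact_mod_cast k0)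
    rw [e1] at this
    linarith [pos_of_mul_pos_right this hn.le]
  rw [e1, mul_halfStep hr] at hz
  have hsq := norm_sq_eq (z - U)
  rw [hz] at hsq
  simp only [Complex.sub_re, Complex.sub_im, U] at hsq
  set X := z.re - 1 / 2 with hX
  set Y := z.im - √3 / 2 with hY
  set e := t - ratio r s with he
  have e0 : 0 < e := by linarith
  have X0 : 0 ≤ X := by linarith
  have hsq' : X ^ 2 + Y ^ 2 = 3 * e ^ 2 := by linear_combination -hsq + e ^ 2 * h33
  -- The ray `UO` cuts the semicircle: the part above it belongs to the face `d = 0`, the rest to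
  -- the face `l = 0`.
  rcases le_or_gt (√3 * X) Y with hXY | hXY
  · have hY0 : 0 ≤ Y := (mul_nonneg h3.le X0).trans hXY
    have hle : 2 * X ≤ √3 * e := by
      apply le_of_sq_le_sq _ (mul_nonneg h3.le e0.le)
      have : (√3 * X) ^ 2 ≤ Y ^ 2 := pow_le_pow_left₀ (mul_nonneg h3.le X0) hXY 2
      nlinarith
    have : 0 < √3 * t := mul_pos h3 (c0.trans t0)
    convert isDrawn_graph hr hs hk ht (by lia) k1 (x := z.re) (by linarith) ?_ using 1
    · apply Complex.ext
      · rfl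
      · change z.im = graphHeight _ _ _
        rw [graphHeight_right c0.le t0.le hre, ← hX, ← he, ← sub_eq_iff_eq_add', ← hY, eq_comm,
          Real.sqrt_eq_iff_mul_self_eq]
        · linear_combination -hsq'
        · nlinarith
        · exact hY0
    · rw [exitX, if_neg (not_lt.2 t0.le)]
      linarith
  · have a0 : 0 < √3 * X - Y + 2 * (1 - ratio r s) * X := by
      have : 0 ≤ 2 * (1 - ratio r s) * X := mul_nonneg (by linarith) X0
      linarith
    have e2 : e < 1 - ratio r s := by
      have : (k : ℝ) < r + s := by exact_mod_cast k1
      have : (r + s) * t < (r + s) * 1 := by linarith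
      linarith [lt_of_mul_lt_mul_left this hn.le]
    -- The direction `(X, Y)` requires `d : o = (√3 X - Y) : 2 X`; the factor `y` is fixed by the
    -- radius condition `d + (1 - κ) o = e`.
    obtain ⟨y, hy⟩ : ∃ y, y = e / (√3 * X - Y + 2 * (1 - ratio r s) * X) := ⟨_, rfl⟩
    have y0 : 0 < y := by
      rw [hy]
      positivity
    have hy' : y * (√3 * X - Y + 2 * (1 - ratio r s) * X) = e := by
      rw [hy, div_mul_cancel₀ _ a0.ne']
    set d := (√3 * X - Y) * y with hd
    set o := 2 * X * y with ho
    have d0 : 0 ≤ d := mul_nonneg (by linarith) y0.le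
    have o0 : 0 ≤ o := by positivity
    have hdo : d + (1 - ratio r s) * o = e := by linear_combination hy'
    have hlt : ratio r s * d < (1 - ratio r s) * (1 - d - o) := by linarith
    have u0 : 0 < 1 - d - o := by
      have : 0 ≤ ratio r s * d := by positivity
      exact pos_of_mul_pos_right (this.trans_lt hlt) (by linarith)
    have eo : (⟨0, 1 - d - o, d⟩ : Weights).o = o := by
      simp only [Weights.o]
      ring
    have hb : (⟨0, 1 - d - o, d⟩ : Weights).OnSurface :=
      ⟨le_rfl, u0.le, d0, by rwa [eo], Or.inr (Or.inl rfl)⟩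
    refine ⟨_, hb, (hasLevel_of_l rfl).2 ⟨2 * s - k, ?_, ?_⟩, by rw [eo]; linarith, ?_⟩
    · obtain ⟨i, hi⟩ := hk
      exact ⟨s - k + i, by linear_combination hi⟩
    · rw [eo]
      push_cast
      linear_combination -(r + s) * hdo - o * hm + e1
    · have hN : √(o ^ 2 - √3 * o * d + d ^ 2) = √3 * e * y := by
        rw [cap_norm_sq, Real.sqrt_eq_iff_mul_self_eq]
        · rw [ho, hd]
          linear_combination y ^ 2 * hsq' - y ^ 2 * e ^ 2 * h33
        · positivity
        · positivity
      rw [drawPoint_of_lt c0 c1 hb rfl hlt, eo, capCurve]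
      simp only
      rw [hN, hdo]
      apply Complex.ext
      · change 1 / 2 + √3 * e * (o / 2 / (√3 * e * y)) = z.re
        rw [ho]
        field_simp
        linarith
      · change √3 / 2 + √3 * e * ((√3 / 2 * o - d) / (√3 * e * y)) = z.im
        rw [ho, hd]
        field_simp
        linarith

theorem isDrawn_ray (hr : 0 < r) (hs : 0 < s) (hk : Even ((s : ℤ) - r + c)) (hre : 1 / 2 ≤ z.re)
    (hz : z.im = √3 * (ratio r s - 1 / 2)) : IsDrawn r s c z := by
  have c0 := ratio_pos hr hs
  have c1 := ratio_lt_one hr hs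
  have hm := ratio_mul (s := s) hr
  have hpos : 0 < 2 * z.re := by linarith
  obtain ⟨y, hy⟩ : ∃ y, y = 1 / (2 * z.re) := ⟨_, rfl⟩
  have y0 : 0 < y := by rw [hy]; positivity
  have y1 : y ≤ 1 := by
    rw [hy, div_le_one hpos]
    linarith
  have ho : (⟨0, ratio r s * y, (1 - ratio r s) * y⟩ : Weights).o = 1 - y := by
    simp only [Weights.o]
    ring
  have hb : (⟨0, ratio r s * y, (1 - ratio r s) * y⟩ : Weights).OnSurface :=
    ⟨le_rfl, mul_nonneg c0.le y0.le, mul_nonneg (by linarith) y0.le, by rw [ho]; linarith,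
      Or.inr (Or.inl rfl)⟩
  refine ⟨_, hb, (hasLevel_of_l rfl).2 ⟨s - r, hk, ?_⟩, by rw [ho]; linarith, ?_⟩
  · rw [ho]
    push_cast
    linear_combination y * hm
  · rw [drawPoint_of_eq c0 c1 rfl (by rw [ho]; linarith) (by ring), ho, rayPoint]
    apply Complex.ext
    · change 1 / (2 * (1 - (1 - y))) = z.re
      rw [hy]
      field_simp
      ring
    · exact hz.symm

theorem isDrawn_iff (hr : 0 < r) (hs : 0 < s) : IsDrawn r s c z ↔ OnDrawing r s c z := by
  constructor
  · rintro ⟨b, hb, hl, ho, rfl⟩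
    exact onDrawing_drawPoint hr hs hb hl ho
  · rintro (⟨h1, k, h2, h3, h4, h5⟩ | ⟨h1, h1', k, h2, h3, h4⟩ | ⟨h1, k, h2, h3, h4, h5⟩ |
      ⟨h1, k, h2, h3, h4, h5⟩ | ⟨h1, h2, h3⟩)
    · rcases le_total 0 z.im with him | him
      · exact isDrawn_left hr hs h2 h3 h4 h1 h5 him
      · have : IsDrawn s r c (conj z) := by
          refine isDrawn_left hs hr h2 h3 (by lia) h1 ?_ ?_
          · rw [norm_conj_sub, conj_L, halfStep_comm, h5]
          · rw [Complex.conj_im]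
            linarith
        simpa using this.conj hs
    · exact isDrawn_middle hr hs h2 h3 h1 h1' h4
    · exact isDrawn_right hr hs h2 h3 h4 h1 h5
    · have : IsDrawn s r c (conj z) := by
        refine isDrawn_right hs hr h2 h3 (by lia) h1 ?_
        rw [norm_conj_sub, conj_U, halfStep_comm, h5]
      simpa using this.conj hs
    · exact isDrawn_ray hr hs h2 h1 h3

end Planar

/-! ### Identification of the drawn curves -/

/-- The factors `m - 1 - 2 j` with `j < m / 2` are the integers strictly between `0` and `m` with
the parity of `m - 1`. -/
theorem mem_capsOpenLeft {p z : ℂ} {m : ℕ} {h : ℝ} : z ∈ capsOpenLeft p m h ↔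
    p.re ≤ z.re ∧ ∃ k : ℤ, Even (k + m + 1) ∧ 0 < k ∧ k < m ∧ ‖z - p‖ = k * h := by
  simp only [capsOpenLeft, Set.mem_iUnion, Finset.mem_range, semicircleOpenLeft, exists_prop,
    Set.mem_ofPred_eq]
  constructor
  · rintro ⟨j, hj, h1, h2⟩
    refine ⟨h2, m - 1 - 2 * j, ⟨m - j, by ring⟩, by lia, by lia, ?_⟩
    rw [h1]
    push_cast
    ring
  · rintro ⟨h2, k, ⟨i, hi⟩, hk, hk', h1⟩
    refine ⟨((m - 1 - k) / 2).toNat, by lia, ?_, h2⟩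
    have e : (2 : ℤ) * (((m - 1 - k) / 2).toNat : ℤ) = m - 1 - k := by lia
    have e' : (2 : ℝ) * (((m - 1 - k) / 2).toNat : ℝ) = m - 1 - k := by exact_mod_cast e
    rw [h1, e']
    ring

theorem mem_capsOpenRight {p z : ℂ} {m : ℕ} {h : ℝ} : z ∈ capsOpenRight p m h ↔
    z.re ≤ p.re ∧ ∃ k : ℤ, Even (k + m + 1) ∧ 0 < k ∧ k < m ∧ ‖z - p‖ = k * h := by
  simp only [capsOpenRight, Set.mem_iUnion, Finset.mem_range, semicircleOpenRight, exists_prop,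
    Set.mem_ofPred_eq]
  constructor
  · rintro ⟨j, hj, h1, h2⟩
    refine ⟨h2, m - 1 - 2 * j, ⟨m - j, by ring⟩, by lia, by lia, ?_⟩
    rw [h1]
    push_cast
    ring
  · rintro ⟨h2, k, ⟨i, hi⟩, hk, hk', h1⟩
    refine ⟨((m - 1 - k) / 2).toNat, by lia, ?_, h2⟩
    have e : (2 : ℤ) * (((m - 1 - k) / 2).toNat : ℤ) = m - 1 - k := by lia
    have e' : (2 : ℝ) * (((m - 1 - k) / 2).toNat : ℝ) = m - 1 - k := by exact_mod_cast e
    rw [h1, e']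
    ring

theorem mem_segment_iff {y g : ℝ} {z : ℂ} :
    z ∈ segment ℝ (⟨1 / 2, y + g * (3 / 2)⟩ : ℂ) ⟨-1, y⟩ ↔
      -1 ≤ z.re ∧ z.re ≤ 1 / 2 ∧ z.im = y + g * (z.re + 1) := by
  constructor
  · rintro ⟨a, a', h1, h2, h3, rfl⟩
    obtain rfl : a' = 1 - a := by linarith
    simp only [Complex.add_re, Complex.add_im, Complex.real_smul, Complex.re_ofReal_mul,
      Complex.im_ofReal_mul]
    refine ⟨by linarith, by linarith, by ring⟩
  · rintro ⟨h1, h2, h3⟩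
    refine ⟨2 / 3 * (z.re + 1), 1 - 2 / 3 * (z.re + 1), by linarith, by linarith, by ring, ?_⟩
    apply Complex.ext
    · simp only [Complex.add_re, Complex.real_smul, Complex.re_ofReal_mul]
      ring
    · simp only [Complex.add_im, Complex.real_smul, Complex.im_ofReal_mul, h3]
      ring

theorem or_rotate (p q v w : Prop) : (((p ∨ q) ∨ v) ∨ w) ↔ (v ∨ w ∨ p ∨ q) := by tauto

theorem or_rotate' (p q v w y : Prop) : ((((p ∨ q) ∨ v) ∨ w) ∨ y) ↔ (v ∨ w ∨ p ∨ q ∨ y) := by tauto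

section Drawings

variable {r s : ℕ} {c : ℤ} {z : ℂ}

theorem sqrt_three_eq (hr : 0 < r) : √3 = (r + s) * halfStep r s := by
  have := mul_halfStep (s := s) hr 1
  linarith

theorem slope_eq (hr : 0 < r) :
    (1 - 2 * ratio r s) * √3 / 3 * (3 / 2) = (r - s) / 2 * halfStep r s := by
  rw [sqrt_three_eq (s := s) hr]
  linear_combination -halfStep r s * ratio_mul (s := s) hr

/-- `U` and `D` are `r + s` half steps apart, so the points around both continue a single arithmetic
progression. It is the progression of the `λ_i` shifted by a constant; hence all segments are
parallel. -/
theorem kappaInner_eq (hr : 0 < r) (i : ℕ) : kappaInner r s i =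
    ⟨1 / 2, (r + s + 1 - 2 * i) * halfStep r s + (1 - 2 * ratio r s) * √3 / 3 * (3 / 2)⟩ := by
  rw [slope_eq hr, kappaInner]
  split_ifs with h
  · simp only [verticalPoint, U]
    congr 1
    rw [sqrt_three_eq (s := s) hr]
    ring
  · simp only [verticalPoint, D]
    congr 1
    rw [sqrt_three_eq (s := s) hr, Nat.cast_sub (by lia)]
    ring

theorem kappaOuter_eq (hr : 0 < r) (hs : 0 < s) (i : ℕ) : kappaOuter r s i =
    ⟨1 / 2, (r + s - 2 * i) * halfStep r s + (1 - 2 * ratio r s) * √3 / 3 * (3 / 2)⟩ := by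
  rw [slope_eq hr, kappaOuter]
  split_ifs with h h'
  · simp only [verticalPoint, U]
    congr 1
    rw [sqrt_three_eq (s := s) hr, Nat.cast_sub hr]
    push_cast
    ring
  · simp only [U]
    congr 1
    rw [sqrt_three_eq (s := s) hr, h']
    ring
  · simp only [verticalPoint, D]
    congr 1
    rw [sqrt_three_eq (s := s) hr, Nat.cast_sub (not_lt.1 h), Nat.cast_sub (Nat.succ_le_of_lt hs)]
    push_cast
    ring

theorem mem_positiveInner (hr : 0 < r) (hc : Even (r + s + 1 + c)) :
    z ∈ positiveInner r s ↔ OnDrawing r s c z := by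
  have par : ∀ k : ℤ, Even (k + (r + s) + 1) ↔ Even (k + c) := by
    intro k
    obtain ⟨i, hi⟩ := hc
    constructor
    · rintro ⟨j, hj⟩
      exact ⟨k + i - j, by linear_combination hi - hj⟩
    · rintro ⟨j, hj⟩
      exact ⟨k + i - j, by linear_combination hi - hj⟩
  -- The ray has level `s - r`, which has the parity of the outer arc.
  have hray : ¬ Even ((s : ℤ) - r + c) := by
    obtain ⟨i, hi⟩ := hc
    rintro ⟨j, hj⟩
    lia
  have hseg : (∃ i ∈ Finset.Icc 1 (r + s), z ∈ segment ℝ (kappaInner r s i)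
      (verticalPoint L (r + s) (halfStep r s) i)) ↔
      (-1 ≤ z.re ∧ z.re ≤ 1 / 2 ∧ ∃ k : ℤ, Even (k + c) ∧ |k| < r + s ∧
        z.im = k * halfStep r s + (1 - 2 * ratio r s) * √3 / 3 * (z.re + 1)) := by
    have e : ∀ i : ℕ, z ∈ segment ℝ (kappaInner r s i)
        (verticalPoint L (r + s) (halfStep r s) i) ↔ -1 ≤ z.re ∧ z.re ≤ 1 / 2 ∧
        z.im = (r + s + 1 - 2 * i) * halfStep r s +
          (1 - 2 * ratio r s) * √3 / 3 * (z.re + 1) := by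
      intro i
      rw [kappaInner_eq hr, ← mem_segment_iff]
      simp [verticalPoint, L]
    simp_rw [e, ← par]
    constructor
    · rintro ⟨i, hi, h1, h2, h3⟩
      rw [Finset.mem_Icc] at hi
      refine ⟨h1, h2, r + s + 1 - 2 * i, ⟨r + s + 1 - i, by ring⟩, abs_lt.2 (by lia), ?_⟩
      rw [h3]
      push_cast
      ring
    · rintro ⟨h1, h2, k, ⟨j, hj⟩, hk, h3⟩
      rw [abs_lt] at hk
      have e : (2 : ℤ) * (((r + s + 1 - k) / 2).toNat : ℤ) = r + s + 1 - k := by lia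
      have e' : (2 : ℝ) * (((r + s + 1 - k) / 2).toNat : ℝ) = r + s + 1 - k := by exact_mod_cast e
      refine ⟨((r + s + 1 - k) / 2).toNat, Finset.mem_Icc.2 (by lia), h1, h2, ?_⟩
      rw [h3, e']
      ring
  have parU : ∀ k : ℤ, Even (k - s + r + 1) ↔ Even (k + c) := by
    intro k
    rw [← par]
    constructor
    · rintro ⟨j, hj⟩
      exact ⟨j + s, by linear_combination hj⟩
    · rintro ⟨j, hj⟩
      exact ⟨j - s, by linear_combination hj⟩
  have parD : ∀ k : ℤ, Even (k - r + s + 1) ↔ Even (k + c) := by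
    intro k
    rw [← par]
    constructor
    · rintro ⟨j, hj⟩
      exact ⟨j + r, by linear_combination hj⟩
    · rintro ⟨j, hj⟩
      exact ⟨j - r, by linear_combination hj⟩
  simp only [positiveInner, Set.mem_union, Set.mem_iUnion, exists_prop, hseg, mem_capsOpenLeft,
    mem_capsOpenRight, OnDrawing]
  have hU : (U.re ≤ z.re ∧ ∃ k : ℤ, Even (k + r + 1) ∧ 0 < k ∧ k < r ∧
      ‖z - U‖ = k * halfStep r s) ↔ (1 / 2 ≤ z.re ∧ ∃ k : ℤ, Even (k + c) ∧ s < k ∧ k < r + s ∧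
      ‖z - U‖ = (k - s) * halfStep r s) := by
    refine and_congr_right' ⟨?_, ?_⟩
    · rintro ⟨k, h1, h2, h3, h4⟩
      refine ⟨k + s, (parU _).1 (by rwa [add_sub_cancel_right]), by lia, by lia, ?_⟩
      rw [h4]
      push_cast
      ring
    · rintro ⟨k, h1, h2, h3, h4⟩
      refine ⟨k - s, (parU _).2 h1, by lia, by lia, ?_⟩
      rw [h4]
      push_cast
      ring
  have hD : (D.re ≤ z.re ∧ ∃ k : ℤ, Even (k + s + 1) ∧ 0 < k ∧ k < s ∧
      ‖z - D‖ = k * halfStep r s) ↔ (1 / 2 ≤ z.re ∧ ∃ k : ℤ, Even (k + c) ∧ r < k ∧ k < r + s ∧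
      ‖z - D‖ = (k - r) * halfStep r s) := by
    refine and_congr_right' ⟨?_, ?_⟩
    · rintro ⟨k, h1, h2, h3, h4⟩
      refine ⟨k + r, (parD _).1 (by rwa [add_sub_cancel_right]), by lia, by lia, ?_⟩
      rw [h4]
      push_cast
      ring
    · rintro ⟨k, h1, h2, h3, h4⟩
      refine ⟨k - r, (parD _).2 h1, by lia, by lia, ?_⟩
      rw [h4]
      push_cast
      ring
  have hL : (z.re ≤ L.re ∧ ∃ k : ℤ, Even (k + (r + s : ℕ) + 1) ∧ 0 < k ∧ k < (r + s : ℕ) ∧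
      ‖z - L‖ = k * halfStep r s) ↔ (z.re ≤ -1 ∧ ∃ k : ℤ, Even (k + c) ∧ 0 < k ∧ k < r + s ∧
      ‖z - L‖ = k * halfStep r s) := by
    push_cast
    simp_rw [par]
    rfl
  rw [hU, hD, hL]
  simp only [hray, false_and, and_false, or_false]
  exact or_rotate _ _ _ _

theorem mem_positiveOuter (hr : 0 < r) (hs : 0 < s) (hc : Even (r + s + c)) :
    z ∈ positiveOuter r s ↔ OnDrawing r s c z := by
  have par : ∀ k : ℤ, Even (k + (r + s)) ↔ Even (k + c) := by
    intro k
    obtain ⟨i, hi⟩ := hc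
    constructor
    · rintro ⟨j, hj⟩
      exact ⟨k + i - j, by linear_combination hi - hj⟩
    · rintro ⟨j, hj⟩
      exact ⟨k + i - j, by linear_combination hi - hj⟩
  have hray : Even ((s : ℤ) - r + c) := by
    obtain ⟨i, hi⟩ := hc
    exact ⟨i - r, by linear_combination hi⟩
  have hseg : (∃ i ∈ Finset.Icc 1 (r + s - 1), z ∈ segment ℝ (kappaOuter r s i)
      (verticalPoint L (r + s - 1) (halfStep r s) i)) ↔
      (-1 ≤ z.re ∧ z.re ≤ 1 / 2 ∧ ∃ k : ℤ, Even (k + c) ∧ |k| < r + s ∧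
        z.im = k * halfStep r s + (1 - 2 * ratio r s) * √3 / 3 * (z.re + 1)) := by
    have e : ∀ i : ℕ, z ∈ segment ℝ (kappaOuter r s i)
        (verticalPoint L (r + s - 1) (halfStep r s) i) ↔ -1 ≤ z.re ∧ z.re ≤ 1 / 2 ∧
        z.im = (r + s - 2 * i) * halfStep r s +
          (1 - 2 * ratio r s) * √3 / 3 * (z.re + 1) := by
      intro i
      rw [kappaOuter_eq hr hs, ← mem_segment_iff, verticalPoint, Nat.cast_sub (by lia)]
      simp [L]
    simp_rw [e, ← par]
    constructor
    · rintro ⟨i, hi, h1, h2, h3⟩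
      rw [Finset.mem_Icc] at hi
      refine ⟨h1, h2, r + s - 2 * i, ⟨r + s - i, by ring⟩, abs_lt.2 (by lia), ?_⟩
      rw [h3]
      push_cast
      ring
    · rintro ⟨h1, h2, k, ⟨j, hj⟩, hk, h3⟩
      rw [abs_lt] at hk
      have e : (2 : ℤ) * (((r + s - k) / 2).toNat : ℤ) = r + s - k := by lia
      have e' : (2 : ℝ) * (((r + s - k) / 2).toNat : ℝ) = r + s - k := by exact_mod_cast e
      refine ⟨((r + s - k) / 2).toNat, Finset.mem_Icc.2 (by lia), h1, h2, ?_⟩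
      rw [h3, e']
      ring
  have hU : (U.re ≤ z.re ∧ ∃ k : ℤ, Even (k + (r - 1 : ℕ) + 1) ∧ 0 < k ∧ k < (r - 1 : ℕ) ∧
      ‖z - U‖ = k * halfStep r s) ↔ (1 / 2 ≤ z.re ∧ ∃ k : ℤ, Even (k + c) ∧ s < k ∧ k < r + s ∧
      ‖z - U‖ = (k - s) * halfStep r s) := by
    refine and_congr_right' ⟨?_, ?_⟩
    · rintro ⟨k, ⟨j, hj⟩, h2, h3, h4⟩
      refine ⟨k + s, (par _).1 ⟨j + s, by lia⟩, by lia, by lia, ?_⟩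
      rw [h4]
      push_cast
      ring
    · rintro ⟨k, h1, h2, h3, h4⟩
      obtain ⟨j, hj⟩ := (par _).2 h1
      refine ⟨k - s, ⟨j - s, by lia⟩, by lia, by lia, ?_⟩
      rw [h4]
      push_cast
      ring
  have hD : (D.re ≤ z.re ∧ ∃ k : ℤ, Even (k + (s - 1 : ℕ) + 1) ∧ 0 < k ∧ k < (s - 1 : ℕ) ∧
      ‖z - D‖ = k * halfStep r s) ↔ (1 / 2 ≤ z.re ∧ ∃ k : ℤ, Even (k + c) ∧ r < k ∧ k < r + s ∧
      ‖z - D‖ = (k - r) * halfStep r s) := by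
    refine and_congr_right' ⟨?_, ?_⟩
    · rintro ⟨k, ⟨j, hj⟩, h2, h3, h4⟩
      refine ⟨k + r, (par _).1 ⟨j + r, by lia⟩, by lia, by lia, ?_⟩
      rw [h4]
      push_cast
      ring
    · rintro ⟨k, h1, h2, h3, h4⟩
      obtain ⟨j, hj⟩ := (par _).2 h1
      refine ⟨k - r, ⟨j - r, by lia⟩, by lia, by lia, ?_⟩
      rw [h4]
      push_cast
      ring
  have hL : (z.re ≤ L.re ∧ ∃ k : ℤ, Even (k + (r + s - 1 : ℕ) + 1) ∧ 0 < k ∧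
      k < (r + s - 1 : ℕ) ∧ ‖z - L‖ = k * halfStep r s) ↔ (z.re ≤ -1 ∧ ∃ k : ℤ, Even (k + c) ∧
      0 < k ∧ k < r + s ∧ ‖z - L‖ = k * halfStep r s) := by
    refine and_congr_right' ⟨?_, ?_⟩
    · rintro ⟨k, ⟨j, hj⟩, h2, h3, h4⟩
      exact ⟨k, (par _).1 ⟨j, by lia⟩, h2, by lia, h4⟩
    · rintro ⟨k, h1, h2, h3, h4⟩
      obtain ⟨j, hj⟩ := (par _).2 h1
      exact ⟨k, ⟨j, by lia⟩, h2, by lia, h4⟩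
  have hO : z ∈ {z : ℂ | (kappaOuter r s r).re ≤ z.re ∧ z.im = (kappaOuter r s r).im} ↔
      (1 / 2 ≤ z.re ∧ Even ((s : ℤ) - r + c) ∧ z.im = √3 * (ratio r s - 1 / 2)) := by
    have e : (s - r) * halfStep r s + (1 - 2 * ratio r s) * √3 / 3 * (3 / 2) =
        √3 * (ratio r s - 1 / 2) := by
      rw [slope_eq hr, sqrt_three_eq (s := s) hr]
      linear_combination -halfStep r s * ratio_mul (s := s) hr
    rw [kappaOuter_eq hr hs, Set.mem_ofPred_eq, ← e]
    simp only [hray, true_and]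
    ring_nf
  simp only [positiveOuter, Set.mem_union, Set.mem_iUnion, exists_prop, hseg, mem_capsOpenLeft,
    mem_capsOpenRight, OnDrawing, hU, hD, hL, hO]
  exact or_rotate' _ _ _ _ _

/-- The parity of the level of the arcs of the given kind. -/
def Kind.parity : Kind → ℤ
  | Kind.inner => 1
  | Kind.outer => 0

theorem mem_positiveArc (hr : 0 < r) (hs : 0 < s) {ε : Kind} {i : ℤ} (hi : Even (i + ε.parity)) :
    z ∈ positiveArc r s ε ↔ OnDrawing r s (i + (r + s)) z := by
  obtain ⟨j, hj⟩ := hi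
  cases ε with simp only [Kind.parity] at hj
  | inner => exact mem_positiveInner hr ⟨j + r + s, by linear_combination hj⟩
  | outer => exact mem_positiveOuter hr hs ⟨j + r + s, by linear_combination hj⟩

/-- In the plane this is `isDrawn_iff`. The point `O` has level `r + s`, so it lies on the curve
exactly when `idet (s, r) x` is even, which is the outer case. -/
theorem trace_drawnArc (hr : 0 < r) (hs : 0 < s) (hv : IsCoprime (s : ℤ) (r : ℤ)) {x : ℤ × ℤ}
    {ε : Kind} (hi : Even (idet (s, r) x + ε.parity)) : (drawnArc hr hs hv x).trace =
      (fun z : ℂ => (z : Sphere)) '' positiveArc r s ε ∪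
        {x | ε = Kind.outer ∧ x = OnePoint.infty} := by
  have hp : ∀ b : Weights, b.o ≠ 1 → blend (ratio r s) 1 b = (drawPoint (ratio r s) b : Sphere) :=
    fun b h => by simp [blend, blendPoint, h]
  ext z
  rw [mem_trace_drawnArc]
  constructor
  · rintro ⟨b, hb, hl, rfl⟩
    by_cases ho : b.o = 1
    · right
      have hsum := b.sum_eq
      have := hb.l_nonneg
      have := hb.u_nonneg
      have := hb.d_nonneg
      have zd : b.d = 0 := by linarith
      have zu : b.u = 0 := by linarith
      refine ⟨?_, if_pos ho⟩
      obtain ⟨m, hm, e⟩ := (hasLevel_of_d zd).1 hl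
      rw [zu, ho] at e
      have : m = r + s := by
        have : (m : ℝ) = r + s := by linarith
        exact_mod_cast this
      rw [this] at hm
      cases ε with
      | inner =>
        obtain ⟨j, hj⟩ := hi
        obtain ⟨j', hj'⟩ := hm
        simp only [Kind.parity] at hj
        lia
      | outer => rfl
    · left
      rw [hp b ho]
      refine ⟨_, (mem_positiveArc hr hs hi).2 ?_, rfl⟩
      exact onDrawing_drawPoint hr hs hb hl (lt_of_le_of_ne hb.o_le_one ho)
  · rintro (⟨w, hw, rfl⟩ | ⟨rfl, rfl⟩)
    · obtain ⟨b, hb, hl, ho, rfl⟩ := (isDrawn_iff hr hs).2 ((mem_positiveArc hr hs hi).1 hw)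
      exact ⟨b, hb, hl, hp b ho.ne⟩
    · have ho : (⟨0, 0, 0⟩ : Weights).o = 1 := by norm_num [Weights.o]
      refine ⟨⟨0, 0, 0⟩, ⟨le_rfl, le_rfl, le_rfl, by rw [ho]; exact zero_le_one,
        Or.inr (Or.inl rfl)⟩, (hasLevel_of_d rfl).2 ⟨r + s, ?_, ?_⟩, if_pos ho⟩
      · obtain ⟨j, hj⟩ := hi
        simp only [Kind.parity] at hj
        exact ⟨j + r + s, by linear_combination hj⟩
      · rw [ho]
        push_cast
        ring

end Drawings

/-! ### Curves with a given trace -/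

/-- The parameter is moved linearly from `s` to `h s`; for interior `s` both are interior, and so is
everything between. -/
theorem homotopic_comp {f g : C(I, Sphere)} (hf : IsMarkedCurve f) (h : C(I, I))
    (hg : ∀ s, f (h s) = g s) (h0 : ∀ s, h s = 0 ↔ s = 0) (h1 : ∀ s, h s = 1 ↔ s = 1) :
    Homotopic f g := by
  have mem : ∀ t s : I, (1 - (t : ℝ)) * s + t * h s ∈ Set.Icc (0 : ℝ) 1 := by
    intro t s
    have a := t.2.1
    have b := t.2.2
    have c := s.2.1
    have d := s.2.2
    have e := (h s).2.1
    have f := (h s).2.2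
    constructor
    · exact add_nonneg (mul_nonneg (by linarith) c) (mul_nonneg a e)
    · nlinarith
  refine ⟨⟨⟨⟨fun p : I × I => f ⟨(1 - (p.1 : ℝ)) * p.2 + p.1 * h p.2, mem p.1 p.2⟩, ?_⟩, ?_, ?_⟩, ?_⟩⟩
  · exact f.continuous.comp (Continuous.subtype_mk (by fun_prop) _)
  · intro s
    change f _ = f _
    congr 1
    apply Subtype.ext
    simp
  · intro s
    change f _ = g _
    rw [← hg]
    congr 1
    apply Subtype.ext
    simp
  · intro t s
    change f _ ∈ marked ↔ _
    rw [hf]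
    have a := t.2.1
    have b := t.2.2
    have c := s.2.1
    have d := s.2.2
    have e := (h s).2.1
    have e' := (h s).2.2
    have x0 : (s : ℝ) = 0 ↔ s = 0 := by simp
    have x1 : (s : ℝ) = 1 ↔ s = 1 := by simp
    have y0 : (h s : ℝ) = 0 ↔ s = 0 := by simp [← h0 s]
    have y1 : (h s : ℝ) = 1 ↔ s = 1 := by simp [← h1 s]
    refine or_congr ?_ ?_
    · rw [Subtype.ext_iff]
      change (1 - (t : ℝ)) * s + t * h s = 0 ↔ _
      constructor
      · intro hz
        have p : 0 ≤ (1 - (t : ℝ)) * s := mul_nonneg (by linarith) c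
        have q : 0 ≤ (t : ℝ) * h s := mul_nonneg a e
        have p0 : (1 - (t : ℝ)) * s = 0 := by linarith
        have q0 : (t : ℝ) * h s = 0 := by linarith
        rcases mul_eq_zero.1 q0 with k | k
        · rw [k] at p0
          exact x0.1 (by linarith)
        · exact y0.1 k
      · intro hs
        rw [x0.2 hs, y0.2 hs]
        ring
    · rw [Subtype.ext_iff]
      change (1 - (t : ℝ)) * s + t * h s = 1 ↔ _
      constructor
      · intro hz
        have p : 0 ≤ (1 - (t : ℝ)) * (1 - s) := mul_nonneg (by linarith) (by linarith)
        have q : 0 ≤ (t : ℝ) * (1 - h s) := mul_nonneg a (by linarith)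
        have p0 : (1 - (t : ℝ)) * (1 - s) = 0 := by linarith
        have q0 : (t : ℝ) * (1 - h s) = 0 := by linarith
        rcases mul_eq_zero.1 q0 with k | k
        · rw [k] at p0
          exact x1.1 (by linarith)
        · exact y1.1 (by linarith)
      · intro hs
        rw [x1.2 hs, y1.2 hs]
        ring

/-- A curve without self-intersections whose endpoints are different is determined by its trace, up
to homotopy and inversion. -/
theorem ArcCurve.isDrawnAs (γ : ArcCurve) (hne : γ.toMap 0 ≠ γ.toMap 1) :
    γ.toArc.IsDrawnAs γ.trace := by
  intro β
  refine ⟨?_, fun h => ⟨γ, rfl, h.symm⟩⟩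
  rintro ⟨δ, htr, rfl⟩
  have inj : Function.Injective γ.toMap := by
    intro s t h
    rcases γ.simple s t h with e | ⟨rfl, rfl⟩ | ⟨rfl, rfl⟩
    · exact e
    · exact absurd h hne
    · exact absurd h.symm hne
  have hemb : IsEmbedding γ.toMap := (γ.toMap.continuous.isClosedEmbedding inj).isEmbedding
  -- `γ` embeds the interval, so `δ = γ ∘ h` with a continuous `h`, and `h` turns out to fix or to
  -- exchange the ends.
  have hex : ∀ s, ∃ t, γ.toMap t = δ.toMap s := by
    intro s
    have : δ.toMap s ∈ γ.trace := htr ▸ Set.mem_range_self s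
    exact this
  choose h hh using hex
  have hcont : Continuous h := by
    rw [hemb.continuous_iff]
    have : γ.toMap ∘ h = δ.toMap := funext hh
    rw [this]
    exact δ.toMap.continuous
  have hend : ∀ s, (h s = 0 ∨ h s = 1) ↔ (s = 0 ∨ s = 1) := by
    intro s
    rw [← γ.isMarked, hh, δ.isMarked]
  have hsurj : ∀ t, ∃ s, h s = t := by
    intro t
    have : γ.toMap t ∈ δ.trace := htr ▸ Set.mem_range_self t
    obtain ⟨s, hs⟩ := this
    exact ⟨s, inj ((hh s).trans hs)⟩
  -- Both ends of `γ` are marked, so `δ` passes through them at its own ends only.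
  have h01 : h 0 ≠ h 1 := by
    intro e
    obtain ⟨s, hs⟩ := hsurj 0
    obtain ⟨s', hs'⟩ := hsurj 1
    have c := (hend s).1 (Or.inl hs)
    have c' := (hend s').1 (Or.inr hs')
    rcases c with rfl | rfl <;> rcases c' with rfl | rfl <;>
      simp_all
  have hδ : ∀ s t, h s = h t → s = t := by
    intro s t e
    have : δ.toMap s = δ.toMap t := by rw [← hh, ← hh, e]
    rcases δ.simple s t this with k | ⟨rfl, rfl⟩ | ⟨rfl, rfl⟩
    · exact k
    · exact absurd e h01
    · exact absurd e.symm h01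
  symm
  apply Quotient.sound
  rcases (hend 0).2 (Or.inl rfl) with e0 | e0
  · left
    have e1 : h 1 = 1 := by
      rcases (hend 1).2 (Or.inr rfl) with e1 | e1
      · exact absurd (e0.trans e1.symm) h01
      · exact e1
    refine homotopic_comp γ.isMarked ⟨h, hcont⟩ hh (fun s => ?_) fun s => ?_
    · exact ⟨fun k => hδ _ _ (k.trans e0.symm), fun k => k ▸ e0⟩
    · exact ⟨fun k => hδ _ _ (k.trans e1.symm), fun k => k ▸ e1⟩
  · right
    have e1 : h 1 = 0 := by
      rcases (hend 1).2 (Or.inr rfl) with e1 | e1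
      · exact e1
      · exact absurd (e0.trans e1.symm) h01
    refine homotopic_comp γ.isMarked ⟨fun s => h (unitInterval.symm s), by fun_prop⟩
      (fun s => hh _) (fun s => ?_) fun s => ?_
    · exact Iff.trans ⟨fun k => hδ _ 1 (k.trans e1.symm), fun k => (congrArg h k).trans e1⟩
        unitInterval.symm_eq_one
    · exact Iff.trans ⟨fun k => hδ _ 0 (k.trans e0.symm), fun k => (congrArg h k).trans e0⟩
        unitInterval.symm_eq_zero

/-- The set is the trace of a curve that is homotopic to the image of the segment from `x` to
`x + v`. -/
def IsTraceOf (X : Set Sphere) (x v : ℤ × ℤ) : Prop :=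
  ∃ hv : IsCoprime v.1 v.2, ∃ γ : ArcCurve, γ.trace = X ∧ γ.toMap 0 ≠ γ.toMap 1 ∧
    γ.toArc = (segmentArc x v hv).toArc

theorem segmentArc_ne (x : ℤ × ℤ) {v : ℤ × ℤ} (hv : IsCoprime v.1 v.2) :
    (segmentArc x v hv).toMap 0 ≠ (segmentArc x v hv).toMap 1 :=
  fun h => zero_ne_one (cover_segmentMap_injective x hv h)

theorem isTraceOf_segmentArc (x : ℤ × ℤ) {v : ℤ × ℤ} (hv : IsCoprime v.1 v.2) :
    IsTraceOf (segmentArc x v hv).trace x v :=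
  ⟨hv, _, rfl, segmentArc_ne x hv, rfl⟩

theorem IsTraceOf.isDrawnAs {X : Set Sphere} {x v : ℤ × ℤ} (h : IsTraceOf X x v) :
    ∃ hv : IsCoprime v.1 v.2, (segmentArc x v hv).toArc.IsDrawnAs X := by
  obtain ⟨hv, γ, rfl, hne, he⟩ := h
  exact ⟨hv, he ▸ γ.isDrawnAs hne⟩

theorem isTraceOf_drawn {r s : ℕ} (hr : 0 < r) (hs : 0 < s) (hv : IsCoprime (s : ℤ) (r : ℤ))
    {x : ℤ × ℤ} {ε : Kind} (hi : Even (idet (s, r) x + ε.parity)) :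
    IsTraceOf ((fun z : ℂ => (z : Sphere)) '' positiveArc r s ε ∪
        {x | ε = Kind.outer ∧ x = OnePoint.infty}) x (s, r) := by
  refine ⟨hv, drawnArc hr hs hv x, trace_drawnArc hr hs hv hi, fun h => ?_,
    drawnArc_toArc hr hs hv x⟩
  rcases (drawnArc hr hs hv x).simple 0 1 h with e | ⟨-, -⟩ | ⟨e, -⟩
  · exact zero_ne_one e
  · exact zero_ne_one (cover_segmentMap_injective x hv (congrArg toSphere
      (blend_one_injOn (ratio_pos hr hs) (ratio_lt_one hr hs) (weights_onSurface _)
        (weights_onSurface _) h)))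
  · exact zero_ne_one e

theorem IsTraceOf.neg {X : Set Sphere} {x v : ℤ × ℤ} (h : IsTraceOf X x v) :
    IsTraceOf X (x + v) (-v) := by
  obtain ⟨hv, γ, hX, hne, he⟩ := h
  refine ⟨hv.neg_neg, γ, hX, hne, he.trans (Quotient.sound (Or.inr ?_))⟩
  have e : (segmentArc x v hv).toMap = reverse (segmentArc (x + v) (-v) hv.neg_neg).toMap := by
    ext1 s
    change cover (segmentMap x v s) = cover (segmentMap (x + v) (-v) (unitInterval.symm s))
    congr 1
    rw [segmentMap_apply, segmentMap_apply, toPlane_add, toPlane_neg, unitInterval.coe_symm_eq,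
      sub_smul, one_smul, smul_neg]
    abel
  rw [← e]
  exact ContinuousMap.HomotopicWith.refl _ (segmentArc x v hv).isMarked

/-! ### The rotation -/

/-- The rotation of the sphere. -/
def rotateSphere : Sphere → Sphere := OnePoint.map rotate

/-- The automorphism of the plane that covers the rotation. -/
def rotatePlane (w : ℝ × ℝ) : ℝ × ℝ := (w.1 + w.2, -w.1)

/-- `rotatePlane` permutes the waves at `w.1`, `w.2`, `w.1 + w.2` cyclically, hence also the weights
of `L`, `U`, `D`. Its cube is the half turn about the origin. -/
theorem rotateSphere_cover (w : ℝ × ℝ) : rotateSphere (cover w) = cover (rotatePlane w) := by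
  have hw : weights (rotatePlane w) = ⟨(weights w).u, (weights w).d, (weights w).l⟩ := by
    have e : w.1 + w.2 + -w.1 = w.2 := by ring
    simp only [weights, rotatePlane, tri_neg, e]
    congr 1 <;> ring
  have ho : (weights (rotatePlane w)).o = (weights w).o := by
    rw [hw]
    simp only [Weights.o]
    ring
  rw [cover, cover, toSphere, toSphere, ho]
  split_ifs with h
  · rfl
  · change ((rotate (affinePoint (weights w)) : ℂ) : Sphere) = _
    congr 1
    have h33 := sqrt_three_sq
    apply Complex.ext
    · rw [rotate, Complex.mul_re]
      simp only [affinePoint, ho]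
      rw [hw]
      simp only
      linear_combination
        -((weights w).u - (weights w).d) / (1 - (weights w).o) ^ 2 / 4 * h33
    · rw [rotate, Complex.mul_im]
      simp only [affinePoint, ho]
      rw [hw]
      simp only
      ring

theorem continuous_rotateSphere : Continuous rotateSphere := by
  rw [isQuotientMap_cover.continuous_iff]
  have : rotateSphere ∘ cover = cover ∘ rotatePlane := funext rotateSphere_cover
  rw [this]
  exact continuous_cover.comp (by unfold rotatePlane; fun_prop)

theorem isLattice_rotatePlane {w : ℝ × ℝ} : IsLattice (rotatePlane w) ↔ IsLattice w := by
  constructor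
  · rintro ⟨j, k, h⟩
    have h1 : w.1 + w.2 = j := congrArg Prod.fst h
    have h2 : -w.1 = k := congrArg Prod.snd h
    refine ⟨-k, j + k, Prod.ext ?_ ?_⟩
    · push_cast
      linarith
    · push_cast
      linarith
  · rintro ⟨j, k, rfl⟩
    exact ⟨j + k, -j, by simp [rotatePlane]⟩

theorem rotateSphere_mem_marked {z : Sphere} : rotateSphere z ∈ marked ↔ z ∈ marked := by
  obtain ⟨w, rfl⟩ := cover_surjective z
  rw [rotateSphere_cover, cover_mem_marked, cover_mem_marked, isLattice_rotatePlane]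

theorem rotateSphere_injective : Function.Injective rotateSphere := by
  apply Option.map_injective
  intro z w h
  refine mul_left_cancel₀ (fun h0 => ?_) h
  have := congrArg Complex.re h0
  norm_num at this

/-- Composition of a curve with the rotation. -/
def rotateMap (f : C(I, Sphere)) : C(I, Sphere) := ⟨fun s => rotateSphere (f s),
  continuous_rotateSphere.comp f.continuous⟩

theorem Homotopic.rotateMap {f g : C(I, Sphere)} (h : Homotopic f g) :
    Homotopic (rotateMap f) (rotateMap g) := by
  obtain ⟨H⟩ := h
  refine ⟨⟨⟨⟨fun p => rotateSphere (H p), continuous_rotateSphere.comp H.continuous⟩, ?_, ?_⟩, ?_⟩⟩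
  · intro s
    exact congrArg rotateSphere (H.apply_zero s)
  · intro s
    exact congrArg rotateSphere (H.apply_one s)
  · intro t s
    exact rotateSphere_mem_marked.trans (H.prop' t s)

/-- The automorphism of the lattice that covers the rotation. -/
def rotateLattice (x : ℤ × ℤ) : ℤ × ℤ := (x.1 + x.2, -x.1)

theorem idet_rotateLattice (x y : ℤ × ℤ) : idet (rotateLattice x) (rotateLattice y) = idet x y := by
  simp only [idet, rotateLattice]
  ring

theorem rotatePlane_segmentMap (x v : ℤ × ℤ) (s : I) :
    rotatePlane (segmentMap x v s) = segmentMap (rotateLattice x) (rotateLattice v) s := by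
  simp only [segmentMap_apply, rotatePlane, rotateLattice, toPlane]
  apply Prod.ext
  · simp
    ring
  · simp
    ring

theorem IsTraceOf.rotate {X : Set Sphere} {x v : ℤ × ℤ} (h : IsTraceOf X x v) :
    IsTraceOf (rotateSphere '' X) (rotateLattice x) (rotateLattice v) := by
  obtain ⟨hv, γ, rfl, hne, he⟩ := h
  have hv' : IsCoprime (rotateLattice v).1 (rotateLattice v).2 := by
    obtain ⟨a, b, h⟩ := hv
    exact ⟨b, b - a, by simp only [rotateLattice]; linear_combination h⟩
  have hm : IsMarkedCurve (rotateMap γ.toMap) := fun s =>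
    rotateSphere_mem_marked.trans (γ.isMarked s)
  have hne' : rotateMap γ.toMap 0 ≠ rotateMap γ.toMap 1 := fun h =>
    hne (rotateSphere_injective h)
  refine ⟨hv', ⟨rotateMap γ.toMap, hm, fun s t h => γ.simple s t (rotateSphere_injective h),
    not_isContractible hm hne'⟩, ?_, hne', ?_⟩
  · exact Set.range_comp rotateSphere γ.toMap
  · have e : (segmentArc (rotateLattice x) (rotateLattice v) hv').toMap =
        rotateMap (segmentArc x v hv).toMap := by
      ext1 s
      change cover _ = rotateSphere (cover _)
      rw [rotateSphere_cover, rotatePlane_segmentMap]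
    apply Quotient.sound
    rcases Quotient.exact he with h | h
    · left
      rw [e]
      exact h.rotateMap
    · right
      rw [e]
      exact h.rotateMap

/-! ### The arcs of lowest complexity -/

theorem trace_segmentArc_inner (hv : IsCoprime ((1 : ℤ), (0 : ℤ)).1 ((1 : ℤ), (0 : ℤ)).2) :
    (segmentArc (0, 1) (1, 0) hv).trace = (fun z : ℂ => (z : Sphere)) '' segment ℝ D L := by
  have key : ∀ s : I, (segmentArc (0, 1) (1, 0) hv).toMap s =
      (((1 - (s : ℝ)) • D + (s : ℝ) • L : ℂ) : Sphere) := by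
    intro s
    have h0 := s.2.1
    have h1 := s.2.2
    change toSphere (weights (segmentMap (0, 1) (1, 0) s)) = _
    have ew : segmentMap (0, 1) (1, 0) s = ((s : ℝ), 1) := by
      simp [segmentMap_apply, toPlane]
    have e : weights ((s : ℝ), 1) = ⟨s, 0, 1 - s⟩ := by
      rw [weights, tri_of_nonneg h0 h1, tri_of_nonneg zero_le_one le_rfl,
        tri_of_one_le (by linarith) (by linarith)]
      congr 1 <;> ring
    have eo : (⟨s, 0, 1 - s⟩ : Weights).o = 0 := by
      simp only [Weights.o]
      ring
    rw [ew, e, toSphere, eo, if_neg zero_ne_one, affinePoint_of_o eo]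
    congr 1
    apply Complex.ext
    · simp [D, L]
      ring
    · simp [D, L]
      ring
  rw [segment_eq_image]
  ext z
  constructor
  · rintro ⟨s, rfl⟩
    exact ⟨_, ⟨s, s.2, rfl⟩, (key s).symm⟩
  · rintro ⟨_, ⟨t, ht, rfl⟩, rfl⟩
    exact ⟨⟨t, ht⟩, key ⟨t, ht⟩⟩

/-- On the edge `OU` with `u = s`, the squared denominator of `affinePoint` gives `U / s`. -/
theorem trace_segmentArc_outer (hv : IsCoprime ((1 : ℤ), (0 : ℤ)).1 ((1 : ℤ), (0 : ℤ)).2) :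
    (segmentArc (0, 0) (1, 0) hv).trace =
      (fun z : ℂ => (z : Sphere)) '' outwardRay U ∪ {OnePoint.infty} := by
  have key : ∀ s : I, (segmentArc (0, 0) (1, 0) hv).toMap s =
      if (s : ℝ) = 0 then OnePoint.infty else ((((1 / s : ℝ) : ℂ) * U : ℂ) : Sphere) := by
    intro s
    have h0 := s.2.1
    have h1 := s.2.2
    change toSphere (weights (segmentMap (0, 0) (1, 0) s)) = _
    have ew : segmentMap (0, 0) (1, 0) s = ((s : ℝ), 0) := by
      simp [segmentMap_apply, toPlane]
    have e : weights ((s : ℝ), 0) = ⟨0, s, 0⟩ := by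
      rw [weights, add_zero, tri_of_nonneg h0 h1, tri_of_nonneg le_rfl zero_le_one]
      congr 1 <;> ring
    have eo : (⟨0, s, 0⟩ : Weights).o = 1 - s := by
      simp only [Weights.o]
      ring
    rw [ew, e, toSphere, eo]
    by_cases hs : (s : ℝ) = 0
    · rw [if_pos (by rw [hs, sub_zero]), if_pos hs]
    · rw [if_neg (by intro h; apply hs; linarith), if_neg hs]
      congr 1
      rw [affinePoint, eo, sub_sub_cancel]
      apply Complex.ext
      · rw [Complex.re_ofReal_mul, U]
        simp only
        field_simp
        ring
      · rw [Complex.im_ofReal_mul, U]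
        field_simp
        ring
  ext z
  constructor
  · rintro ⟨s, rfl⟩
    rw [key]
    split_ifs with hs
    · exact Or.inr rfl
    · left
      have h0 : 0 < (s : ℝ) := lt_of_le_of_ne s.2.1 (Ne.symm hs)
      refine ⟨_, ⟨1 / s, ?_, rfl⟩, rfl⟩
      rw [le_div_iff₀ h0, one_mul]
      exact s.2.2
  · rintro (⟨_, ⟨t, ht, rfl⟩, rfl⟩ | rfl)
    · have t0 : 0 < t := by linarith
      refine ⟨⟨1 / t, by positivity, ?_⟩, ?_⟩
      · rw [div_le_one t0]
        exact ht
      · rw [key, if_neg (by positivity)]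
        simp
    · exact ⟨0, (key 0).trans (if_pos rfl)⟩

/-! ### The drawings of all arcs -/

/-- The drawing on the sphere with the given part in `ℂ`. -/
def sphereDrawing (A : Set ℂ) (ε : Kind) : Set Sphere :=
  (fun z : ℂ => (z : Sphere)) '' A ∪ {x | ε = Kind.outer ∧ x = OnePoint.infty}

theorem rotateSphere_image (A : Set ℂ) (ε : Kind) :
    rotateSphere '' sphereDrawing A ε = sphereDrawing (rotate '' A) ε := by
  ext z
  constructor
  · rintro ⟨_, ⟨w, hw, rfl⟩ | ⟨h, rfl⟩, rfl⟩
    · exact Or.inl ⟨_, ⟨w, hw, rfl⟩, rfl⟩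
    · exact Or.inr ⟨h, rfl⟩
  · rintro (⟨_, ⟨w, hw, rfl⟩, rfl⟩ | ⟨h, rfl⟩)
    · exact ⟨_, Or.inl ⟨w, hw, rfl⟩, rfl⟩
    · exact ⟨_, Or.inr ⟨h, rfl⟩, rfl⟩

/-- The point set is the drawing of an arc of direction `v` and of the given kind. -/
def IsDrawingOf (A : Set ℂ) (ε : Kind) (v : ℤ × ℤ) : Prop :=
  ∃ x, Even (idet v x + ε.parity) ∧ IsTraceOf (sphereDrawing A ε) x v

theorem IsDrawingOf.rotate {A : Set ℂ} {ε : Kind} {v : ℤ × ℤ} (h : IsDrawingOf A ε v) :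
    IsDrawingOf (rotate '' A) ε (rotateLattice v) := by
  obtain ⟨x, hx, ht⟩ := h
  refine ⟨rotateLattice x, by rwa [idet_rotateLattice], ?_⟩
  rw [← rotateSphere_image]
  exact ht.rotate

theorem IsDrawingOf.neg {A : Set ℂ} {ε : Kind} {v : ℤ × ℤ} (h : IsDrawingOf A ε v) :
    IsDrawingOf A ε (-v) := by
  obtain ⟨x, hx, ht⟩ := h
  refine ⟨x + v, ?_, ht.neg⟩
  have e : idet (-v) (x + v) = -idet v x := by
    simp only [idet, Prod.fst_neg, Prod.snd_neg, Prod.fst_add, Prod.snd_add]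
    ring
  obtain ⟨i, hi⟩ := hx
  exact ⟨i - idet v x, by rw [e]; linear_combination hi⟩

theorem isDrawingOf_positiveArc {r s : ℕ} (hr : 0 < r) (hs : 0 < s)
    (hv : IsCoprime (s : ℤ) (r : ℤ)) (ε : Kind) : IsDrawingOf (positiveArc r s ε) ε (s, r) := by
  obtain ⟨u, hu⟩ := exists_idet_eq_one (v := ((s : ℤ), (r : ℤ))) hv
  cases ε with
  | inner =>
    have h : Even (idet ((s : ℤ), (r : ℤ)) u + Kind.inner.parity) := by
      rw [hu]
      exact ⟨1, rfl⟩
    exact ⟨u, h, isTraceOf_drawn hr hs hv h⟩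
  | outer =>
    have h : Even (idet ((s : ℤ), (r : ℤ)) 0 + Kind.outer.parity) := by
      simp [idet, Kind.parity]
    exact ⟨0, h, isTraceOf_drawn hr hs hv h⟩

theorem isDrawingOf_lowArc (ε : Kind) : IsDrawingOf (lowArc L D U ε) ε (1, 0) := by
  have hv : IsCoprime ((1 : ℤ), (0 : ℤ)).1 ((1 : ℤ), (0 : ℤ)).2 := isCoprime_one_left
  cases ε with
  | inner =>
    refine ⟨(0, 1), ⟨1, rfl⟩, ?_⟩
    have e : sphereDrawing (lowArc L D U Kind.inner) Kind.inner =
        (segmentArc (0, 1) (1, 0) hv).trace := by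
      rw [trace_segmentArc_inner, sphereDrawing, segment_symm]
      simp [lowArc]
    rw [e]
    exact isTraceOf_segmentArc _ hv
  | outer =>
    refine ⟨(0, 0), ⟨0, rfl⟩, ?_⟩
    have e : sphereDrawing (lowArc L D U Kind.outer) Kind.outer =
        (segmentArc (0, 0) (1, 0) hv).trace := by
      rw [trace_segmentArc_outer, sphereDrawing]
      simp [lowArc]
    rw [e]
    exact isTraceOf_segmentArc _ hv

theorem rotate_L : rotate L = D := by
  apply Complex.ext <;> simp [rotate, L, D]

theorem rotate_D : rotate D = U := by
  apply Complex.ext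
  · rw [rotate, Complex.mul_re]
    simp only [D, U]
    linear_combination sqrt_three_sq / 4
  · rw [rotate, Complex.mul_im]
    simp only [D, U]
    ring

theorem rotate_U : rotate U = L := by
  apply Complex.ext
  · rw [rotate, Complex.mul_re]
    simp only [U, L, Complex.neg_re, Complex.one_re]
    linear_combination -sqrt_three_sq / 4
  · rw [rotate, Complex.mul_im]
    simp only [U, L, Complex.neg_im, Complex.one_im]
    ring

theorem rotate_lowArc (a b c : ℂ) (ε : Kind) :
    rotate '' lowArc a b c ε = lowArc (rotate a) (rotate b) (rotate c) ε := by
  cases ε with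
  | inner =>
    have : rotate = (LinearMap.mulLeft ℝ (⟨-(1 / 2), √3 / 2⟩ : ℂ)).toAffineMap := rfl
    change rotate '' segment ℝ a b = segment ℝ (rotate a) (rotate b)
    rw [this]
    exact image_segment ℝ _ a b
  | outer =>
    ext z
    constructor
    · rintro ⟨_, ⟨t, ht, rfl⟩, rfl⟩
      exact ⟨t, ht, mul_left_comm _ _ _⟩
    · rintro ⟨t, ht, rfl⟩
      exact ⟨_, ⟨t, ht, rfl⟩, mul_left_comm _ _ _⟩

theorem lowArc_symm (a b c : ℂ) (ε : Kind) : lowArc a b c ε = lowArc b a c ε := by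
  cases ε with
  | inner => exact segment_symm ℝ a b
  | outer => rfl

/-- Up to sign, `rotateLattice` permutes `(1, 0)`, `(1, -1)`, `(0, 1)` cyclically. It maps `(-r, r +
s)` to `(s, r)` and `(-(r + s), s)` to `(-r, r + s)`, so one or two rotations lead from a positive
slope to any negative one. -/
theorem isDrawingOf_planarArc {r s : ℤ} (h : IsCoprime s r) (hs : 0 ≤ s) (hr : s = 0 → r = 1)
    (ε : Kind) : IsDrawingOf (planarArc r s ε) ε (s, r) := by
  have h0 := isDrawingOf_lowArc ε
  have h1 := h0.rotate
  have h2 := h1.rotate.neg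
  rw [rotate_lowArc, rotate_L, rotate_D, rotate_U] at h1
  rw [rotate_lowArc, rotate_lowArc, rotate_L, rotate_D, rotate_U, rotate_L, lowArc_symm] at h2
  have pos : ∀ a b : ℤ, 0 < a → 0 < b → IsCoprime b a →
      IsDrawingOf (positiveArc a.natAbs b.natAbs ε) ε (b, a) := by
    intro a b ha hb hc
    have := isDrawingOf_positiveArc (r := a.natAbs) (s := b.natAbs) (by lia) (by lia)
      (by rwa [Int.natAbs_of_nonneg ha.le, Int.natAbs_of_nonneg hb.le]) ε
    rwa [Int.natAbs_of_nonneg ha.le, Int.natAbs_of_nonneg hb.le] at this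
  rw [planarArc]
  split_ifs with c1 c2 c3 c4 c5
  · subst c1
    have : s = 1 := by
      rw [isCoprime_zero_right, Int.isUnit_iff] at h
      lia
    rw [this]
    exact h0
  · rw [c2, hr c2]
    exact h2
  · obtain rfl : r = -s := by lia
    have : s = 1 := by
      rw [IsCoprime.neg_right_iff, isCoprime_self, Int.isUnit_iff] at h
      lia
    rw [this, lowArc_symm]
    exact h1
  · exact pos r s c4 (by lia) h
  · have hc : IsCoprime (-r) (r + s) := by
      obtain ⟨a, b, e⟩ := h
      exact ⟨a - b, a, by linear_combination e⟩
    have := (pos (r + s) (-r) c5 (by lia) hc).rotate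
    rw [Int.natAbs_neg] at this
    convert this using 1
    simp [rotateLattice]
  · have hc : IsCoprime (-(r + s)) s := by
      obtain ⟨a, b, e⟩ := h
      exact ⟨-b, a - b, by linear_combination e⟩
    have := (pos s (-(r + s)) (by lia) (by lia) hc).rotate.rotate
    rw [Int.natAbs_neg] at this
    convert this using 1
    simp [rotateLattice]

/-! ### Slopes as primitive lattice directions. -/

theorem isCoprime_slope (p : OnePoint ℚ) : IsCoprime (slopeDen p) (slopeNum p) := by
  induction p using OnePoint.rec with
  | infty => exact isCoprime_one_right
  | coe q =>
    have : IsCoprime q.num (q.den : ℤ) := Int.isCoprime_iff_gcd_eq_one.2 q.reduced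
    exact this.symm

theorem isDrawingOf_slope (p : OnePoint ℚ) (ε : Kind) :
    IsDrawingOf (planarArc (slopeNum p) (slopeDen p) ε) ε (slopeDen p, slopeNum p) := by
  refine isDrawingOf_planarArc (isCoprime_slope p) ?_ ?_ ε
  · induction p using OnePoint.rec with
    | infty => exact le_rfl
    | coe q => exact Int.natCast_nonneg _
  · induction p using OnePoint.rec with
    | infty => exact fun _ => rfl
    | coe q =>
      intro h
      have : (q.den : ℤ) = 0 := h
      have := q.den_pos
      lia

theorem eq_of_idet_eq_zero {p q : OnePoint ℚ}
    (h : idet (slopeDen p, slopeNum p) (slopeDen q, slopeNum q) = 0) : p = q := by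
  have hd : ∀ q : ℚ, (q.den : ℤ) ≠ 0 := fun q => by exact_mod_cast q.den_ne_zero
  induction p using OnePoint.rec with
  | infty =>
    induction q using OnePoint.rec with
    | infty => rfl
    | coe q =>
      have h : (0 : ℤ) * q.num - 1 * (q.den : ℤ) = 0 := h
      exact absurd (by linarith) (hd q)
  | coe p =>
    induction q using OnePoint.rec with
    | infty =>
      have h : (p.den : ℤ) * 1 - p.num * 0 = 0 := h
      exact absurd (by linarith) (hd p)
    | coe q =>
      have h : (p.den : ℤ) * q.num - p.num * (q.den : ℤ) = 0 := h
      congr 1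
      rw [Rat.eq_iff_mul_eq_mul]
      linarith

end FourPuncturedSphere

end

/-! ### The compatibility criterion. -/

theorem mainTheorem10 (p q : OnePoint ℚ) (ε φ : FourPuncturedSphere.Kind) :
    ∃ α β : FourPuncturedSphere.Arc,
      α.IsDrawnAs (FourPuncturedSphere.drawing p ε) ∧
      β.IsDrawnAs (FourPuncturedSphere.drawing q φ) ∧
      (FourPuncturedSphere.Compatible α β ↔
        FourPuncturedSphere.slopeDist p q ≤ if ε = φ then 2 else 1) := by
  open FourPuncturedSphere in
  obtain ⟨x, hx, hX⟩ := isDrawingOf_slope p ε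
  obtain ⟨y, hy, hY⟩ := isDrawingOf_slope q φ
  obtain ⟨hv, hα⟩ := hX.isDrawnAs
  obtain ⟨hv', hβ⟩ := hY.isDrawnAs
  refine ⟨_, _, hα, hβ, ?_⟩
  have hdist : slopeDist p q = |idet (slopeDen p, slopeNum p) (slopeDen q, slopeNum q)| := by
    rw [slopeDist, idet]
    congr 1
    ring
  -- The parity of the determinant with the base point encodes the kind, which matches the two
  -- bounds for straight arcs with those of the theorem.
  have hpar : Even (idet (slopeDen p, slopeNum p) x - idet (slopeDen q, slopeNum q) y) ↔ ε = φ := by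
    obtain ⟨i, hi⟩ := hx
    obtain ⟨j, hj⟩ := hy
    constructor
    · rintro ⟨k, hk⟩
      cases ε <;> cases φ <;> simp only [Kind.parity] at hi hj <;> first | rfl | lia
    · rintro rfl
      exact ⟨i - j, by linear_combination hi - hj⟩
  rw [hdist]
  constructor
  · intro h
    have := abs_idet_le_of_compatible h
    simpa only [hpar] using this
  · intro h
    by_cases h0 : idet (slopeDen p, slopeNum p) (slopeDen q, slopeNum q) = 0
    · obtain rfl := eq_of_idet_eq_zero h0
      by_cases he : ε = φ
      · subst he
        left
        -- The base points `x` and `y` may differ, but both arcs have the same drawing, and a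
        -- drawing determines its arc.
        obtain ⟨γ, hγ, e⟩ := (hα _).2 rfl
        rw [← e]
        exact (hβ _).1 ⟨γ, hγ, rfl⟩
      · exact compatible_of_odd hv (mt hpar.1 he)
    · exact compatible_of_abs_idet_le hv hv' h0 (by simpa only [hpar] using h)
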